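/- Let $N\ge 3$ and let $\mathcal E=\dot H^1_{\mathrm{rad}}(\mathbb R^N)\times L^2_{\mathrm{rad}}(\mathbb R^N)$ be the space of real radial pairs $\boldsymbol u=(u,\dot u)$, with $\|\boldsymbol u\|_{\mathcal E}^2=\|\nabla u\|_{L^2}^2+\|\dot u\|_{L^2}^2$. Put $f(u)=|u|^{\frac4{N-2}}u$, $F(u)=\frac{N-2}{2N}|u|^{\frac{2N}{N-2}}$ and $$E(\boldsymbol u)=\int_{\mathbb R^N}\tfrac12|\dot u|^2+\tfrac12|\nabla u|^2-F(u)\,\mathrm dx .$$ Let $\langle \mathrm D^2E(\boldsymbol U)\boldsymbol g,\boldsymbol g\rangle=\frac{d^2}{dt^2}\big|_{t=0}E(\boldsymbol U+t\boldsymbol g)$ denote the Hessian quadratic form. Let $\langle v,w\rangle=\int_{\mathbb R^N} vw\,\mathrm dx$ and $\langle(\alpha,\dot\alpha),(g,\dot g)\rangle=\langle\alpha,g\rangle+\langle\dot\alpha,\dot g\rangle$. For $\lambda>0$ write $v_\lambda(x)=\lambda^{-\frac{N-2}2}v(x/\lambda)$ and $v_{\underline\lambda}(x)=\lambda^{-\frac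 N2}v(x/\lambda)$. Let $$W(x)=\Big(1+\frac{|x|^2}{N(N-2)}\Big)^{-\frac{N-2}2},\qquad \boldsymbol W_\lambda=(W_\lambda,0),\qquad \Lambda W=\Big(\frac N2-1\Big)W+x\cdot\nabla W .$$ Let $-\nu^2$ ($\nu>0$) be the strictly negative eigenvalue of $L=-\Delta-f'(W)$ and let $\mathcal Y\in H^1(\mathbb R^N)$ be the corresponding positive eigenfunction, $L\mathcal Y=-\nu^2\mathcal Y$, with $\|\mathcal Y\|_{L^2}=1$. Set $$\alpha^{\pm}_\lambda=\tfrac12\Big(\frac\nu\lambda\mathcal Y_{\underline\lambda},\ \pm\mathcal Y_{\underline\lambda}\Big).$$ Finally, fix $\mathcal Z\in C_0^\infty(\mathbb R^N)$ with $\langle\mathcal Z,\Lambda W\rangle>0$ and $\langle\mathcal Z,\mathcal Y\rangle=0$. **Lemma.** There exist constants $\lambda_0,\eta,c>0$ (depending only on $N$ and $\mathcal Z$) such that for all $\lambda_1,\lambda_2>0$ with $\lambda_1/\lambda_2<\lambda_0$, all $\boldsymbol U\in\mathcal E$ with $\|\boldsymbol U-(\boldsymbol W_{\lambda_2}-\boldsymbol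 W_{\lambda_1})\|_{\mathcal E}<\eta$, and all $\boldsymbol g=(g,\dot g)\in\mathcal E$ with $\langle\mathcal Z_{\underline{\lambda_1}},g\rangle=\langle\mathcal Z_{\underline{\lambda_2}},g\rangle=0$, $$\tfrac12\langle\mathrm D^2E(\boldsymbol U)\boldsymbol g,\boldsymbol g\rangle+2\Big(\langle\alpha^-_{\lambda_1},\boldsymbol g\rangle^2+\langle\alpha^+_{\lambda_1},\boldsymbol g\rangle^2+\langle\alpha^-_{\lambda_2},\boldsymbol g\rangle^2+\langle\alpha^+_{\lambda_2},\boldsymbol g\rangle^2\Big)\ \ge\ c\,\|\boldsymbol g\|_{\mathcal E}^2 .$$ -/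

import Mathlib

open MeasureTheory
open scoped ContDiff

noncomputable section

namespace TwoBubble

/-- The Euclidean space `ℝ^N`. -/
abbrev Space (N : ℕ) := EuclideanSpace ℝ (Fin N)

/-- Pairs `(v, v')` of real functions on `ℝ^N` (position and velocity components). -/
abbrev Pair (N : ℕ) := (Space N → ℝ) × (Space N → ℝ)

/-- Test functions: smooth and compactly supported. -/
def IsTest {N : ℕ} (φ : Space N → ℝ) : Prop :=
  ContDiff ℝ ∞ φ ∧ HasCompactSupport φ

/-! ### Weak gradients and the energy space -/

/-- `G` is the weak (distributional) gradient of `u`. -/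
def HasWeakGradient {N : ℕ} (u : Space N → ℝ) (G : Space N → Space N) : Prop :=
  LocallyIntegrable u volume ∧ LocallyIntegrable G volume ∧
    ∀ φ : Space N → ℝ, IsTest φ → ∫ x, u x • gradient φ x = -∫ x, φ x • G x

/-- Weak gradients are unique almost everywhere. -/
theorem HasWeakGradient.ae_eq {N : ℕ} {u : Space N → ℝ} {G H : Space N → Space N}
    (hG : HasWeakGradient u G) (hH : HasWeakGradient u H) : G =ᵐ[volume] H := by
  refine ae_eq_of_integral_contDiff_smul_eq hG.2.1 hH.2.1 fun φ h1 h2 => ?_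
  have e := (hG.2.2 φ ⟨h1, h2⟩).symm.trans (hH.2.2 φ ⟨h1, h2⟩)
  exact neg_injective e

open Classical in
/-- The weak gradient of `u` (`0` if there is none). -/
def weakGradient {N : ℕ} (u : Space N → ℝ) : Space N → Space N :=
  if h : ∃ G, HasWeakGradient u G then h.choose else 0

theorem hasWeakGradient_weakGradient {N : ℕ} {u : Space N → ℝ} {G : Space N → Space N}
    (h : HasWeakGradient u G) : HasWeakGradient u (weakGradient u) := by
  have h' : ∃ G, HasWeakGradient u G := ⟨G, h⟩
  rw [weakGradient, dif_pos h']
  exact h'.choose_spec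

/-- The space `Ḣ¹(ℝ^N)`, `N ≥ 3`: functions in `L^{2N/(N-2)}` with weak gradient in `L²`
(equivalently, the completion of the test functions for the norm `‖∇u‖_{L²}`). -/
def MemHDot1 {N : ℕ} (u : Space N → ℝ) : Prop :=
  MemLp u (ENNReal.ofReal (2 * N / (N - 2))) volume ∧
    ∃ G, HasWeakGradient u G ∧ MemLp G 2 volume

/-- The space `H¹(ℝ^N)`. -/
def MemH1 {N : ℕ} (u : Space N → ℝ) : Prop :=
  MemLp u 2 volume ∧ ∃ G, HasWeakGradient u G ∧ MemLp G 2 volume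

/-- `u` is radially symmetric (as an almost everywhere class). -/
def IsRadial {N : ℕ} (u : Space N → ℝ) : Prop :=
  ∃ φ : ℝ → ℝ, ∀ᵐ x : Space N, u x = φ ‖x‖

/-- Membership in the radial energy space `ℰ = Ḣ¹_rad × L²_rad`. -/
def MemEnergySpace {N : ℕ} (u : Pair N) : Prop :=
  (MemHDot1 u.1 ∧ IsRadial u.1) ∧ (MemLp u.2 2 volume ∧ IsRadial u.2)

/-- The norm `‖(u, v)‖_ℰ = (‖∇u‖²_{L²} + ‖v‖²_{L²})^{1/2}`. -/
def energyNorm {N : ℕ} (u : Pair N) : ℝ :=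
  Real.sqrt ((∫ x, ‖weakGradient u.1 x‖ ^ 2) + ∫ x, u.2 x ^ 2)

/-! ### The energy functional and its Hessian -/

/-- `f(u) = |u|^{4/(N-2)} u`. -/
def nonlin (N : ℕ) (u : ℝ) : ℝ := |u| ^ (4 / ((N : ℝ) - 2)) * u

/-- `F(u) = (N-2)/(2N) |u|^{2N/(N-2)}`. -/
def potential (N : ℕ) (u : ℝ) : ℝ :=
  ((N : ℝ) - 2) / (2 * N) * |u| ^ (2 * (N : ℝ) / ((N : ℝ) - 2))

/-- `E(u, v) = ∫ ½ v² + ½ |∇u|² - F(u)`. -/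
def energy {N : ℕ} (u : Pair N) : ℝ :=
  ∫ x, (1 / 2 * u.2 x ^ 2 + 1 / 2 * ‖weakGradient u.1 x‖ ^ 2 - potential N (u.1 x))

/-- The Hessian quadratic form `⟨D²E(U) g, g⟩`, the second derivative at `t = 0` of
`t ↦ E(U + t g)`. -/
def hessian {N : ℕ} (U g : Pair N) : ℝ :=
  iteratedDeriv 2 (fun t : ℝ => energy (U + t • g)) 0

/-! ### Scalings, ground states and the linearized operator -/

/-- `v_λ(x) = λ^{-(N-2)/2} v(x/λ)`. -/
def scaleHDot1 {N : ℕ} (r : ℝ) (v : Space N → ℝ) : Space N → ℝ :=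
  fun x => r ^ (-(((N : ℝ) - 2) / 2)) * v (r⁻¹ • x)

/-- `v_{\underline λ}(x) = λ^{-N/2} v(x/λ)`. -/
def scaleL2 {N : ℕ} (r : ℝ) (v : Space N → ℝ) : Space N → ℝ :=
  fun x => r ^ (-((N : ℝ) / 2)) * v (r⁻¹ • x)

/-- `(v, v')_λ = (v_λ, v'_{\underline λ})`. -/
def scalePair {N : ℕ} (r : ℝ) (v : Pair N) : Pair N :=
  (scaleHDot1 r v.1, scaleL2 r v.2)

/-- The ground state `W(x) = (1 + |x|²/(N(N-2)))^{-(N-2)/2}`. -/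
def W (N : ℕ) : Space N → ℝ :=
  fun x => (1 + ‖x‖ ^ 2 / ((N : ℝ) * ((N : ℝ) - 2))) ^ (-(((N : ℝ) - 2) / 2))

/-- The rescaled stationary state, the pair `(W, 0)_λ`. -/
def bubble (N : ℕ) (r : ℝ) : Pair N := scalePair r (W N, 0)

/-- `Λv = (N/2 - 1) v + x · ∇v`. -/
def scalingGenerator {N : ℕ} (v : Space N → ℝ) : Space N → ℝ :=
  fun x => ((N : ℝ) / 2 - 1) * v x + fderiv ℝ v x x

/-- `⟨v, w⟩ = ∫ v w`. -/
def pairing {N : ℕ} (v w : Space N → ℝ) : ℝ := ∫ x, v x * w x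

/-- `⟨(α, α'), (g, g')⟩ = ⟨α, g⟩ + ⟨α', g'⟩`. -/
def pairing₂ {N : ℕ} (α g : Pair N) : ℝ := pairing α.1 g.1 + pairing α.2 g.2

/-- `-ν²` (`ν > 0`) is a strictly negative eigenvalue of `L = -Δ - f'(W)` and `Y ∈ H¹` is a
positive eigenfunction of it with `‖Y‖_{L²} = 1`; the equation `L Y = -ν² Y` is understood in the
weak sense. -/
structure IsNegativeEigenpair (N : ℕ) (ν : ℝ) (Y : Space N → ℝ) : Prop where
  nu_pos : 0 < ν
  memH1 : MemH1 Y
  pos : ∀ᵐ x : Space N, 0 < Y x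
  normalized : ∫ x, Y x ^ 2 = 1
  eigen : ∀ φ : Space N → ℝ, IsTest φ →
    (∫ x, inner ℝ (weakGradient Y x) (gradient φ x)) - (∫ x, deriv (nonlin N) (W N x) * Y x * φ x)
      = -ν ^ 2 * ∫ x, Y x * φ x

/-- `α⁻_λ = ½ ((ν/λ) Y_{\underline λ}, -Y_{\underline λ})`. -/
def alphaMinus {N : ℕ} (ν : ℝ) (Y : Space N → ℝ) (r : ℝ) : Pair N :=
  (1 / 2 : ℝ) • ((ν / r) • scaleL2 r Y, -scaleL2 r Y)

/-- `α⁺_λ = ½ ((ν/λ) Y_{\underline λ}, Y_{\underline λ})`. -/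
def alphaPlus {N : ℕ} (ν : ℝ) (Y : Space N → ℝ) (r : ℝ) : Pair N :=
  (1 / 2 : ℝ) • ((ν / r) • scaleL2 r Y, scaleL2 r Y)

end TwoBubble

end

/-!
The proof reduces the estimate to a coercivity statement for a quadratic form in the first component
of `g`. Differentiating under the integral, the Hessian at `U` is
`∫ ġ² + ∫ |∇g|² - p ∫ |U|^{4/(N-2)} g²` with `p = (N+2)/(N-2)` (`hessian_eq`). For `U` close to
`W_{λ₂} - W_{λ₁}`, the potential is at most the sum of the potentials of the two bubbles, up to
`δ ∫ |∇g|²`, by Hölder's and Sobolev's inequalities (`exists_potential_le`). The difference of two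
positive functions is bounded by their maximum, so no smallness of the interaction is needed here.

To separate the scales, `g` is split as `cos θ g`, `sin θ g` with an angle `θ` that passes from `0`
to `π/2` between the scales `λ₁` and `λ₂`, slowly on the logarithmic scale (`cutAngle`). By the IMS
formula and Hardy's inequality this costs `O(ε²) ∫ |∇g|²` (`ims`, `hardy`, `localization_le`). After
rescaling, the cutoffs tend to `1` as `λ₁/λ₂ → 0`, so each piece is controlled by the coercivity of
the linearized form around a single bubble (`IsNegativeEigenpair.coercive`,
`IsNegativeEigenpair.two_coercive`).

For a single bubble, the starting point is a spectral gap for the weighted problem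
`-Δu = μ W^{4/(N-2)} u` on radial functions. The first two radial eigenfunctions are `W` and `ΛW`,
with `μ = 1` and `μ = p`; the third is an explicit function `psi2` with eigenvalue `mu2 > p` and two
nodal spheres. For functions vanishing on these spheres the Jacobi inequality
`∫ |∇h|² - V h² = ∫ ψ² |∇(h/ψ)|² ≥ 0` (`jacobi_inequality`) gives the Poincaré inequality with
constant `mu2`; a radial function can be brought to vanish there by subtracting a combination of `W`
and `ΛW`, and these are exactly the directions for which the form `gapForm` is corrected
(`gapForm_nonneg`). No spectral theory is used. Consequently, on radial functions, `L` is positive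
definite on the complement of `W` and `ΛW`, negative along `W`, and zero along `ΛW`. The
Cauchy–Schwarz inequality against the negative eigenfunction `Y` shows that orthogonality to `Y`
removes the negative direction (`IsNegativeEigenpair.exists_qform_ge`), and orthogonality to `Z`
removes the kernel because `⟨Z, ΛW⟩ ≠ 0`.

Two facts about `Y` have to be derived from the weak equation. It decays
(`IsNegativeEigenpair.decay`, by testing against weighted multiples of `Y`), so pairing with it is
continuous on `Ḣ¹`; and it is radial (`IsNegativeEigenpair.inv`), because `L` is nonnegative on
functions that are odd with respect to a hyperplane (`odd_test_nonneg`, the Jacobi inequality with a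
derivative of `W`). Inequalities proved for radial test functions pass to radial functions in `Ḣ¹`
by density (`nonneg_of_radial_test`).
-/

noncomputable section

namespace TwoBubble

open Filter Topology
open scoped ENNReal NNReal Convolution

variable {N : ℕ}

/-! ### Gradients of smooth functions -/

theorem inner_gradient_apply (f : Space N → ℝ) (x e : Space N) :
    inner ℝ (gradient f x) e = fderiv ℝ f x e := inner_gradient_left

theorem norm_gradient_eq (f : Space N → ℝ) (x : Space N) : ‖gradient f x‖ = ‖fderiv ℝ f x‖ := by
  simp [gradient]

theorem gradient_add' {f g : Space N → ℝ} {x : Space N} (hf : DifferentiableAt ℝ f x)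
    (hg : DifferentiableAt ℝ g x) : gradient (f + g) x = gradient f x + gradient g x := by
  simp only [gradient, fderiv_add hf hg, map_add]

theorem gradient_sub' {f g : Space N → ℝ} {x : Space N} (hf : DifferentiableAt ℝ f x)
    (hg : DifferentiableAt ℝ g x) : gradient (f - g) x = gradient f x - gradient g x := by
  simp only [gradient, fderiv_sub hf hg, map_sub]

theorem gradient_smul' {f : Space N → ℝ} {x : Space N} (c : ℝ) (hf : DifferentiableAt ℝ f x) :
    gradient (c • f) x = c • gradient f x := by
  simp only [gradient, fderiv_const_smul hf c, map_smul]

theorem gradient_mul' {f g : Space N → ℝ} {x : Space N} (hf : DifferentiableAt ℝ f x)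
    (hg : DifferentiableAt ℝ g x) :
    gradient (fun y => f y * g y) x = f x • gradient g x + g x • gradient f x := by
  simp only [gradient, fderiv_fun_mul hf hg, map_add, map_smul]

theorem gradient_comp' {f : Space N → ℝ} {k : ℝ → ℝ} {k' : ℝ} {x : Space N}
    (hk : HasDerivAt k k' (f x)) (hf : DifferentiableAt ℝ f x) :
    gradient (fun y => k (f y)) x = k' • gradient f x := by
  have h := (hk.hasFDerivAt.comp x hf.hasFDerivAt).fderiv
  simp only [Function.comp_def] at h
  refine ext_inner_right ℝ fun e => ?_
  rw [inner_gradient_apply, h, inner_smul_left, inner_gradient_apply]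
  simp [mul_comm]

theorem continuous_gradient {f : Space N → ℝ} (hf : ContDiff ℝ ∞ f) : Continuous (gradient f) :=
  (InnerProductSpace.toDual ℝ (Space N)).symm.continuous.comp (hf.continuous_fderiv (by simp))

theorem _root_.ContDiff.diffAt {f : Space N → ℝ} (hf : ContDiff ℝ ∞ f) (x : Space N) :
    DifferentiableAt ℝ f x := (hf.differentiable (by simp)) x

theorem gradient_hasCompactSupport {f : Space N → ℝ} (hf : HasCompactSupport f) :
    HasCompactSupport (gradient f) := by
  have := hf.fderiv ℝ
  exact this.comp_left (g := (InnerProductSpace.toDual ℝ (Space N)).symm) (map_zero _)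

theorem gradient_comp_isometry {f : Space N → ℝ} (hf : ContDiff ℝ ∞ f)
    (R : Space N ≃ₗᵢ[ℝ] Space N) (x : Space N) :
    gradient (f ∘ R) x = R.symm (gradient f (R x)) := by
  refine ext_inner_right ℝ fun e => ?_
  rw [inner_gradient_apply, LinearIsometryEquiv.inner_map_eq_flip, LinearIsometryEquiv.symm_symm,
    inner_gradient_apply]
  have : HasFDerivAt (f ∘ R) ((fderiv ℝ f (R x)).comp (R : Space N →L[ℝ] Space N)) x :=
    (hf.diffAt (R x)).hasFDerivAt.comp x (R : Space N ≃L[ℝ] Space N).hasFDerivAt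
  rw [this.fderiv]; rfl

/-! ### Test functions -/

namespace IsTest
variable {φ ψ : Space N → ℝ}

theorem add (h : IsTest φ) (h' : IsTest ψ) : IsTest (φ + ψ) := ⟨h.1.add h'.1, h.2.add h'.2⟩

theorem smul (c : ℝ) (h : IsTest φ) : IsTest (c • φ) := by
  refine ⟨contDiff_const.smul h.1, h.2.comp_left (g := fun y => c * y) (by simp)⟩

theorem sub (h : IsTest φ) (h' : IsTest ψ) : IsTest (φ - ψ) := by
  have := h.add (h'.smul (-1))
  simpa [sub_eq_add_neg] using this

theorem mul_left (h : IsTest φ) (hψ : ContDiff ℝ ∞ ψ) : IsTest (fun x => ψ x * φ x) :=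
  ⟨hψ.mul h.1, h.2.mul_left⟩

theorem comp_isometry (h : IsTest φ) (R : Space N ≃ₗᵢ[ℝ] Space N) : IsTest (φ ∘ R) :=
  ⟨h.1.comp (R : Space N ≃L[ℝ] Space N).contDiff,
    h.2.comp_homeomorph R.toHomeomorph⟩

theorem continuous (h : IsTest φ) : Continuous φ := h.1.continuous

theorem memLp (h : IsTest φ) (p : ℝ≥0∞) : MemLp φ p volume :=
  h.continuous.memLp_of_hasCompactSupport h.2

theorem memLp_gradient (h : IsTest φ) (p : ℝ≥0∞) : MemLp (gradient φ) p volume :=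
  (continuous_gradient h.1).memLp_of_hasCompactSupport (gradient_hasCompactSupport h.2)

theorem integrable_mul (h : IsTest φ) {a : Space N → ℝ} (ha : Continuous a) :
    Integrable (fun x => a x * φ x) volume :=
  (ha.mul h.continuous).integrable_of_hasCompactSupport h.2.mul_left

theorem integrable_inner (h : IsTest φ) {G : Space N → Space N} (ha : Continuous G) :
    Integrable (fun x => inner ℝ (G x) (gradient φ x)) volume := by
  refine (ha.inner (continuous_gradient h.1)).integrable_of_hasCompactSupport ?_
  refine (gradient_hasCompactSupport h.2).mono fun x hx => ?_
  simp only [Function.mem_support] at hx ⊢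
  contrapose! hx
  simp [hx]

end IsTest

/-- Integration by parts of a directional derivative against a test function. -/
theorem integral_mul_fderiv_test {a η : Space N → ℝ} (ha : ContDiff ℝ ∞ a) (hη : IsTest η)
    (e : Space N) :
    ∫ x, a x * fderiv ℝ η x e = -∫ x, fderiv ℝ a x e * η x := by
  have c1 : Continuous fun x => fderiv ℝ a x e :=
    (ha.continuous_fderiv (by simp)).clm_apply continuous_const
  have c2 : Continuous fun x => fderiv ℝ η x e :=
    (hη.1.continuous_fderiv (by simp)).clm_apply continuous_const
  refine integral_mul_fderiv_eq_neg_fderiv_mul_of_integrable (hη.integrable_mul c1) ?_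
    (hη.integrable_mul ha.continuous) (fun x _ => ha.diffAt x) (fun x _ => hη.1.diffAt x)
  refine (ha.continuous.mul c2).integrable_of_hasCompactSupport ?_
  exact ((hη.2.fderiv ℝ).comp_left (g := fun L : Space N →L[ℝ] ℝ => L e) (by simp)).mul_left

/-- Integration by parts of the radial derivative `x · ∇` against a test function. -/
theorem integral_mul_fderiv_self_test {a η : Space N → ℝ} (ha : ContDiff ℝ ∞ a) (hη : IsTest η) :
    ∫ x, a x * fderiv ℝ η x x = -∫ x, (N * a x + fderiv ℝ a x x) * η x := by
  have hb : ∀ i : Fin N, ContDiff ℝ ∞ fun x : Space N => a x * x i := fun i =>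
    ha.mul (EuclideanSpace.proj (𝕜 := ℝ) i).contDiff
  have hx : ∀ x : Space N, x = ∑ i, x i • EuclideanSpace.single i (1 : ℝ) := fun x => by
    simpa using ((EuclideanSpace.basisFun (Fin N) ℝ).sum_repr x).symm
  have h1 : ∀ (i : Fin N) (x : Space N), fderiv ℝ (fun x : Space N => a x * x i) x
      (EuclideanSpace.single i (1 : ℝ)) = a x + fderiv ℝ a x (EuclideanSpace.single i 1) * x i := by
    intro i x
    have hp : HasFDerivAt (fun x : Space N => x i) (EuclideanSpace.proj (𝕜 := ℝ) i) x :=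
      (EuclideanSpace.proj (𝕜 := ℝ) i).hasFDerivAt
    rw [((ha.diffAt x).hasFDerivAt.fun_mul hp).fderiv]
    simp [mul_comm]
  have e1 : ∀ x, a x * fderiv ℝ η x x =
      ∑ i : Fin N, (a x * x i) * fderiv ℝ η x (EuclideanSpace.single i (1 : ℝ)) := fun x => by
    conv_lhs => rw [show fderiv ℝ η x x = fderiv ℝ η x (∑ i, x i • EuclideanSpace.single i (1 : ℝ))
      from by rw [← hx x]]
    simp [Finset.mul_sum, mul_assoc]
  have e2 : ∀ x, (N * a x + fderiv ℝ a x x) * η x = ∑ i : Fin N,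
      fderiv ℝ (fun x : Space N => a x * x i) x (EuclideanSpace.single i (1 : ℝ)) * η x :=
    fun x => by
    conv_lhs => rw [show fderiv ℝ a x x = fderiv ℝ a x (∑ i, x i • EuclideanSpace.single i (1 : ℝ))
      from by rw [← hx x]]
    simp only [h1, map_sum, map_smul, smul_eq_mul]
    rw [← Finset.sum_mul, Finset.sum_add_distrib]
    simp [mul_comm]
  simp_rw [e1, e2]
  rw [integral_finsetSum, integral_finsetSum, ← Finset.sum_neg_distrib]
  · exact Finset.sum_congr rfl fun i _ => integral_mul_fderiv_test (hb i) hη _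
  · intro i _
    exact hη.integrable_mul (((hb i).continuous_fderiv (by simp)).clm_apply continuous_const)
  · intro i _
    have c2 : Continuous fun x => fderiv ℝ η x (EuclideanSpace.single i (1 : ℝ)) :=
      (hη.1.continuous_fderiv (by simp)).clm_apply continuous_const
    refine ((hb i).continuous.mul c2).integrable_of_hasCompactSupport ?_
    exact ((hη.2.fderiv ℝ).comp_left
      (g := fun L : Space N →L[ℝ] ℝ => L (EuclideanSpace.single i (1 : ℝ))) (by simp)).mul_left

/-! ### Weak gradients -/

theorem hasWeakGradient_gradient {v : Space N → ℝ} (hv : ContDiff ℝ ∞ v) :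
    HasWeakGradient v (gradient v) := by
  refine ⟨hv.continuous.locallyIntegrable, (continuous_gradient hv).locallyIntegrable,
    fun φ hφ => ext_inner_right ℝ fun e => ?_⟩
  have i1 : Integrable (fun x => v x • gradient φ x) volume :=
    (hv.continuous.smul (continuous_gradient hφ.1)).integrable_of_hasCompactSupport
      (gradient_hasCompactSupport hφ.2).smul_left
  have i2 : Integrable (fun x => φ x • gradient v x) volume :=
    (hφ.continuous.smul (continuous_gradient hv)).integrable_of_hasCompactSupport
      hφ.2.smul_right
  rw [inner_neg_left, real_inner_comm, ← integral_inner i1, real_inner_comm, ← integral_inner i2]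
  have hc : ∀ (f : Space N → ℝ) x, inner ℝ e (gradient f x) = fderiv ℝ f x e := fun f x => by
    rw [real_inner_comm, inner_gradient_apply]
  simp only [inner_smul_right, hc]
  rw [integral_mul_fderiv_test hv hφ]
  simp only [mul_comm]

theorem _root_.MeasureTheory.LocallyIntegrable.integrable_smul_test {F : Type*}
    [NormedAddCommGroup F] [NormedSpace ℝ F] {G : Space N → F}
    (hG : LocallyIntegrable G volume) {φ : Space N → ℝ} (hc : Continuous φ)
    (hφ : HasCompactSupport φ) : Integrable (fun x => φ x • G x) volume :=
  hG.integrable_smul_left_of_hasCompactSupport hc hφ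

theorem integrable_smul_gradient {u : Space N → ℝ} (hu : LocallyIntegrable u volume)
    {φ : Space N → ℝ} (hφ : IsTest φ) : Integrable (fun x => u x • gradient φ x) volume :=
  hu.integrable_smul_right_of_hasCompactSupport (continuous_gradient hφ.1)
    (gradient_hasCompactSupport hφ.2)

theorem HasWeakGradient.add {u v : Space N → ℝ} {G H : Space N → Space N}
    (hu : HasWeakGradient u G) (hv : HasWeakGradient v H) : HasWeakGradient (u + v) (G + H) := by
  refine ⟨hu.1.add hv.1, hu.2.1.add hv.2.1, fun φ hφ => ?_⟩
  simp only [Pi.add_apply, add_smul, smul_add]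
  rw [integral_add (integrable_smul_gradient hu.1 hφ) (integrable_smul_gradient hv.1 hφ),
    integral_add (hu.2.1.integrable_smul_test hφ.continuous hφ.2)
    (hv.2.1.integrable_smul_test hφ.continuous hφ.2), hu.2.2 φ hφ, hv.2.2 φ hφ]
  abel

theorem HasWeakGradient.smul {u : Space N → ℝ} {G : Space N → Space N} (c : ℝ)
    (hu : HasWeakGradient u G) : HasWeakGradient (c • u) (c • G) := by
  refine ⟨hu.1.smul c, hu.2.1.smul c, fun φ hφ => ?_⟩
  simp only [Pi.smul_apply, smul_eq_mul, mul_smul]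
  rw [integral_smul, hu.2.2 φ hφ]
  simp_rw [smul_comm _ c]
  rw [integral_smul, smul_neg]

theorem weakGradient_eq {u : Space N → ℝ} {G : Space N → Space N} (h : HasWeakGradient u G) :
    weakGradient u =ᵐ[volume] G :=
  (hasWeakGradient_weakGradient h).ae_eq h

theorem MemHDot1.hasWeakGradient {u : Space N → ℝ} (h : MemHDot1 u) :
    HasWeakGradient u (weakGradient u) := by
  obtain ⟨_, G, hG, _⟩ := h
  exact hasWeakGradient_weakGradient hG

theorem MemHDot1.memLp_weakGradient {u : Space N → ℝ} (h : MemHDot1 u) :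
    MemLp (weakGradient u) 2 volume := by
  obtain ⟨_, G, hG, h2⟩ := h
  exact h2.ae_eq (weakGradient_eq hG).symm

theorem MemHDot1.add {u v : Space N → ℝ} (hu : MemHDot1 u) (hv : MemHDot1 v) :
    MemHDot1 (u + v) :=
  ⟨hu.1.add hv.1, _, hu.hasWeakGradient.add hv.hasWeakGradient,
    hu.memLp_weakGradient.add hv.memLp_weakGradient⟩

theorem MemHDot1.smul {u : Space N → ℝ} (c : ℝ) (hu : MemHDot1 u) : MemHDot1 (c • u) :=
  ⟨hu.1.const_smul c, _, hu.hasWeakGradient.smul c, hu.memLp_weakGradient.const_smul c⟩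

theorem MemHDot1.zero : MemHDot1 (0 : Space N → ℝ) := by
  refine ⟨MemLp.zero, 0, ⟨locallyIntegrable_zero, locallyIntegrable_zero, ?_⟩, MemLp.zero⟩
  simp

theorem IsTest.memHDot1 {φ : Space N → ℝ} (h : IsTest φ) : MemHDot1 φ :=
  ⟨h.memLp _, _, hasWeakGradient_gradient h.1, h.memLp_gradient 2⟩

/-! ### Mollification in `L^p` -/

/-- Continuity of translations in `L^p`. -/
theorem eLpNorm_translate_sub_small {F : Type*} [NormedAddCommGroup F] {p : ℝ≥0∞} (hp1 : 1 ≤ p)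
    (hp : p ≠ ⊤) {f : Space N → F} (hf : MemLp f p volume) {ε : ℝ≥0∞} (hε : ε ≠ 0) :
    ∃ δ > (0 : ℝ), ∀ z : Space N, ‖z‖ < δ → eLpNorm (fun x => f (x - z) - f x) p volume ≤ ε := by
  have : Fact (1 ≤ p) := ⟨hp1⟩
  let g : C(Space N, C(Space N, Space N)) :=
    (ContinuousMap.mk (fun a : Space N × Space N => a.2 - a.1) (by fun_prop)).curry
  have hg : ∀ z, MeasurePreserving (g z) (volume : Measure (Space N)) volume := fun z =>
    measurePreserving_sub_right volume z
  have hc : Continuous fun z => Lp.compMeasurePreserving (g z) (hg z) (hf.toLp f) :=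
    continuous_const.compMeasurePreservingLp g.continuous hg hp
  have h0 := hc.tendsto 0
  rw [EMetric.tendsto_nhds] at h0
  obtain ⟨δ, hδ, h⟩ := Metric.eventually_nhds_iff.1 (h0 ε (pos_iff_ne_zero.2 hε))
  refine ⟨δ, hδ, fun z hz => ?_⟩
  have h1 := (h (y := z) (by simpa using hz)).le
  rw [Lp.toLp_compMeasurePreserving, Lp.toLp_compMeasurePreserving, Lp.edist_toLp_toLp] at h1
  have e : (fun x => f (x - z) - f x) = f ∘ ⇑(g z) - f ∘ ⇑(g 0) := by
    funext x
    change _ = f (x - z) - f (x - 0)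
    rw [sub_zero]
  rwa [e]

/-- The case of `eLpNorm_convolution_sub_le` in which `f` is strongly measurable, which makes
`(x, z) ↦ f (x - z) - f x` jointly measurable. -/
theorem eLpNorm_convolution_sub_le_aux {F : Type*} [NormedAddCommGroup F] [NormedSpace ℝ F]
    [CompleteSpace F]
    {p : ℝ≥0∞} (hp1 : 1 ≤ p) (hp : p ≠ ⊤) {f : Space N → F} (hf : MemLp f p volume)
    (hfm : StronglyMeasurable f) {k : Space N → ℝ}
    (hk : Continuous k) (hks : HasCompactSupport k) (hk0 : ∀ x, 0 ≤ k x) (hk1 : ∫ x, k x = 1)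
    {ε : ℝ≥0∞}
    (hε : ∀ z, k z ≠ 0 → eLpNorm (fun x => f (x - z) - f x) p volume ≤ ε) :
    eLpNorm ((k ⋆[ContinuousLinearMap.lsmul ℝ ℝ, volume] f) - f) p volume ≤ ε := by
  set w : Space N → ℝ≥0∞ := fun z => ENNReal.ofReal (k z) with hw
  have hwm : Measurable w := hk.measurable.ennreal_ofReal
  set P : Measure (Space N) := volume.withDensity w with hP
  have hki : Integrable k volume := hk.integrable_of_hasCompactSupport hks
  have : IsProbabilityMeasure P := ⟨by
    rw [hP, withDensity_apply _ MeasurableSet.univ, setLIntegral_univ,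
      ← ofReal_integral_eq_lintegral_ofReal hki (ae_of_all _ hk0), hk1, ENNReal.ofReal_one]⟩
  have hp0 : p ≠ 0 := (zero_lt_one.trans_le hp1).ne'
  have hpr : 0 < p.toReal := ENNReal.toReal_pos hp0 hp
  have hloc : LocallyIntegrable f volume := hf.locallyIntegrable hp1
  have hmeas : ∀ x, StronglyMeasurable fun z => f (x - z) - f x := fun x =>
    (hfm.comp_measurable (measurable_const.sub measurable_id)).sub stronglyMeasurable_const
  have key : ∀ x, ‖(k ⋆[ContinuousLinearMap.lsmul ℝ ℝ, volume] f) x - f x‖ₑ ^ p.toReal ≤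
      ∫⁻ z, ‖f (x - z) - f x‖ₑ ^ p.toReal ∂P := by
    intro x
    have hint : Integrable (fun z => k z • f (x - z)) volume :=
      (hks.convolutionExists_left (ContinuousLinearMap.lsmul ℝ ℝ) hk hloc x).integrable
    have e1 : (k ⋆[ContinuousLinearMap.lsmul ℝ ℝ, volume] f) x - f x
        = ∫ z, k z • (f (x - z) - f x) := by
      simp_rw [smul_sub]
      rw [integral_sub hint (hki.smul_const _), integral_smul_const, hk1, one_smul]
      rfl
    have e2 : ‖(k ⋆[ContinuousLinearMap.lsmul ℝ ℝ, volume] f) x - f x‖ₑ ≤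
        ∫⁻ z, ‖f (x - z) - f x‖ₑ ∂P := by
      rw [e1, hP, lintegral_withDensity_eq_lintegral_mul _ hwm (hmeas x).enorm]
      refine (enorm_integral_le_lintegral_enorm _).trans (le_of_eq ?_)
      refine lintegral_congr fun z => ?_
      rw [enorm_smul, Pi.mul_apply, hw, Real.enorm_eq_ofReal (hk0 z)]
    have e3 := eLpNorm_le_eLpNorm_of_exponent_le (μ := P) hp1 (hmeas x).aestronglyMeasurable
    rw [eLpNorm_one_eq_lintegral_enorm, eLpNorm_eq_lintegral_rpow_enorm_toReal hp0 hp] at e3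
    calc _ ≤ ((∫⁻ z, ‖f (x - z) - f x‖ₑ ^ p.toReal ∂P) ^ (1 / p.toReal)) ^ p.toReal :=
          ENNReal.rpow_le_rpow (e2.trans e3) hpr.le
      _ = _ := by rw [← ENNReal.rpow_mul, one_div_mul_cancel hpr.ne', ENNReal.rpow_one]
  have hm2 : StronglyMeasurable (Function.uncurry fun x z : Space N => f (x - z) - f x) :=
    (hfm.comp_measurable (measurable_fst.sub measurable_snd)).sub
      (hfm.comp_measurable measurable_fst)
  rw [eLpNorm_eq_lintegral_rpow_enorm_toReal hp0 hp]
  have hfin : ∫⁻ x, ‖((k ⋆[ContinuousLinearMap.lsmul ℝ ℝ, volume] f) - f) x‖ₑ ^ p.toReal ≤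
      ε ^ p.toReal := by
    calc _ ≤ ∫⁻ x, ∫⁻ z, ‖f (x - z) - f x‖ₑ ^ p.toReal ∂P := lintegral_mono key
      _ = ∫⁻ z, (∫⁻ x, ‖f (x - z) - f x‖ₑ ^ p.toReal) ∂P :=
          lintegral_lintegral_swap (hm2.enorm.pow_const _).aemeasurable
      _ = ∫⁻ z, w z * (∫⁻ x, ‖f (x - z) - f x‖ₑ ^ p.toReal) := by
          rw [hP, lintegral_withDensity_eq_lintegral_mul _ hwm]
          · rfl
          · exact (hm2.enorm.pow_const p.toReal).lintegral_prod_left'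
      _ ≤ ∫⁻ z, w z * ε ^ p.toReal := by
          refine lintegral_mono fun z => ?_
          by_cases hz : k z = 0
          · simp [hw, hz]
          · refine mul_le_mul_right ?_ _
            have := hε z hz
            rw [eLpNorm_eq_lintegral_rpow_enorm_toReal hp0 hp] at this
            calc _ = ((∫⁻ x, ‖f (x - z) - f x‖ₑ ^ p.toReal) ^ (1 / p.toReal)) ^ p.toReal := by
                  rw [← ENNReal.rpow_mul, one_div_mul_cancel hpr.ne', ENNReal.rpow_one]
              _ ≤ _ := ENNReal.rpow_le_rpow this hpr.le
      _ = ε ^ p.toReal := by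
          rw [lintegral_mul_const _ hwm, hw,
            ← ofReal_integral_eq_lintegral_ofReal hki (ae_of_all _ hk0), hk1, ENNReal.ofReal_one,
            one_mul]
  calc _ ≤ (ε ^ p.toReal) ^ (1 / p.toReal) := ENNReal.rpow_le_rpow hfin (by positivity)
    _ = ε := by rw [← ENNReal.rpow_mul, mul_one_div_cancel hpr.ne', ENNReal.rpow_one]

/-- If translations by elements of the support of a probability density `k` move `f` by at most
`ε` in `L^p`, so does the convolution with `k` (Jensen's inequality and Tonelli's theorem). -/
theorem eLpNorm_convolution_sub_le {F : Type*} [NormedAddCommGroup F] [NormedSpace ℝ F]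
    [CompleteSpace F]
    {p : ℝ≥0∞} (hp1 : 1 ≤ p) (hp : p ≠ ⊤) {f : Space N → F} (hf : MemLp f p volume)
    {k : Space N → ℝ}
    (hk : Continuous k) (hks : HasCompactSupport k) (hk0 : ∀ x, 0 ≤ k x) (hk1 : ∫ x, k x = 1)
    {ε : ℝ≥0∞}
    (hε : ∀ z, k z ≠ 0 → eLpNorm (fun x => f (x - z) - f x) p volume ≤ ε) :
    eLpNorm ((k ⋆[ContinuousLinearMap.lsmul ℝ ℝ, volume] f) - f) p volume ≤ ε := by
  obtain ⟨g, hg, hfg⟩ := hf.1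
  have h1 : (k ⋆[ContinuousLinearMap.lsmul ℝ ℝ, volume] f) =
      (k ⋆[ContinuousLinearMap.lsmul ℝ ℝ, volume] g) :=
    convolution_congr _ (EventuallyEq.refl _ _) hfg
  rw [h1, eLpNorm_congr_ae ((EventuallyEq.refl _ _).sub hfg)]
  refine eLpNorm_convolution_sub_le_aux hp1 hp ((memLp_congr_ae hfg).1 hf) hg hk hks hk0 hk1
    fun z hz => ?_
  refine le_trans (le_of_eq (eLpNorm_congr_ae ?_)) (hε z hz)
  have := (measurePreserving_sub_right (volume : Measure (Space N)) z).quasiMeasurePreserving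
    |>.ae_eq_comp hfg
  filter_upwards [this, hfg] with x h1 h2
  simp only [Function.comp_apply] at h1
  rw [h1, h2]

/-! ### Radial plateau functions -/

/-- A smooth radial function equal to `1` on the ball of radius `R` and supported in the ball
of radius `√2 R`. -/
def plateau (R : ℝ) (x : Space N) : ℝ := Real.smoothTransition (2 - ‖x‖ ^ 2 / R ^ 2)

theorem plateau_contDiff (R : ℝ) : ContDiff ℝ ∞ (plateau R : Space N → ℝ) :=
  Real.smoothTransition.contDiff.comp
    (contDiff_const.sub ((contDiff_norm_sq ℝ).div_const _))

theorem plateau_nonneg (R : ℝ) (x : Space N) : 0 ≤ plateau R x := Real.smoothTransition.nonneg _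

theorem plateau_le_one (R : ℝ) (x : Space N) : plateau R x ≤ 1 := Real.smoothTransition.le_one _

theorem plateau_eq_one {R : ℝ} (hR : 0 < R) {x : Space N} (hx : ‖x‖ ≤ R) : plateau R x = 1 := by
  refine Real.smoothTransition.one_of_one_le ?_
  have : ‖x‖ ^ 2 / R ^ 2 ≤ 1 := by
    rw [div_le_one (by positivity)]
    gcongr
  linarith

theorem plateau_eq_zero {R : ℝ} (hR : 0 < R) {x : Space N} (hx : 2 * R ≤ ‖x‖) :
    plateau R x = 0 := by
  refine Real.smoothTransition.zero_of_nonpos ?_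
  have : 2 ≤ ‖x‖ ^ 2 / R ^ 2 := by
    rw [le_div_iff₀ (by positivity)]
    nlinarith
  linarith

theorem plateau_isTest {R : ℝ} (hR : 0 < R) : IsTest (plateau R : Space N → ℝ) := by
  refine ⟨plateau_contDiff R, HasCompactSupport.intro (isCompact_closedBall 0 (2 * R)) ?_⟩
  intro x hx
  refine plateau_eq_zero hR ?_
  simp only [Metric.mem_closedBall, dist_zero_right, not_le] at hx
  exact hx.le

theorem plateau_isometry (R : ℝ) (T : Space N ≃ₗᵢ[ℝ] Space N) (x : Space N) :
    plateau R (T x) = plateau R x := by simp [plateau]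

theorem plateau_integral_pos {R : ℝ} (hR : 0 < R) : 0 < ∫ x : Space N, plateau R x := by
  refine (plateau_contDiff R).continuous.integral_pos_of_hasCompactSupport_nonneg_nonzero
    (plateau_isTest hR).2 (plateau_nonneg R) (x := 0) ?_
  rw [plateau_eq_one hR (by simpa using hR.le)]
  exact one_ne_zero

/-- The radial mollifier supported in the ball of radius `2R`. -/
def mollifier (R : ℝ) (x : Space N) : ℝ := (∫ y : Space N, plateau R y)⁻¹ * plateau R x

theorem mollifier_isTest {R : ℝ} (hR : 0 < R) : IsTest (mollifier R : Space N → ℝ) :=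
  (plateau_isTest hR).smul _

theorem mollifier_nonneg {R : ℝ} (hR : 0 < R) (x : Space N) : 0 ≤ mollifier R x :=
  mul_nonneg (inv_nonneg.2 (plateau_integral_pos hR).le) (plateau_nonneg R x)

theorem mollifier_integral {R : ℝ} (hR : 0 < R) : ∫ x : Space N, mollifier R x = 1 := by
  simp only [mollifier]
  rw [integral_const_mul, inv_mul_cancel₀ (plateau_integral_pos hR).ne']

theorem mollifier_isometry (R : ℝ) (T : Space N ≃ₗᵢ[ℝ] Space N) (x : Space N) :
    mollifier R (T x) = mollifier R x := by simp [mollifier, plateau_isometry]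

theorem norm_lt_of_mollifier_ne_zero {R : ℝ} (hR : 0 < R) {x : Space N} (hx : mollifier R x ≠ 0) :
    ‖x‖ < 2 * R := by
  contrapose! hx
  simp [mollifier, plateau_eq_zero hR hx]

/-- The mollification of `f` at scale `R`. -/
def mollify {F : Type*} [NormedAddCommGroup F] [NormedSpace ℝ F] (R : ℝ) (f : Space N → F) :
    Space N → F :=
  mollifier R ⋆[ContinuousLinearMap.lsmul ℝ ℝ, volume] f

theorem mollify_contDiff {R : ℝ} (hR : 0 < R) {u : Space N → ℝ} (hu : LocallyIntegrable u volume) :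
    ContDiff ℝ ∞ (mollify R u) :=
  (mollifier_isTest hR).2.contDiff_convolution_left (n := ⊤) _ (mollifier_isTest hR).1 hu

theorem mollify_apply {F : Type*} [NormedAddCommGroup F] [NormedSpace ℝ F] (R : ℝ)
    (f : Space N → F) (x : Space N) : mollify R f x = ∫ y, mollifier R (x - y) • f y := by
  simp only [mollify, convolution_def, ContinuousLinearMap.lsmul_apply]
  rw [← integral_sub_left_eq_self _ volume x]
  simp

/-- Mollification commutes with the weak gradient. -/
theorem gradient_mollify {R : ℝ} (hR : 0 < R) {u : Space N → ℝ} {G : Space N → Space N}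
    (h : HasWeakGradient u G) : gradient (mollify R u) = mollify R G := by
  ext1 x
  have hm := mollifier_isTest (N := N) hR
  have hd := hm.2.hasFDerivAt_convolution_left (ContinuousLinearMap.lsmul ℝ ℝ)
    (hm.1.of_le (by simp)) h.1 x
  -- the test function `y ↦ k (x - y)`
  set φ : Space N → ℝ := fun y => mollifier R (x - y) with hφ
  have hφt : IsTest φ := by
    refine ⟨hm.1.comp (contDiff_const.sub contDiff_id), ?_⟩
    exact hm.2.comp_homeomorph (Homeomorph.subLeft x)
  have hφg : ∀ y e, fderiv ℝ φ y e = -fderiv ℝ (mollifier R) (x - y) e := by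
    intro y e
    have : HasFDerivAt φ ((fderiv ℝ (mollifier R) (x - y)).comp
        (-ContinuousLinearMap.id ℝ (Space N))) y :=
      (hm.1.diffAt (x - y)).hasFDerivAt.comp y ((hasFDerivAt_id y).const_sub x)
    rw [this.fderiv]; simp
  have hw := h.2.2 φ hφt
  refine ext_inner_right ℝ fun e => ?_
  rw [inner_gradient_apply, mollify, hd.fderiv]
  have e1 : mollify R G x = -∫ y, u y • gradient φ y := by rw [hw, neg_neg, mollify_apply]
  have hci : ConvolutionExistsAt (fderiv ℝ (mollifier R : Space N → ℝ)) u x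
      ((ContinuousLinearMap.lsmul ℝ ℝ).precompL (Space N)) volume :=
    (hm.2.fderiv ℝ).convolutionExists_left _ (hm.1.continuous_fderiv (by simp)) h.1 x
  change _ = inner ℝ (mollify R G x) e
  rw [e1, inner_neg_left, real_inner_comm,
    ← integral_inner (integrable_smul_gradient h.1 hφt)]
  simp only [convolution_def]
  rw [ContinuousLinearMap.integral_apply hci.integrable]
  · rw [← integral_sub_left_eq_self _ volume x, ← integral_neg]
    refine integral_congr_ae (ae_of_all _ fun y => ?_)
    simp only [sub_sub_cancel]
    rw [inner_smul_right, real_inner_comm, inner_gradient_apply, hφg]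
    simp [ContinuousLinearMap.precompL_apply, mul_comm]

theorem mollify_isometry {F : Type*} [NormedAddCommGroup F] [NormedSpace ℝ F] (R : ℝ)
    {u : Space N → F} (T : Space N ≃ₗᵢ[ℝ] Space N) (h : u ∘ T =ᵐ[volume] u) (x : Space N) :
    mollify R u (T x) = mollify R u x := by
  rw [mollify_apply, mollify_apply,
    ← (T.measurePreserving).integral_comp T.toHomeomorph.measurableEmbedding]
  refine integral_congr_ae ?_
  filter_upwards [h] with y hy
  simp only [Function.comp_apply] at hy
  rw [hy, ← map_sub, mollifier_isometry]

theorem tendsto_mollify {F : Type*} [NormedAddCommGroup F] [NormedSpace ℝ F] [CompleteSpace F]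
    {p : ℝ≥0∞} (hp1 : 1 ≤ p) (hp : p ≠ ⊤) {f : Space N → F} (hf : MemLp f p volume) :
    Tendsto (fun R => eLpNorm (mollify R f - f) p volume) (𝓝[>] 0) (𝓝 0) := by
  rw [ENNReal.tendsto_nhds_zero]
  intro ε hε
  obtain ⟨δ, hδ, h⟩ := eLpNorm_translate_sub_small hp1 hp hf hε.ne'
  filter_upwards [Ioo_mem_nhdsGT (show (0 : ℝ) < δ / 2 by positivity)] with R hR
  have hm := mollifier_isTest (N := N) hR.1
  refine eLpNorm_convolution_sub_le hp1 hp hf hm.continuous hm.2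
    (mollifier_nonneg hR.1) (mollifier_integral hR.1) fun z hz => h z ?_
  have := norm_lt_of_mollifier_ne_zero hR.1 hz
  linarith [hR.2]

/-! ### Density of test functions -/

/-- Dominated convergence in `L^p` for multipliers bounded by `1`. -/
theorem tendsto_eLpNorm_smul_zero {ι : Type*} {l : Filter ι} [l.IsCountablyGenerated]
    {F : Type*} [NormedAddCommGroup F] [NormedSpace ℝ F] {p : ℝ≥0∞} (hp0 : p ≠ 0) (hp : p ≠ ⊤)
    {f : Space N → F} (hf : MemLp f p volume) {m : ι → Space N → ℝ}
    (hm : ∀ᶠ i in l, AEStronglyMeasurable (m i) volume) (hb : ∀ᶠ i in l, ∀ x, |m i x| ≤ 1)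
    (hl : ∀ᵐ x, Tendsto (fun i => m i x) l (𝓝 0)) :
    Tendsto (fun i => eLpNorm (fun x => m i x • f x) p volume) l (𝓝 0) := by
  have hpr : 0 < p.toReal := ENNReal.toReal_pos hp0 hp
  simp_rw [eLpNorm_eq_lintegral_rpow_enorm_toReal hp0 hp]
  have h : Tendsto (fun i => ∫⁻ x, ‖m i x • f x‖ₑ ^ p.toReal) l (𝓝 (∫⁻ _ : Space N, 0)) := by
    refine tendsto_lintegral_filter_of_dominated_convergence' (fun x => ‖f x‖ₑ ^ p.toReal)
      ?_ ?_ ?_ ?_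
    · filter_upwards [hm] with i hi
      exact ((hi.smul hf.1).enorm.pow_const _)
    · filter_upwards [hb] with i hi
      refine ae_of_all _ fun x => ENNReal.rpow_le_rpow ?_ hpr.le
      rw [enorm_smul]
      calc ‖m i x‖ₑ * ‖f x‖ₑ ≤ 1 * ‖f x‖ₑ := by
            gcongr
            rw [← ofReal_norm, Real.norm_eq_abs]
            exact ENNReal.ofReal_le_one.2 (hi x)
        _ = _ := one_mul _
    · exact (lintegral_rpow_enorm_lt_top_of_eLpNorm_lt_top hp0 hp hf.2).ne
    · filter_upwards [hl] with x hx
      have h1 : Tendsto (fun i => ‖m i x • f x‖ₑ) l (𝓝 0) := by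
        have := (hx.smul_const (f x)).enorm
        simpa using this
      have := (ENNReal.continuous_rpow_const (y := p.toReal)).tendsto 0 |>.comp h1
      simpa [ENNReal.zero_rpow_of_pos hpr, Function.comp_def] using this
  rw [lintegral_zero] at h
  have := (ENNReal.continuous_rpow_const (y := 1 / p.toReal)).tendsto 0 |>.comp h
  rw [ENNReal.zero_rpow_of_pos (by positivity)] at this
  exact this

theorem plateau_scale {R : ℝ} (hR : 0 < R) (x : Space N) : plateau R x = plateau 1 (R⁻¹ • x) := by
  simp only [plateau, norm_smul, norm_inv, Real.norm_eq_abs, abs_of_pos hR, mul_pow, one_pow,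
    div_one, inv_pow]
  rw [div_eq_inv_mul]

/-- The gradient of `plateau R` is `O(1/R)`. -/
theorem exists_norm_gradient_plateau_le :
    ∃ C : ℝ, 0 ≤ C ∧ ∀ R : ℝ, 0 < R → ∀ x : Space N, ‖gradient (plateau R) x‖ ≤ C / R := by
  have h1 := plateau_isTest (N := N) one_pos
  obtain ⟨C, hC⟩ := (continuous_gradient h1.1).bounded_above_of_compact_support
    (gradient_hasCompactSupport h1.2)
  refine ⟨C, (norm_nonneg _).trans (hC 0), fun R hR x => ?_⟩
  have e : (plateau R : Space N → ℝ) = fun x => plateau 1 (R⁻¹ • x) :=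
    funext fun x => plateau_scale hR x
  have hd : HasFDerivAt (plateau R : Space N → ℝ)
      ((fderiv ℝ (plateau 1) (R⁻¹ • x)).comp (R⁻¹ • ContinuousLinearMap.id ℝ (Space N))) x := by
    rw [e]
    exact (h1.1.diffAt _).hasFDerivAt.comp x ((hasFDerivAt_id x).const_smul R⁻¹)
  rw [norm_gradient_eq, hd.fderiv, ContinuousLinearMap.comp_smul, ContinuousLinearMap.comp_id,
    norm_smul, norm_inv, Real.norm_eq_abs, abs_of_pos hR, ← norm_gradient_eq, div_eq_inv_mul]
  gcongr
  exact hC _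

theorem gradient_plateau_eq_zero {R : ℝ} (hR : 0 < R) {x : Space N}
    (hx : ‖x‖ < R ∨ 2 * R < ‖x‖) : gradient (plateau R) x = 0 := by
  have hz : gradient (fun _ : Space N => (0 : ℝ)) x = 0 := by simp
  have ho : gradient (fun _ : Space N => (1 : ℝ)) x = 0 := by simp
  rcases hx with hx | hx
  · rw [← ho]
    refine EventuallyEq.gradient_eq ?_
    filter_upwards [(isOpen_lt continuous_norm continuous_const).mem_nhds hx] with y hy
    exact plateau_eq_one hR (le_of_lt hy)
  · rw [← hz]
    refine EventuallyEq.gradient_eq ?_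
    filter_upwards [(isOpen_lt continuous_const continuous_norm).mem_nhds hx] with y hy
    exact plateau_eq_zero hR (le_of_lt hy)

theorem eLpNorm_gradient_plateau_top_le : ∃ C : ℝ≥0∞, C ≠ ⊤ ∧ ∀ R : ℝ, 1 ≤ R →
    eLpNorm (gradient (plateau R : Space N → ℝ)) ⊤ volume ≤ C := by
  obtain ⟨C, hC0, hC⟩ := exists_norm_gradient_plateau_le (N := N)
  refine ⟨ENNReal.ofReal C, ENNReal.ofReal_ne_top, fun R hR => ?_⟩
  refine (eLpNormEssSup_le_of_ae_bound (C := C) (ae_of_all _ fun x => ?_))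
  exact (hC R (by linarith) x).trans (div_le_self hC0 hR)

/-- In the scaling invariant space `L^N`, the gradients of the plateau functions are bounded. -/
theorem eLpNorm_gradient_plateau_le (hN : 1 ≤ N) : ∃ C : ℝ≥0∞, C ≠ ⊤ ∧ ∀ R : ℝ, 1 ≤ R →
    eLpNorm (gradient (plateau R : Space N → ℝ)) N volume ≤ C := by
  obtain ⟨C, hC0, hC⟩ := exists_norm_gradient_plateau_le (N := N)
  have hN0 : (N : ℝ) ≠ 0 := by positivity
  refine ⟨ENNReal.ofReal (2 * C) * (volume (Metric.closedBall (0 : Space N) 1)) ^ (1 / (N : ℝ)),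
    ENNReal.mul_ne_top ENNReal.ofReal_ne_top (ENNReal.rpow_ne_top_of_nonneg (by positivity)
      (isCompact_closedBall _ _).measure_lt_top.ne), fun R hR => ?_⟩
  have hR0 : 0 < R := by linarith
  have hle : ∀ x : Space N, ‖gradient (plateau R) x‖ ≤
      ‖(Metric.closedBall (0 : Space N) (2 * R)).indicator (fun _ => C / R) x‖ := by
    intro x
    by_cases hx : x ∈ Metric.closedBall (0 : Space N) (2 * R)
    · rw [Set.indicator_of_mem hx, Real.norm_eq_abs, abs_of_nonneg (by positivity)]
      exact hC R hR0 x
    · simp only [Metric.mem_closedBall, dist_zero_right, not_le] at hx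
      rw [gradient_plateau_eq_zero hR0 (Or.inr hx)]
      simp
  refine (eLpNorm_mono hle).trans ?_
  rw [eLpNorm_indicator_const measurableSet_closedBall (by simp; omega) (by simp)]
  rw [Measure.addHaar_closedBall _ _ (by positivity), finrank_euclideanSpace, Fintype.card_fin,
    ENNReal.toReal_natCast, ENNReal.mul_rpow_of_nonneg _ _ (by positivity),
    ENNReal.ofReal_rpow_of_nonneg (by positivity) (by positivity), ← mul_assoc]
  refine mul_le_mul' ?_ ?_
  · rw [← ofReal_norm, ← ENNReal.ofReal_mul (norm_nonneg _)]
    refine ENNReal.ofReal_le_ofReal (le_of_eq ?_)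
    rw [one_div, Real.pow_rpow_inv_natCast (by positivity) (by omega), Real.norm_eq_abs,
      abs_of_nonneg (by positivity)]
    field_simp
  · refine ENNReal.rpow_le_rpow (measure_mono Metric.ball_subset_closedBall) (by positivity)

/-- Smooth functions in `L^s` with gradient in `L²` are approximated by their truncations; `t` is
the exponent with `1/t + 1/s = 1/2`, for which the gradients of the truncations stay bounded. -/
theorem tendsto_truncation {s t : ℝ≥0∞} [ENNReal.HolderTriple t s 2] (hs1 : 1 ≤ s) (hs : s ≠ ⊤)
    (hC : ∃ C : ℝ≥0∞, C ≠ ⊤ ∧ ∀ R : ℝ, 1 ≤ R →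
      eLpNorm (gradient (plateau R : Space N → ℝ)) t volume ≤ C)
    {v : Space N → ℝ} (hv : ContDiff ℝ ∞ v) (hvs : MemLp v s volume)
    (hv2 : MemLp (gradient v) 2 volume) :
    Tendsto (fun R : ℝ => eLpNorm ((fun x => plateau R x * v x) - v) s volume) atTop (𝓝 0) ∧
    Tendsto (fun R : ℝ => eLpNorm (gradient (fun x => plateau R x * v x) - gradient v) 2 volume)
      atTop (𝓝 0) := by
  have hm : ∀ R : ℝ, Continuous (fun x : Space N => 1 - plateau R x) := fun R =>
    continuous_const.sub (plateau_contDiff R).continuous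
  have hb : ∀ (R : ℝ) (x : Space N), |1 - plateau R x| ≤ 1 := fun R x => by
    rw [abs_le]
    constructor <;> linarith [plateau_nonneg R x, plateau_le_one R x]
  have hlim : ∀ x : Space N, Tendsto (fun R : ℝ => 1 - plateau R x) atTop (𝓝 0) := fun x => by
    refine tendsto_const_nhds.congr' ?_
    filter_upwards [eventually_ge_atTop ‖x‖, eventually_gt_atTop 0] with R hR hR0
    rw [plateau_eq_one hR0 hR, sub_self]
  have gen : ∀ {F : Type} [NormedAddCommGroup F] [NormedSpace ℝ F] {q : ℝ≥0∞} {f : Space N → F},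
      q ≠ 0 → q ≠ ⊤ → MemLp f q volume →
      Tendsto (fun R : ℝ => eLpNorm (fun x => (1 - plateau R x) • f x) q volume) atTop (𝓝 0) :=
    fun hq0 hq hf => tendsto_eLpNorm_smul_zero hq0 hq hf
      (Eventually.of_forall fun R => (hm R).aestronglyMeasurable)
      (Eventually.of_forall hb) (ae_of_all _ hlim)
  have hs0 : s ≠ 0 := (zero_lt_one.trans_le hs1).ne'
  constructor
  · refine (gen hs0 hs hvs).congr fun R => ?_
    rw [← eLpNorm_neg]
    congr 1
    funext x
    simp only [Pi.neg_apply, Pi.sub_apply, smul_eq_mul]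
    ring
  · obtain ⟨C, hCt, hC⟩ := hC
    have h1 := gen two_ne_zero ENNReal.ofNat_ne_top hv2
    have h2 := (gen hs0 hs hvs).comp (tendsto_id.atTop_div_const (show (0 : ℝ) < 2 by norm_num))
    have h3 := (ENNReal.Tendsto.const_mul h2 (Or.inr hCt)).add h1
    simp only [mul_zero, add_zero] at h3
    refine tendsto_of_tendsto_of_tendsto_of_le_of_le' tendsto_const_nhds h3
      (Eventually.of_forall fun _ => zero_le) ?_
    filter_upwards [eventually_ge_atTop 1] with R hR
    have hR0 : 0 < R := by linarith
    -- `∇ plateau R` lives where `plateau (R/2)` vanishes, so the factor `1 - plateau (R/2)` is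
    -- free; it makes the term tend to zero
    have e : gradient (fun x => plateau R x * v x) - gradient v =
        (fun x => ((1 - plateau (R / 2) x) * v x) • gradient (plateau R) x) -
          fun x => (1 - plateau R x) • gradient v x := by
      funext x
      simp only [Pi.sub_apply]
      rw [gradient_mul' ((plateau_contDiff R).diffAt x) (hv.diffAt x)]
      have : v x • gradient (plateau R) x =
          ((1 - plateau (R / 2) x) * v x) • gradient (plateau R) x := by
        rcases lt_or_ge ‖x‖ R with h | h
        · rw [gradient_plateau_eq_zero hR0 (Or.inl h), smul_zero, smul_zero]
        · rw [plateau_eq_zero (by positivity) (by linarith : 2 * (R / 2) ≤ ‖x‖), sub_zero, one_mul]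
      rw [this, sub_smul, one_smul]
      abel
    rw [e]
    have m1 : AEStronglyMeasurable (fun x => (1 - plateau (R / 2) x) * v x) volume :=
      ((hm _).mul hv.continuous).aestronglyMeasurable
    have m2 : AEStronglyMeasurable (gradient (plateau R : Space N → ℝ)) volume :=
      (continuous_gradient (plateau_contDiff R)).aestronglyMeasurable
    have m3 : AEStronglyMeasurable (fun x => (1 - plateau R x) • gradient v x) volume :=
      ((hm _).smul (continuous_gradient hv)).aestronglyMeasurable
    refine (eLpNorm_sub_le (m1.smul m2) m3 (by norm_num)).trans ?_
    gcongr
    have : ENNReal.HolderTriple s t 2 := ENNReal.HolderTriple.symm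
    refine (eLpNorm_smul_le_mul_eLpNorm (p := s) (q := t) (r := 2) m2 m1).trans ?_
    rw [mul_comm]
    exact mul_le_mul' (hC R hR) le_rfl

/-- Functions in `L^s` with weak gradient in `L²` are limits of test functions, in both norms at
once; invariances under isometries are kept. -/
theorem exists_test_approx {s t : ℝ≥0∞} [ENNReal.HolderTriple t s 2] (hs1 : 1 ≤ s) (hs : s ≠ ⊤)
    (hC : ∃ C : ℝ≥0∞, C ≠ ⊤ ∧ ∀ R : ℝ, 1 ≤ R →
      eLpNorm (gradient (plateau R : Space N → ℝ)) t volume ≤ C)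
    {u : Space N → ℝ} {G : Space N → Space N} (h : HasWeakGradient u G) (hu : MemLp u s volume)
    (hG : MemLp G 2 volume) {ε : ℝ≥0∞} (hε : ε ≠ 0) :
    ∃ φ : Space N → ℝ, IsTest φ ∧ eLpNorm (φ - u) s volume ≤ ε ∧
      eLpNorm (gradient φ - G) 2 volume ≤ ε ∧
      ∀ T : Space N ≃ₗᵢ[ℝ] Space N, u ∘ T =ᵐ[volume] u → ∀ x, φ (T x) = φ x := by
  have hε2 : 0 < ε / 2 := ENNReal.div_pos hε ENNReal.ofNat_ne_top
  have e1 := (ENNReal.tendsto_nhds_zero.1 (tendsto_mollify hs1 hs hu)) (min (ε / 2) 1)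
    (lt_min hε2 one_pos)
  have e2 := (ENNReal.tendsto_nhds_zero.1 (tendsto_mollify one_le_two ENNReal.ofNat_ne_top hG))
    (min (ε / 2) 1) (lt_min hε2 one_pos)
  obtain ⟨δ, ⟨h1, h2⟩, hδ⟩ := ((e1.and e2).and self_mem_nhdsWithin).exists
  have hδ0 : (0 : ℝ) < δ := hδ
  set v := mollify δ u with hv
  have hvs : ContDiff ℝ ∞ v := mollify_contDiff hδ0 h.1
  have hvg : gradient v = mollify δ G := gradient_mollify hδ0 h
  have fin : ∀ {a : ℝ≥0∞}, a ≤ min (ε / 2) 1 → a < ⊤ := fun ha =>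
    (ha.trans (min_le_right _ _)).trans_lt ENNReal.one_lt_top
  have hvm : MemLp v s volume := by
    have : MemLp (v - u) s volume := ⟨hvs.continuous.aestronglyMeasurable.sub hu.1, fin h1⟩
    simpa using this.add hu
  have hvgm : MemLp (gradient v) 2 volume := by
    have : MemLp (gradient v - G) 2 volume :=
      ⟨(continuous_gradient hvs).aestronglyMeasurable.sub hG.1, by rw [hvg]; exact fin h2⟩
    simpa using this.add hG
  obtain ⟨t1, t2⟩ := tendsto_truncation hs1 hs hC hvs hvm hvgm
  obtain ⟨R, ⟨r1, r2⟩, hR⟩ := (((ENNReal.tendsto_nhds_zero.1 t1 _ hε2).and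
    (ENNReal.tendsto_nhds_zero.1 t2 _ hε2)).and (eventually_gt_atTop 0)).exists
  have ht : IsTest fun x => plateau R x * v x :=
    ⟨(plateau_contDiff R).mul hvs, (plateau_isTest hR).2.mul_right⟩
  refine ⟨fun x => plateau R x * v x, ht, ?_, ?_, fun T hT x => ?_⟩
  · calc eLpNorm ((fun x => plateau R x * v x) - u) s volume
        = eLpNorm (((fun x => plateau R x * v x) - v) + (v - u)) s volume := by
          rw [sub_add_sub_cancel]
      _ ≤ _ := eLpNorm_add_le ((ht.continuous.sub hvs.continuous).aestronglyMeasurable)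
          (hvs.continuous.aestronglyMeasurable.sub hu.1) hs1
      _ ≤ ε / 2 + ε / 2 := add_le_add r1 (h1.trans (min_le_left _ _))
      _ = ε := ENNReal.add_halves ε
  · calc eLpNorm (gradient (fun x => plateau R x * v x) - G) 2 volume
        = eLpNorm ((gradient (fun x => plateau R x * v x) - gradient v) + (gradient v - G)) 2
            volume := by rw [sub_add_sub_cancel]
      _ ≤ _ := eLpNorm_add_le
          (((continuous_gradient ht.1).sub (continuous_gradient hvs)).aestronglyMeasurable)
          ((continuous_gradient hvs).aestronglyMeasurable.sub hG.1) one_le_two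
      _ ≤ ε / 2 + ε / 2 := by
          refine add_le_add r2 ?_
          rw [hvg]
          exact h2.trans (min_le_left _ _)
      _ = ε := ENNReal.add_halves ε
  · change plateau R (T x) * v (T x) = plateau R x * v x
    rw [plateau_isometry, hv, mollify_isometry δ T hT]

/-! ### The Jacobi inequality -/

/-- `-Δψ = V ψ`, tested against test functions. -/
def WeakSol (V ψ : Space N → ℝ) : Prop :=
  ∀ η, IsTest η → ∫ x, inner ℝ (gradient ψ x) (gradient η x) = ∫ x, V x * ψ x * η x

/-- The inequality behind the Jacobi inequality, for the regularization `ψ / (ψ² + ε)` of `1/ψ`. -/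
theorem jacobi_regularized {ψ V h : Space N → ℝ} (hψ : ContDiff ℝ ∞ ψ) (hV : Continuous V)
    (heq : WeakSol V ψ) (hh : IsTest h) {ε : ℝ} (hε : 0 < ε) :
    ∫ x, (V x * ψ x * (ψ x / (ψ x ^ 2 + ε) * h x ^ 2)
      - ε / (ψ x ^ 2 + ε) ^ 2 * h x ^ 2 * ‖gradient ψ x‖ ^ 2) ≤ ∫ x, ‖gradient h x‖ ^ 2 := by
  have hpos : ∀ x, 0 < ψ x ^ 2 + ε := fun x => by positivity
  have hsm : ContDiff ℝ ∞ fun x => ψ x / (ψ x ^ 2 + ε) :=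
    hψ.div ((hψ.pow 2).add contDiff_const) fun x => (hpos x).ne'
  have hη : IsTest fun x => ψ x / (ψ x ^ 2 + ε) * (h x * h x) :=
    (hh.mul_left hh.1).mul_left hsm
  have i1 : Integrable (fun x => inner ℝ (gradient ψ x)
      (gradient (fun x => ψ x / (ψ x ^ 2 + ε) * (h x * h x)) x)) volume :=
    hη.integrable_inner (continuous_gradient hψ)
  have i2 : Integrable (fun x => ε / (ψ x ^ 2 + ε) ^ 2 * h x ^ 2 * ‖gradient ψ x‖ ^ 2) volume := by
    have hc : Continuous fun x => ε / (ψ x ^ 2 + ε) ^ 2 * h x * ‖gradient ψ x‖ ^ 2 :=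
      (((continuous_const.div ((hψ.continuous.pow 2).add continuous_const |>.pow 2)
        fun x => (pow_pos (hpos x) 2).ne').mul hh.continuous)).mul
        ((continuous_gradient hψ).norm.pow 2)
    refine (hh.integrable_mul hc).congr (ae_of_all _ fun x => ?_)
    simp only
    ring
  have i3 : Integrable (fun x => V x * ψ x * (ψ x / (ψ x ^ 2 + ε) * h x ^ 2)) volume := by
    refine (hη.integrable_mul (hV.mul hψ.continuous)).congr (ae_of_all _ fun x => ?_)
    simp only [Pi.mul_apply]
    ring
  have i4 : Integrable (fun x => ‖gradient h x‖ ^ 2) volume := by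
    refine (hh.integrable_inner (continuous_gradient hh.1)).congr (ae_of_all _ fun x => ?_)
    exact real_inner_self_eq_norm_sq _
  rw [integral_sub i3 i2]
  have e1 : ∫ x, V x * ψ x * (ψ x / (ψ x ^ 2 + ε) * h x ^ 2) = ∫ x, inner ℝ (gradient ψ x)
      (gradient (fun x => ψ x / (ψ x ^ 2 + ε) * (h x * h x)) x) := by
    rw [heq _ hη]
    simp only [pow_two]
  rw [e1, ← integral_sub i1 i2]
  refine integral_mono (i1.sub i2) i4 fun x => ?_
  have hk : HasDerivAt (fun s : ℝ => s / (s ^ 2 + ε))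
      ((1 * (ψ x ^ 2 + ε) - ψ x * (2 * ψ x)) / (ψ x ^ 2 + ε) ^ 2) (ψ x) := by
    have h2 : HasDerivAt (fun s : ℝ => s ^ 2 + ε) (2 * ψ x) (ψ x) := by
      simpa using (hasDerivAt_pow 2 (ψ x)).add_const ε
    exact (hasDerivAt_id (ψ x)).div h2 (hpos x).ne'
  have g1 : gradient (fun x => ψ x / (ψ x ^ 2 + ε) * (h x * h x)) x =
      (ψ x / (ψ x ^ 2 + ε)) • (h x • gradient h x + h x • gradient h x) + (h x * h x) •
        (((1 * (ψ x ^ 2 + ε) - ψ x * (2 * ψ x)) / (ψ x ^ 2 + ε) ^ 2) • gradient ψ x) := by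
    rw [gradient_mul' (hsm.diffAt x) ((hh.1.mul hh.1).diffAt x),
      gradient_mul' (hh.1.diffAt x) (hh.1.diffAt x), gradient_comp' hk (hψ.diffAt x)]
  set k := ψ x / (ψ x ^ 2 + ε) with hkdef
  set D := gradient ψ x
  set g := gradient h x
  -- with `k` the regularization of `1/ψ`, this is `ψ² |∇(h/ψ)|² ≥ 0`
  have key : 0 ≤ ‖g - (k * h x) • D‖ ^ 2 := by positivity
  rw [norm_sub_sq_real, norm_smul, inner_smul_right, mul_pow, Real.norm_eq_abs, sq_abs,
    real_inner_comm D g] at key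
  simp only [g1, inner_add_right, inner_smul_right, real_inner_self_eq_norm_sq]
  have hk2 : (1 * (ψ x ^ 2 + ε) - ψ x * (2 * ψ x)) / (ψ x ^ 2 + ε) ^ 2 =
      ε / (ψ x ^ 2 + ε) ^ 2 - k ^ 2 := by
    rw [hkdef]; field_simp; ring
  rw [hk2]
  nlinarith [key]

/-- If `-Δψ = V ψ` and `h` vanishes where `ψ` does, to first order, then `∫ V h² ≤ ∫ |∇h|²`: the
difference is formally `∫ ψ² |∇(h/ψ)|²`. -/
theorem jacobi_inequality {ψ V h : Space N → ℝ} (hψ : ContDiff ℝ ∞ ψ) (hV : Continuous V)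
    (heq : WeakSol V ψ) (hh : IsTest h) {C : ℝ} (hC : ∀ x, |h x| ≤ C * |ψ x|) :
    ∫ x, V x * h x ^ 2 ≤ ∫ x, ‖gradient h x‖ ^ 2 := by
  set e : ℕ → ℝ := fun n => 1 / ((n : ℝ) + 1) with he
  have epos : ∀ n, 0 < e n := fun n => by positivity
  have hlim : Tendsto (fun n => ∫ x, (V x * ψ x * (ψ x / (ψ x ^ 2 + e n) * h x ^ 2)
      - e n / (ψ x ^ 2 + e n) ^ 2 * h x ^ 2 * ‖gradient ψ x‖ ^ 2)) atTop
      (𝓝 (∫ x, V x * h x ^ 2)) := by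
    refine tendsto_integral_of_dominated_convergence
      (fun x => |V x| * h x ^ 2 + (tsupport h).indicator (fun x => C ^ 2 * ‖gradient ψ x‖ ^ 2) x)
      (fun n => ?_) ?_ (fun n => ae_of_all _ fun x => ?_) (ae_of_all _ fun x => ?_)
    · have hp : ∀ x, ψ x ^ 2 + e n ≠ 0 := fun x => by have := epos n; positivity
      have hp2 : ∀ x, (ψ x ^ 2 + e n) ^ 2 ≠ 0 := fun x => pow_ne_zero 2 (hp x)
      have hcψ := hψ.continuous
      have hch := hh.continuous
      have hcg := continuous_gradient hψ
      refine Continuous.aestronglyMeasurable ?_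
      fun_prop (disch := assumption)
    · refine Integrable.add ?_ ?_
      · refine (hh.integrable_mul (hV.abs.mul hh.continuous)).congr (ae_of_all _ fun x => ?_)
        simp only [Pi.mul_apply]
        ring
      · rw [integrable_indicator_iff (isClosed_tsupport h).measurableSet]
        exact (continuous_const.mul ((continuous_gradient hψ).norm.pow 2)).continuousOn
          |>.integrableOn_compact hh.2
    · have hs : 0 < ψ x ^ 2 + e n := by have := epos n; positivity
      refine (norm_sub_le _ _).trans (add_le_add ?_ ?_)
      · rw [Real.norm_eq_abs, show V x * ψ x * (ψ x / (ψ x ^ 2 + e n) * h x ^ 2) =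
          V x * (ψ x ^ 2 / (ψ x ^ 2 + e n)) * h x ^ 2 by field_simp, abs_mul, abs_mul,
          abs_of_nonneg (sq_nonneg (h x)), abs_of_nonneg (a := ψ x ^ 2 / (ψ x ^ 2 + e n))
          (by positivity)]
        have : ψ x ^ 2 / (ψ x ^ 2 + e n) ≤ 1 := by
          rw [div_le_one hs]; linarith [epos n]
        gcongr
        exact mul_le_of_le_one_right (abs_nonneg _) this
      · by_cases hx : x ∈ tsupport h
        · rw [Set.indicator_of_mem hx, Real.norm_eq_abs, abs_of_nonneg (by
            have := epos n; positivity)]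
          gcongr
          rw [div_mul_eq_mul_div, div_le_iff₀ (by positivity)]
          have h2 : h x ^ 2 ≤ C ^ 2 * ψ x ^ 2 := by
            rw [← mul_pow, ← sq_abs (h x)]
            have := hC x
            rw [← sq_abs (C * ψ x), abs_mul]
            refine pow_le_pow_left₀ (abs_nonneg _) (this.trans ?_) 2
            gcongr
            exact le_abs_self C
          have h3 : e n * ψ x ^ 2 ≤ (ψ x ^ 2 + e n) ^ 2 := by
            nlinarith [epos n, sq_nonneg (ψ x), mul_nonneg (sq_nonneg (ψ x)) (epos n).le,
              sq_nonneg (ψ x ^ 2)]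
          calc e n * h x ^ 2 ≤ e n * (C ^ 2 * ψ x ^ 2) := by gcongr
            _ = C ^ 2 * (e n * ψ x ^ 2) := by ring
            _ ≤ _ := by gcongr
        · rw [image_eq_zero_of_notMem_tsupport hx, Set.indicator_of_notMem hx]
          simp
    · by_cases hx : ψ x = 0
      · have : h x = 0 := by simpa [hx] using hC x
        simp [hx, this]
      · have het : Tendsto e atTop (𝓝 0) := tendsto_one_div_add_atTop_nhds_zero_nat
        have hne : ψ x ^ 2 + 0 ≠ 0 := by positivity
        have hb : Tendsto (fun n => ψ x ^ 2 + e n) atTop (𝓝 (ψ x ^ 2 + 0)) :=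
          tendsto_const_nhds.add het
        have h1 := ((tendsto_const_nhds (x := ψ x)).div hb hne).mul_const (h x ^ 2)
          |>.const_mul (V x * ψ x)
        have h2 := ((het.div (hb.pow 2) (pow_ne_zero 2 hne)).mul_const (h x ^ 2)).mul_const
          (‖gradient ψ x‖ ^ 2)
        have h3 := h1.sub h2
        have e3 : V x * ψ x * (ψ x / (ψ x ^ 2 + 0) * h x ^ 2) -
            0 / (ψ x ^ 2 + 0) ^ 2 * h x ^ 2 * ‖gradient ψ x‖ ^ 2 = V x * h x ^ 2 := by
          rw [add_zero, zero_div]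
          field_simp
          ring
        rw [e3] at h3
        exact h3
  exact le_of_tendsto' hlim fun n => jacobi_regularized hψ hV heq hh (epos n)

/-- For test functions, the domination needed in `jacobi_inequality` does not see a positive factor
of the comparison function. -/
theorem exists_le_mul_of_factor {h q P : Space N → ℝ} (hh : IsTest h) (hP : Continuous P)
    (hP0 : ∀ x, 0 < P x) {L : ℝ} (hL : 0 ≤ L) (hq : ∀ x, |h x| ≤ L * |q x|) :
    ∃ C, ∀ x, |h x| ≤ C * |q x * P x| := by
  obtain ⟨M, hM⟩ := (hh.2.isCompact).exists_bound_of_continuousOn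
    (f := fun x => (P x)⁻¹) (hP.inv₀ fun x => (hP0 x).ne').continuousOn
  refine ⟨L * |M|, fun x => ?_⟩
  by_cases hx : x ∈ tsupport h
  · have h1 := (hM x hx).trans (le_abs_self M)
    rw [Real.norm_eq_abs, abs_of_pos (inv_pos.2 (hP0 x)), inv_le_iff_one_le_mul₀ (hP0 x)] at h1
    rw [abs_mul, abs_of_pos (hP0 x)]
    calc |h x| ≤ L * |q x| * 1 := by simpa using hq x
      _ ≤ L * |q x| * (|M| * P x) := by gcongr
      _ = _ := by ring
  · rw [image_eq_zero_of_notMem_tsupport hx, abs_zero]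
    positivity

theorem IsTest.exists_lipschitz {h : Space N → ℝ} (hh : IsTest h) :
    ∃ L : ℝ, 0 ≤ L ∧ ∀ x y, |h x - h y| ≤ L * ‖x - y‖ := by
  obtain ⟨C, hC⟩ := (hh.1.of_le (by simp)).lipschitzWith_of_hasCompactSupport
    hh.2 one_ne_zero
  exact ⟨C, C.2, fun x y => by simpa [Real.dist_eq, dist_eq_norm] using hC.dist_le_mul x y⟩

theorem inner_gradient_apply' (f : Space N → ℝ) (x e : Space N) :
    inner ℝ e (gradient f x) = fderiv ℝ f x e := by
  rw [real_inner_comm, inner_gradient_apply]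

/-! ### Powers of the bracket `1 + |x|²/κ` -/

/-- The function `(1 + |x|²/κ)^{-b}`. -/
def jap (κ b : ℝ) (x : Space N) : ℝ := (1 + ‖x‖ ^ 2 / κ) ^ (-b)

section jap
variable {κ : ℝ} (hκ : 0 < κ)
include hκ

theorem jap_base_pos (x : Space N) : 0 < 1 + ‖x‖ ^ 2 / κ := by positivity

theorem jap_pos (b : ℝ) (x : Space N) : 0 < jap κ b x := Real.rpow_pos_of_pos (jap_base_pos hκ x) _

theorem jap_contDiff (b : ℝ) : ContDiff ℝ ∞ (jap κ b : Space N → ℝ) :=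
  (contDiff_const.add ((contDiff_norm_sq ℝ).div_const _)).rpow_const_of_ne
    fun x => (jap_base_pos hκ x).ne'

theorem jap_mul (a b : ℝ) (x : Space N) : jap κ a x * jap κ b x = jap κ (a + b) x := by
  rw [jap, jap, jap, ← Real.rpow_add (jap_base_pos hκ x)]
  ring_nf

theorem base_mul_jap (b : ℝ) (x : Space N) :
    (1 + ‖x‖ ^ 2 / κ) * jap κ (b + 1) x = jap κ b x := by
  have := jap_mul hκ (-1) (b + 1) x
  rw [jap, neg_neg, Real.rpow_one] at this
  rw [this]; ring_nf

theorem sq_mul_jap (b : ℝ) (x : Space N) :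
    ‖x‖ ^ 2 / κ * jap κ (b + 1) x = jap κ b x - jap κ (b + 1) x := by
  rw [← base_mul_jap hκ b x]; ring

theorem jap_rpow (b c : ℝ) (x : Space N) : jap κ b x ^ c = jap κ (b * c) x := by
  rw [jap, jap, ← Real.rpow_mul (jap_base_pos hκ x).le]; ring_nf

theorem fderiv_jap (b : ℝ) (x e : Space N) :
    fderiv ℝ (jap κ b) x e = -(2 * b / κ) * jap κ (b + 1) x * inner ℝ x e := by
  have h1 : HasFDerivAt (fun y : Space N => 1 + ‖y‖ ^ 2 / κ) (κ⁻¹ • ((2 : ℕ) • innerSL ℝ x)) x := by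
    have := ((hasStrictFDerivAt_norm_sq x).hasFDerivAt.const_mul κ⁻¹).const_add 1
    refine this.congr_of_eventuallyEq (Eventually.of_forall fun y => ?_)
    simp only [div_eq_inv_mul]
  have h2 := h1.rpow_const (p := -b) (Or.inl (jap_base_pos hκ x).ne')
  have h3 : fderiv ℝ (jap κ b) x = _ := h2.fderiv
  rw [h3, jap, show -(b + 1) = -b - 1 by ring]
  simp only [smul_apply, nsmul_eq_mul, smul_eq_mul, innerSL_apply_apply, Nat.cast_ofNat]
  field_simp

theorem gradient_jap (b : ℝ) (x : Space N) :
    gradient (jap κ b) x = (-(2 * b / κ) * jap κ (b + 1) x) • x := by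
  refine ext_inner_right ℝ fun e => ?_
  rw [inner_gradient_apply, fderiv_jap hκ, inner_smul_left]
  simp

omit hκ in
theorem jap_isometry (b : ℝ) (T : Space N ≃ₗᵢ[ℝ] Space N) (x : Space N) :
    jap κ b (T x) = jap κ b x := by simp [jap]

/-- `-Δ (1+|x|²/κ)^{-b}`, in weak form. -/
theorem jap_weak_laplacian (b : ℝ) {η : Space N → ℝ} (hη : IsTest η) :
    ∫ x, inner ℝ (gradient (jap κ b) x) (gradient η x) =
      ∫ x, 2 * b / κ * ((N - 2 * b - 2) * jap κ (b + 1) x +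
        2 * (b + 1) * jap κ (b + 2) x) * η x := by
  have ha : ContDiff ℝ ∞ fun x : Space N => -(2 * b / κ) * jap κ (b + 1) x :=
    contDiff_const.mul (jap_contDiff hκ _)
  have h := integral_mul_fderiv_self_test ha hη
  have e1 : ∀ x, inner ℝ (gradient (jap κ b) x) (gradient η x) =
      -(2 * b / κ) * jap κ (b + 1) x * fderiv ℝ η x x := fun x => by
    rw [gradient_jap hκ, inner_smul_left, inner_gradient_apply']
    simp
  simp_rw [e1]
  rw [h, ← integral_neg]
  refine integral_congr_ae (ae_of_all _ fun x => ?_)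
  simp only
  have hd : fderiv ℝ (fun x : Space N => -(2 * b / κ) * jap κ (b + 1) x) x x =
      -(2 * b / κ) * (-(2 * (b + 1) / κ) * jap κ (b + 2) x * ‖x‖ ^ 2) := by
    rw [fderiv_const_mul ((jap_contDiff hκ _).diffAt x)]
    simp only [smul_apply, smul_eq_mul]
    rw [fderiv_jap hκ, real_inner_self_eq_norm_sq]
    ring_nf
  have hs := sq_mul_jap hκ (b + 1) x
  rw [show b + 1 + 1 = b + 2 by ring] at hs
  rw [hd]
  have : jap κ (b + 2) x * ‖x‖ ^ 2 = κ * (jap κ (b + 1) x - jap κ (b + 2) x) := by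
    rw [← hs]; field_simp
  rw [mul_assoc _ (jap κ (b + 2) x), this]
  field_simp
  ring

end jap

/-! ### Hardy's inequality -/

/-- **Hardy's inequality**, with the weight `|x|⁻²` regularized so as to be smooth: it is
`jacobi_inequality` for the bracket to the power `-(N-2)/4`. -/
theorem hardy (hN : 3 ≤ N) {h : Space N → ℝ} (hh : IsTest h) {δ : ℝ} (hδ : 0 < δ) :
    ((N : ℝ) - 2) ^ 2 / 4 * ∫ x, h x ^ 2 / (‖x‖ ^ 2 + δ) ≤ ∫ x, ‖gradient h x‖ ^ 2 := by
  have hN' : (3 : ℝ) ≤ N := by exact_mod_cast hN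
  -- `b = (N-2)/4` maximizes the coefficient `2b(N-2-2b)` of the potential, giving `(N-2)²/4`
  set b : ℝ := ((N : ℝ) - 2) / 4 with hb
  set V : Space N → ℝ := fun x =>
    2 * b / δ * ((N - 2 * b - 2) * jap δ 1 x + 2 * (b + 1) * jap δ 2 x) with hV
  have hVc : Continuous V := continuous_const.mul
    ((continuous_const.mul (jap_contDiff hδ _).continuous).add
      (continuous_const.mul (jap_contDiff hδ _).continuous))
  have hw : WeakSol V (jap δ b) := fun η hη => by
    rw [jap_weak_laplacian hδ b hη]
    refine integral_congr_ae (ae_of_all _ fun x => ?_)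
    simp only [hV]
    rw [show b + 1 = 1 + b by ring, show b + 2 = 2 + b by ring, ← jap_mul hδ 1 b,
      ← jap_mul hδ 2 b]
    ring
  obtain ⟨L, hL0, hL⟩ : ∃ L : ℝ, 0 ≤ L ∧ ∀ x, |h x| ≤ L * |(1 : ℝ)| := by
    obtain ⟨C, hC⟩ := hh.continuous.bounded_above_of_compact_support hh.2
    exact ⟨C, (norm_nonneg _).trans (hC 0), fun x => by simpa using hC x⟩
  obtain ⟨C, hC⟩ := exists_le_mul_of_factor (q := fun _ => 1) hh (jap_contDiff hδ b).continuous
    (jap_pos hδ b) hL0 hL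
  have key := jacobi_inequality (jap_contDiff hδ b) hVc hw hh (C := C) (by simpa using hC)
  refine le_trans ?_ key
  rw [← integral_const_mul]
  have hc2 : Continuous fun x : Space N => h x / (‖x‖ ^ 2 + δ) :=
    hh.continuous.div (by fun_prop) fun x => by positivity
  refine integral_mono ?_ ?_ fun x => ?_
  · refine ((hh.integrable_mul hc2).const_mul (((N : ℝ) - 2) ^ 2 / 4)).congr
      (ae_of_all _ fun x => ?_)
    simp only
    ring_nf
  · refine (hh.integrable_mul (hVc.mul hh.continuous)).congr (ae_of_all _ fun x => ?_)
    simp only [Pi.mul_apply]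
    ring
  · simp only [hV]
    have h1 : jap δ 1 x = δ / (‖x‖ ^ 2 + δ) := by
      rw [jap, Real.rpow_neg_one]
      field_simp
      ring_nf
    have h2 := (jap_pos hδ 2 x).le
    have e : ((N : ℝ) - 2) ^ 2 / 4 * (h x ^ 2 / (‖x‖ ^ 2 + δ)) =
        2 * b / δ * ((N - 2 * b - 2) * jap δ 1 x) * h x ^ 2 := by
      rw [h1, hb]; field_simp; ring
    rw [e]
    have : 0 ≤ b := by rw [hb]; linarith
    gcongr
    nlinarith

/-! ### The linearized operator on odd functions -/

/-- The constant `κ = N(N-2)`. -/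
def kap (N : ℕ) : ℝ := (N : ℝ) * ((N : ℝ) - 2)

theorem kap_pos (hN : 3 ≤ N) : 0 < kap N := by
  have hN' : (3 : ℝ) ≤ N := by exact_mod_cast hN
  unfold kap
  nlinarith

/-- The critical exponent `p = (N+2)/(N-2)`. -/
def pexp (N : ℕ) : ℝ := ((N : ℝ) + 2) / ((N : ℝ) - 2)

/-- The potential `W^{4/(N-2)} = (1+|x|²/κ)^{-2}`. -/
def pot (N : ℕ) : Space N → ℝ := jap (kap N) 2

/-- `f'(W)` admits the partial derivatives of `W` as zero modes; they are odd. -/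
theorem weakSol_odd (hN : 3 ≤ N) (e : Space N) :
    WeakSol (fun x => pexp N * pot N x) (fun x => inner ℝ e x * jap (kap N) (N / 2) x) := by
  intro η hη
  have hN' : (3 : ℝ) ≤ N := by exact_mod_cast hN
  have hκ := kap_pos hN
  set κ := kap N with hκd
  have hl : ContDiff ℝ ∞ fun x : Space N => inner ℝ e x := contDiff_const.inner ℝ contDiff_id
  have hP := jap_contDiff (N := N) hκ (N / 2)
  have hP1 := jap_contDiff (N := N) hκ (N / 2 + 1)
  have hgl : ∀ x : Space N, ∀ v, fderiv ℝ (fun x : Space N => inner ℝ e x) x v = inner ℝ e v := by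
    intro x v
    have : HasFDerivAt (fun x : Space N => inner ℝ e x) (innerSL ℝ e) x :=
      (innerSL ℝ e).hasFDerivAt
    rw [this.fderiv]; rfl
  have hgrad : ∀ x : Space N, gradient (fun x : Space N => inner ℝ e x) x = e := fun x =>
    ext_inner_right ℝ fun v => by rw [inner_gradient_apply, hgl]
  -- the gradient is `P e + a x`
  set a : Space N → ℝ := fun x => -((N : ℝ) / κ) * (inner ℝ e x * jap κ (N / 2 + 1) x) with had
  have ha : ContDiff ℝ ∞ a := contDiff_const.mul (hl.mul hP1)
  have h1 : ∀ x, inner ℝ (gradient (fun x => inner ℝ e x * jap κ (N / 2) x) x) (gradient η x) =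
      jap κ (N / 2) x * fderiv ℝ η x e + a x * fderiv ℝ η x x := fun x => by
    rw [gradient_mul' (hl.diffAt x) (hP.diffAt x), hgrad, gradient_jap hκ, inner_add_left,
      inner_smul_left, inner_smul_left, inner_smul_left, inner_gradient_apply',
      inner_gradient_apply']
    simp only [had, conj_trivial]
    ring
  have c1 : Integrable (fun x => jap κ (N / 2) x * fderiv ℝ η x e) volume := by
    refine (hη.integrable_inner (G := fun x => jap κ (N / 2) x • e)
      (hP.continuous.smul continuous_const)).congr (ae_of_all _ fun x => ?_)
    simp only
    rw [inner_smul_left, inner_gradient_apply']; rfl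
  have c2 : Integrable (fun x => a x * fderiv ℝ η x x) volume := by
    refine (hη.integrable_inner (G := fun x => a x • x)
      (ha.continuous.smul continuous_id)).congr (ae_of_all _ fun x => ?_)
    simp only
    rw [inner_smul_left, inner_gradient_apply']; rfl
  have d1 : Continuous fun x => fderiv ℝ (jap κ (N / 2)) x e :=
    (hP.continuous_fderiv (by simp)).clm_apply continuous_const
  have d2 : Continuous fun x => (N * a x + fderiv ℝ a x x) :=
    (continuous_const.mul ha.continuous).add
      ((ha.continuous_fderiv (by simp)).clm_apply continuous_id)
  simp_rw [h1]
  rw [integral_add c1 c2, integral_mul_fderiv_test hP hη, integral_mul_fderiv_self_test ha hη,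
    ← neg_add, ← integral_add (hη.integrable_mul d1) (hη.integrable_mul d2), ← integral_neg]
  refine integral_congr_ae (ae_of_all _ fun x => ?_)
  simp only
  have hda : fderiv ℝ a x x = -((N : ℝ) / κ) * (inner ℝ e x * (-(2 * (N / 2 + 1) / κ) *
      jap κ (N / 2 + 1 + 1) x * ‖x‖ ^ 2) + jap κ (N / 2 + 1) x * inner ℝ e x) := by
    rw [had, fderiv_const_mul ((hl.mul hP1).diffAt x), fderiv_fun_mul (hl.diffAt x) (hP1.diffAt x)]
    simp only [smul_apply, smul_eq_mul, add_apply]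
    rw [hgl, fderiv_jap hκ, real_inner_self_eq_norm_sq]
  have hs := sq_mul_jap hκ (N / 2 + 1) x
  have hs2 : jap κ ((N : ℝ) / 2 + 1 + 1) x * ‖x‖ ^ 2 =
      κ * (jap κ (N / 2 + 1) x - jap κ (N / 2 + 1 + 1) x) := by
    rw [← hs]; field_simp
  rw [hda, fderiv_jap hκ, mul_assoc _ (jap κ (N / 2 + 1 + 1) x), hs2, real_inner_comm]
  simp only [had, pot, pexp]
  have hm : jap κ 2 x * (inner ℝ e x * jap κ (N / 2) x) =
      inner ℝ e x * jap κ (N / 2 + 1 + 1) x := by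
    rw [show (N : ℝ) / 2 + 1 + 1 = 2 + N / 2 by ring, ← jap_mul hκ]; ring
  rw [← hκd, mul_assoc (((N : ℝ) + 2) / (N - 2)), hm]
  have h2 : (N : ℝ) - 2 ≠ 0 := by linarith
  have h0 : (N : ℝ) ≠ 0 := by linarith
  rw [hκd, kap]
  field_simp
  ring

/-- The linearized operator `-Δ - f'(W)` is nonnegative on functions that are odd with respect to a
hyperplane. -/
theorem odd_test_nonneg (hN : 3 ≤ N) {e : Space N} (he : ‖e‖ = 1) {h : Space N → ℝ}
    (hh : IsTest h) (hodd : ∀ x, h ((ℝ ∙ e)ᗮ.reflection x) = -h x) :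
    ∫ x, pexp N * pot N x * h x ^ 2 ≤ ∫ x, ‖gradient h x‖ ^ 2 := by
  have hκ := kap_pos hN
  obtain ⟨L, hL0, hL⟩ := hh.exists_lipschitz
  have h1 : ∀ x, |h x| ≤ L * |(inner ℝ e x : ℝ)| := by
    intro x
    -- the projection of `x` to the hyperplane, on which the odd function `h` vanishes
    set y : Space N := x - (inner ℝ e x : ℝ) • e with hy
    have hyo : y ∈ (ℝ ∙ e)ᗮ := by
      rw [Submodule.mem_orthogonal_singleton_iff_inner_right, hy, inner_sub_right,
        inner_smul_right, real_inner_self_eq_norm_sq, he]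
      ring
    have hfix := Submodule.reflection_mem_subspace_eq_self hyo
    have hy0 : h y = 0 := by
      have := hodd y
      rw [hfix] at this
      linarith
    have := hL x y
    rw [hy0, sub_zero, hy, sub_sub_cancel, norm_smul, he, mul_one, Real.norm_eq_abs] at this
    exact this
  obtain ⟨C, hC⟩ := exists_le_mul_of_factor hh (jap_contDiff hκ (N / 2)).continuous
    (jap_pos hκ _) hL0 h1
  exact jacobi_inequality ((contDiff_const.inner ℝ contDiff_id).mul (jap_contDiff hκ _))
    (continuous_const.mul (jap_contDiff hκ 2).continuous) (weakSol_odd hN e) hh hC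

/-! ### The third radial eigenfunction -/

/-- The third radial eigenvalue of `-Δ u = μ W^{4/(N-2)} u` (the first two are `1` and `p`). -/
def mu2 (N : ℕ) : ℝ := ((N : ℝ) + 4) * (N + 2) / (N * (N - 2))

theorem pexp_lt_mu2 (hN : 3 ≤ N) : pexp N < mu2 N := by
  have hN' : (3 : ℝ) ≤ N := by exact_mod_cast hN
  have h2 : (0 : ℝ) < (N : ℝ) - 2 := by linarith
  unfold pexp mu2
  rw [div_lt_div_iff₀ h2 (by positivity)]
  nlinarith [mul_pos h2 h2]

theorem one_lt_pexp (hN : 3 ≤ N) : 1 < pexp N := by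
  have hN' : (3 : ℝ) ≤ N := by exact_mod_cast hN
  unfold pexp
  rw [one_lt_div (by linarith)]
  linarith

/-- The radial eigenfunction with eigenvalue `mu2`: up to a factor, `W` times the Gegenbauer
polynomial of degree two in `(1-t)/(1+t)`, `t = |x|²/κ`. -/
def psi2 (N : ℕ) (x : Space N) : ℝ :=
  N * jap (kap N) (N / 2 - 1) x + -(4 * N + 4) * jap (kap N) (N / 2) x +
    (4 * N + 4) * jap (kap N) (N / 2 + 1) x

theorem pot_mul_jap (hN : 3 ≤ N) (b : ℝ) (x : Space N) :
    pot N x * jap (kap N) b x = jap (kap N) (b + 2) x := by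
  rw [pot, jap_mul (kap_pos hN), add_comm]

/-- A combination of three brackets solves `-Δψ = μ W^{4/(N-2)} ψ` as soon as the explicit identity
`h` between brackets holds. -/
theorem WeakSol.linear_comb3 (hN : 3 ≤ N) (μ c1 c2 c3 b1 b2 b3 : ℝ)
    (h : ∀ x : Space N,
      c1 * (2 * b1 / kap N * ((N - 2 * b1 - 2) * jap (kap N) (b1 + 1) x +
        2 * (b1 + 1) * jap (kap N) (b1 + 2) x)) +
      c2 * (2 * b2 / kap N * ((N - 2 * b2 - 2) * jap (kap N) (b2 + 1) x +
        2 * (b2 + 1) * jap (kap N) (b2 + 2) x)) +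
      c3 * (2 * b3 / kap N * ((N - 2 * b3 - 2) * jap (kap N) (b3 + 1) x +
        2 * (b3 + 1) * jap (kap N) (b3 + 2) x)) =
      μ * (c1 * jap (kap N) (b1 + 2) x + c2 * jap (kap N) (b2 + 2) x +
        c3 * jap (kap N) (b3 + 2) x)) :
    WeakSol (fun x => μ * pot N x) fun x =>
      c1 * jap (kap N) b1 x + c2 * jap (kap N) b2 x + c3 * jap (kap N) b3 x := by
  intro η hη
  have hκ := kap_pos hN
  have hs : ∀ b, ContDiff ℝ ∞ (jap (kap N) b : Space N → ℝ) := jap_contDiff hκ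
  have hg : ∀ x : Space N, gradient (fun x =>
      c1 * jap (kap N) b1 x + c2 * jap (kap N) b2 x + c3 * jap (kap N) b3 x) x =
      c1 • gradient (jap (kap N) b1) x + c2 • gradient (jap (kap N) b2) x +
        c3 • gradient (jap (kap N) b3) x := fun x => by
    have d : ∀ (c b : ℝ), DifferentiableAt ℝ (c • jap (kap N) b) x := fun c b =>
      ((hs b).diffAt x).const_smul c
    have := gradient_add' ((d c1 b1).add (d c2 b2)) (d c3 b3)
    rw [gradient_add' (d c1 b1) (d c2 b2), gradient_smul' _ ((hs b1).diffAt x),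
      gradient_smul' _ ((hs b2).diffAt x), gradient_smul' _ ((hs b3).diffAt x)] at this
    exact this
  have hi : ∀ c b, Integrable (fun x => c * inner ℝ (gradient (jap (kap N) b) x) (gradient η x))
      volume := fun c b => (hη.integrable_inner (continuous_gradient (hs b))).const_mul c
  have hj : ∀ b, Integrable (fun x => 2 * b / kap N * ((N - 2 * b - 2) * jap (kap N) (b + 1) x +
      2 * (b + 1) * jap (kap N) (b + 2) x) * η x) volume := fun b =>
    hη.integrable_mul (continuous_const.mul ((continuous_const.mul (hs _).continuous).add
      (continuous_const.mul (hs _).continuous)))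
  simp_rw [hg, inner_add_left, inner_smul_left, conj_trivial]
  have i12 : Integrable (fun x => c1 * inner ℝ (gradient (jap (kap N) b1) x) (gradient η x) +
      c2 * inner ℝ (gradient (jap (kap N) b2) x) (gradient η x)) volume := (hi _ _).add (hi _ _)
  rw [integral_add i12 (hi _ _), integral_add (hi _ _) (hi _ _),
    integral_const_mul, integral_const_mul, integral_const_mul, jap_weak_laplacian hκ _ hη,
    jap_weak_laplacian hκ _ hη, jap_weak_laplacian hκ _ hη, ← integral_const_mul,
    ← integral_const_mul, ← integral_const_mul, ← integral_add ((hj _).const_mul _)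
    ((hj _).const_mul _)]
  refine Eq.trans (integral_add (((hj b1).const_mul c1).add ((hj b2).const_mul c2))
    ((hj b3).const_mul c3)).symm ?_
  refine integral_congr_ae (ae_of_all _ fun x => ?_)
  have e : pot N x * (c1 * jap (kap N) b1 x + c2 * jap (kap N) b2 x + c3 * jap (kap N) b3 x) =
      c1 * jap (kap N) (b1 + 2) x + c2 * jap (kap N) (b2 + 2) x + c3 * jap (kap N) (b3 + 2) x := by
    simp only [← pot_mul_jap hN]; ring
  simp only [Pi.add_apply]
  rw [mul_assoc μ, e, ← h x]; ring

/-- `psi2` is an eigenfunction with eigenvalue `mu2`. -/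
theorem weakSol_psi2 (hN : 3 ≤ N) : WeakSol (fun x => mu2 N * pot N x) (psi2 N) := by
  have hN' : (3 : ℝ) ≤ N := by exact_mod_cast hN
  refine WeakSol.linear_comb3 hN _ _ _ _ _ _ _ fun x => ?_
  rw [show (N : ℝ) / 2 - 1 + 1 = N / 2 by ring, show (N : ℝ) / 2 - 1 + 2 = N / 2 + 1 by ring,
    show (N : ℝ) / 2 + 1 + 1 = N / 2 + 2 by ring]
  have h2 : (N : ℝ) - 2 ≠ 0 := by linarith
  have h0 : (N : ℝ) ≠ 0 := by linarith
  rw [kap, mu2]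
  field_simp
  ring

/-- `psi2` is a positive function times a quadratic polynomial in `|x|²/κ`; its roots are the nodal
spheres. -/
theorem psi2_eq (hN : 3 ≤ N) (x : Space N) :
    psi2 N x = (N * (‖x‖ ^ 2 / kap N) ^ 2 - 2 * (N + 2) * (‖x‖ ^ 2 / kap N) + N) *
      jap (kap N) (N / 2 + 1) x := by
  have hκ := kap_pos hN
  have h1 := base_mul_jap hκ ((N : ℝ) / 2) x
  have h2 := base_mul_jap hκ ((N : ℝ) / 2 - 1) x
  rw [show (N : ℝ) / 2 - 1 + 1 = N / 2 by ring] at h2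
  rw [psi2, ← h2, ← h1]
  ring

/-- A test function vanishing on the two nodal spheres of the third radial eigenfunction satisfies
the Poincaré inequality with the third radial eigenvalue. -/
theorem exists_gap_radii (hN : 3 ≤ N) : ∃ r₁ r₂ : ℝ, 0 < r₁ ∧ r₁ < r₂ ∧
    ∀ h : Space N → ℝ, IsTest h → (∀ x, ‖x‖ = r₁ → h x = 0) → (∀ x, ‖x‖ = r₂ → h x = 0) →
      ∫ x, mu2 N * pot N x * h x ^ 2 ≤ ∫ x, ‖gradient h x‖ ^ 2 := by
  have hN' : (3 : ℝ) ≤ N := by exact_mod_cast hN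
  have hκ := kap_pos hN
  -- `t₁`, `t₂` are the roots of the quadratic polynomial in `psi2_eq`
  set s := √((N : ℝ) + 1) with hs
  have hs2 : s ^ 2 = N + 1 := Real.sq_sqrt (by positivity)
  have hs0 : 0 < s := Real.sqrt_pos.2 (by positivity)
  have hs1 : 2 * s < N + 2 := by nlinarith
  set t₁ : ℝ := (N + 2 - 2 * s) / N with ht1
  set t₂ : ℝ := (N + 2 + 2 * s) / N with ht2
  have h0 : (0 : ℝ) < N := by linarith
  have t1pos : 0 < t₁ := div_pos (by linarith) h0
  have t12 : t₁ < t₂ := by rw [ht1, ht2]; gcongr; linarith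
  have hsum : N * (t₁ + t₂) = 2 * (N + 2) := by rw [ht1, ht2]; field_simp; ring
  have hprod : t₁ * t₂ = 1 := by
    rw [ht1, ht2]; field_simp
    nlinarith
  set r₁ := √(kap N * t₁) with hr1
  set r₂ := √(kap N * t₂) with hr2
  have r1pos : 0 < r₁ := Real.sqrt_pos.2 (by positivity)
  have r12 : r₁ < r₂ := Real.sqrt_lt_sqrt (by positivity) (by gcongr)
  have r1sq : r₁ ^ 2 = kap N * t₁ := Real.sq_sqrt (by positivity)
  have r2sq : r₂ ^ 2 = kap N * t₂ := Real.sq_sqrt (by positivity)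
  refine ⟨r₁, r₂, r1pos, r12, fun h hh hz1 hz2 => ?_⟩
  obtain ⟨L, hL0, hL⟩ := hh.exists_lipschitz
  have : Nonempty (Fin N) := ⟨⟨0, by omega⟩⟩
  have hdist : ∀ r, 0 ≤ r → (∀ x : Space N, ‖x‖ = r → h x = 0) → ∀ x, |h x| ≤ L * |‖x‖ - r| := by
    intro r hr hz x
    obtain ⟨v, hv1, hv2⟩ : ∃ v : Space N, ‖v‖ = 1 ∧ x = ‖x‖ • v := by
      by_cases hx : x = 0
      · obtain ⟨v, hv⟩ := exists_norm_eq (Space N) zero_le_one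
        exact ⟨v, hv, by simp [hx]⟩
      · refine ⟨‖x‖⁻¹ • x, ?_, ?_⟩
        · rw [norm_smul, norm_inv, norm_norm, inv_mul_cancel₀ (norm_ne_zero_iff.2 hx)]
        · rw [smul_smul, mul_inv_cancel₀ (norm_ne_zero_iff.2 hx), one_smul]
    have h0 : h (r • v) = 0 := hz _ (by rw [norm_smul, hv1, Real.norm_eq_abs, abs_of_nonneg hr,
      mul_one])
    have := hL x (r • v)
    rw [h0, sub_zero] at this
    have e : ‖x - r • v‖ = |‖x‖ - r| := by
      conv_lhs => rw [hv2]
      rw [← sub_smul, norm_smul, hv1, mul_one, Real.norm_eq_abs]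
    rwa [e] at this
  have d1 := hdist r₁ r1pos.le hz1
  have d2 := hdist r₂ (r1pos.trans r12).le hz2
  have hq : ∀ x, |h x| ≤ L * (kap N) ^ 2 / (N * (r₁ * r₂ * ((r₂ - r₁) / 2))) *
      |N * (‖x‖ ^ 2 / kap N) ^ 2 - 2 * (N + 2) * (‖x‖ ^ 2 / kap N) + N| := by
    intro x
    have e1 : N * (‖x‖ ^ 2 / kap N) ^ 2 - 2 * (N + 2) * (‖x‖ ^ 2 / kap N) + N =
        N / (kap N) ^ 2 * (((‖x‖ - r₁) * (‖x‖ - r₂)) * ((‖x‖ + r₁) * (‖x‖ + r₂))) := by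
      have : ((‖x‖ - r₁) * (‖x‖ - r₂)) * ((‖x‖ + r₁) * (‖x‖ + r₂)) =
          (‖x‖ ^ 2 - r₁ ^ 2) * (‖x‖ ^ 2 - r₂ ^ 2) := by ring
      rw [this, r1sq, r2sq]
      have e2 : N / (kap N) ^ 2 * ((‖x‖ ^ 2 - kap N * t₁) * (‖x‖ ^ 2 - kap N * t₂)) =
        N * (‖x‖ ^ 2 / kap N) ^ 2 - (N * (t₁ + t₂)) * (‖x‖ ^ 2 / kap N) + N * (t₁ * t₂) := by
        field_simp; ring
      rw [e2, hsum, hprod, mul_one]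
    rw [e1, abs_mul, abs_mul, abs_mul, abs_of_pos (a := (N : ℝ) / kap N ^ 2) (by positivity),
      abs_of_nonneg (a := (‖x‖ + r₁) * (‖x‖ + r₂)) (by positivity)]
    have hpp : r₁ * r₂ ≤ (‖x‖ + r₁) * (‖x‖ + r₂) := by
      have := norm_nonneg x
      nlinarith [mul_nonneg this this, mul_nonneg this r1pos.le,
        mul_nonneg this (r1pos.trans r12).le]
    have hmm : |h x| * ((r₂ - r₁) / 2) ≤ L * (|‖x‖ - r₁| * |‖x‖ - r₂|) := by
      -- use the Lipschitz bound at the nearer of the two spheres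
      rcases le_total ‖x‖ ((r₁ + r₂) / 2) with hc | hc
      · have : (r₂ - r₁) / 2 ≤ |‖x‖ - r₂| := by
          rw [abs_sub_comm]; exact le_trans (by linarith) (le_abs_self _)
        calc _ ≤ (L * |‖x‖ - r₁|) * |‖x‖ - r₂| :=
              mul_le_mul (d1 x) this (by linarith) (by positivity)
          _ = _ := by ring
      · have : (r₂ - r₁) / 2 ≤ |‖x‖ - r₁| := le_trans (by linarith) (le_abs_self _)
        calc _ ≤ (L * |‖x‖ - r₂|) * |‖x‖ - r₁| :=
              mul_le_mul (d2 x) this (by linarith) (by positivity)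
          _ = _ := by ring
    have hr21 : 0 < (r₂ - r₁) / 2 := by linarith
    have hr2pos := r1pos.trans r12
    have e3 : L * (kap N) ^ 2 / (N * (r₁ * r₂ * ((r₂ - r₁) / 2))) *
        (N / kap N ^ 2 * (|‖x‖ - r₁| * |‖x‖ - r₂| * ((‖x‖ + r₁) * (‖x‖ + r₂)))) =
        (L * (|‖x‖ - r₁| * |‖x‖ - r₂|)) * ((‖x‖ + r₁) * (‖x‖ + r₂)) /
          (r₁ * r₂ * ((r₂ - r₁) / 2)) := by
      have : kap N ≠ 0 := hκ.ne'
      have : r₂ - r₁ ≠ 0 := by linarith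
      field_simp
    rw [e3, le_div_iff₀ (by positivity)]
    calc |h x| * (r₁ * r₂ * ((r₂ - r₁) / 2)) = (|h x| * ((r₂ - r₁) / 2)) * (r₁ * r₂) := by ring
      _ ≤ _ := mul_le_mul hmm hpp (by positivity) (by positivity)
  obtain ⟨C, hC⟩ := exists_le_mul_of_factor hh (jap_contDiff hκ ((N : ℝ) / 2 + 1)).continuous
    (jap_pos hκ _) (by have : 0 < r₂ - r₁ := by linarith
                       positivity) hq
  refine jacobi_inequality (ψ := psi2 N) ?_ (continuous_const.mul (jap_contDiff hκ 2).continuous)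
    (weakSol_psi2 hN) hh (C := C) fun x => ?_
  · exact ((contDiff_const.mul (jap_contDiff hκ _)).add
      (contDiff_const.mul (jap_contDiff hκ _))).add (contDiff_const.mul (jap_contDiff hκ _))
  · rw [psi2_eq hN]; exact hC x

/-! ### Integrability of the brackets; the ground state -/

theorem jap_integrable {κ : ℝ} (hκ : 0 < κ) {b : ℝ} (hb : (N : ℝ) < 2 * b) :
    Integrable (jap κ b : Space N → ℝ) volume := by
  have hb0 : 0 < b := by
    have : (0 : ℝ) ≤ N := by positivity
    linarith
  have h := integrable_rpow_neg_one_add_norm_sq (E := Space N) (μ := volume) (r := 2 * b)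
    (by simpa using hb)
  refine (h.const_mul ((max 1 κ) ^ b)).mono' (jap_contDiff hκ b).continuous.aestronglyMeasurable
    (ae_of_all _ fun x => ?_)
  rw [Real.norm_eq_abs, abs_of_pos (jap_pos hκ b x), jap, show -(2 * b) / 2 = -b by ring]
  have hm : 0 < max 1 κ := lt_max_of_lt_left one_pos
  have h1 : (1 + ‖x‖ ^ 2) / max 1 κ ≤ 1 + ‖x‖ ^ 2 / κ := by
    rw [add_div]
    refine add_le_add ((div_le_one hm).2 (le_max_left _ _)) ?_
    gcongr
    exact le_max_right _ _
  calc (1 + ‖x‖ ^ 2 / κ) ^ (-b) ≤ ((1 + ‖x‖ ^ 2) / max 1 κ) ^ (-b) :=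
        Real.rpow_le_rpow_of_nonpos (by positivity) h1 (by linarith)
    _ = _ := by
        rw [Real.div_rpow (by positivity) hm.le, Real.rpow_neg hm.le b, div_inv_eq_mul, mul_comm]

theorem jap_memLp {κ : ℝ} (hκ : 0 < κ) {b s : ℝ} (hs : 0 < s) (hb : (N : ℝ) < 2 * (b * s)) :
    MemLp (jap κ b : Space N → ℝ) (ENNReal.ofReal s) volume := by
  have hm : AEStronglyMeasurable (jap κ b : Space N → ℝ) volume :=
    (jap_contDiff hκ b).continuous.aestronglyMeasurable
  rw [← integrable_norm_rpow_iff hm (by simpa using hs) ENNReal.ofReal_ne_top]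
  refine (jap_integrable hκ hb).congr (ae_of_all _ fun x => ?_)
  simp only
  rw [Real.norm_eq_abs, abs_of_pos (jap_pos hκ b x), ENNReal.toReal_ofReal hs.le, jap_rpow hκ]

/-- The gradient decays like `|x|^{-(2b+1)}`, hence the condition. -/
theorem jap_gradient_memLp {κ : ℝ} (hκ : 0 < κ) {b : ℝ} (hb : (N : ℝ) < 2 * ((b + 1 / 2) * 2)) :
    MemLp (gradient (jap κ b : Space N → ℝ)) 2 volume := by
  have h := jap_memLp (N := N) hκ (b := b + 1 / 2) (s := 2) two_pos hb
  rw [ENNReal.ofReal_ofNat] at h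
  refine h.of_le_mul (c := |2 * b| / √κ)
    (continuous_gradient (jap_contDiff hκ b)).aestronglyMeasurable (ae_of_all _ fun x => ?_)
  rw [gradient_jap hκ, norm_smul, Real.norm_eq_abs, Real.norm_eq_abs, abs_mul, abs_neg, abs_div,
    abs_of_pos hκ, abs_of_pos (jap_pos hκ _ x), abs_of_pos (jap_pos hκ _ x)]
  have h1 : ‖x‖ / √κ * jap κ (b + 1) x ≤ jap κ (b + 1 / 2) x := by
    rw [show b + 1 = 1 / 2 + (b + 1 / 2) by ring, ← jap_mul hκ, ← mul_assoc]
    refine mul_le_of_le_one_left (jap_pos hκ _ x).le ?_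
    rw [jap, Real.rpow_neg (jap_base_pos hκ x).le, ← div_eq_mul_inv,
      div_le_one (Real.rpow_pos_of_pos (jap_base_pos hκ x) _), ← Real.sqrt_eq_rpow]
    refine Real.le_sqrt_of_sq_le ?_
    rw [div_pow, Real.sq_sqrt hκ.le]
    linarith
  have hsq : √κ * √κ = κ := Real.mul_self_sqrt hκ.le
  have hs0 : 0 < √κ := Real.sqrt_pos.2 hκ
  calc |2 * b| / κ * jap κ (b + 1) x * ‖x‖
      = |2 * b| / √κ * (‖x‖ / √κ * jap κ (b + 1) x) := by
        rw [show |2 * b| / κ = |2 * b| / √κ / √κ by rw [div_div, hsq]]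
        ring
    _ ≤ _ := by gcongr

/-- The critical Sobolev exponent `2* = 2N/(N-2)`. -/
def expS (N : ℕ) : ℝ := 2 * N / (N - 2)

theorem two_lt_expS (hN : 3 ≤ N) : 2 < expS N := by
  have hN' : (3 : ℝ) ≤ N := by exact_mod_cast hN
  rw [expS, lt_div_iff₀ (by linarith)]
  linarith

theorem jap_memHDot1 (hN : 3 ≤ N) {κ : ℝ} (hκ : 0 < κ) {b : ℝ} (hb : ((N : ℝ) - 2) / 2 ≤ b) :
    MemHDot1 (jap κ b : Space N → ℝ) := by
  have hN' : (3 : ℝ) ≤ N := by exact_mod_cast hN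
  refine ⟨?_, _, hasWeakGradient_gradient (jap_contDiff hκ b), jap_gradient_memLp hκ (by linarith)⟩
  have h2 := two_lt_expS hN
  refine jap_memLp (s := expS N) hκ (by linarith) ?_
  have : ((N : ℝ) - 2) / 2 * expS N ≤ b * expS N := by gcongr
  have e : ((N : ℝ) - 2) / 2 * expS N = N := by
    have : (N : ℝ) - 2 ≠ 0 := by linarith
    rw [expS]; field_simp
  linarith

theorem W_eq : W N = jap (kap N) (((N : ℝ) - 2) / 2) := rfl

theorem LW_eq (hN : 3 ≤ N) : scalingGenerator (W N) = fun x =>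
    ((N : ℝ) - 2) * jap (kap N) (N / 2) x + -(((N : ℝ) - 2) / 2) * W N x := by
  funext x
  have hκ := kap_pos hN
  have hs := sq_mul_jap hκ (((N : ℝ) - 2) / 2) x
  have hs2 : jap (kap N) (((N : ℝ) - 2) / 2 + 1) x * ‖x‖ ^ 2 = kap N *
    (jap (kap N) (((N : ℝ) - 2) / 2) x - jap (kap N) (((N : ℝ) - 2) / 2 + 1) x) := by
    rw [← hs]; field_simp
  rw [scalingGenerator, W_eq, fderiv_jap hκ, real_inner_self_eq_norm_sq, mul_assoc _ (jap _ _ x),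
    hs2, show (N : ℝ) / 2 = ((N : ℝ) - 2) / 2 + 1 by ring]
  field_simp
  ring

/-- `W` has eigenvalue `1`: it solves `-ΔW = f(W)`. -/
theorem weakSol_W (hN : 3 ≤ N) : WeakSol (pot N) (W N) := by
  have hN' : (3 : ℝ) ≤ N := by exact_mod_cast hN
  have h2 : (N : ℝ) - 2 ≠ 0 := by linarith
  intro η hη
  rw [W_eq, jap_weak_laplacian (kap_pos hN) _ hη]
  refine integral_congr_ae (ae_of_all _ fun x => ?_)
  simp only
  rw [pot_mul_jap hN, kap]
  field_simp
  ring

/-- `ΛW` has eigenvalue `p`: it is in the kernel of `L`. -/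
theorem weakSol_LW (hN : 3 ≤ N) :
    WeakSol (fun x => pexp N * pot N x) (scalingGenerator (W N)) := by
  have hN' : (3 : ℝ) ≤ N := by exact_mod_cast hN
  have h2 : (N : ℝ) - 2 ≠ 0 := by linarith
  have h0 : (N : ℝ) ≠ 0 := by linarith
  have h := WeakSol.linear_comb3 hN (pexp N) ((N : ℝ) - 2)
    (-(((N : ℝ) - 2) / 2)) 0 (N / 2) (((N : ℝ) - 2) / 2) 0 fun x => by
      rw [kap, pexp,
        show ((N : ℝ) - 2) / 2 + 1 = N / 2 by ring, show ((N : ℝ) - 2) / 2 + 2 = N / 2 + 1 by ring]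
      field_simp
      ring
  rw [LW_eq hN, W_eq]
  simpa only [zero_mul, add_zero] using h

theorem deriv_nonlin_W (hN : 3 ≤ N) (x : Space N) :
    deriv (nonlin N) (W N x) = pexp N * pot N x := by
  have hN' : (3 : ℝ) ≤ N := by exact_mod_cast hN
  have h2 : (N : ℝ) - 2 ≠ 0 := by linarith
  have hκ := kap_pos hN
  have hW : 0 < W N x := by rw [W_eq]; exact jap_pos hκ _ x
  have hd : HasDerivAt (fun u : ℝ => u ^ (4 / ((N : ℝ) - 2)) * u)
      ((4 / ((N : ℝ) - 2)) * W N x ^ (4 / ((N : ℝ) - 2) - 1) * W N x +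
        W N x ^ (4 / ((N : ℝ) - 2)) * 1) (W N x) := by
    refine HasDerivAt.mul (Real.hasDerivAt_rpow_const (Or.inl hW.ne')) (hasDerivAt_id _)
  have he : nonlin N =ᶠ[𝓝 (W N x)] fun u : ℝ => u ^ (4 / ((N : ℝ) - 2)) * u := by
    filter_upwards [lt_mem_nhds hW] with u hu
    rw [nonlin, abs_of_pos hu]
  rw [he.deriv_eq, hd.deriv, mul_assoc, ← Real.rpow_add_one hW.ne', sub_add_cancel, mul_one,
    ← add_one_mul, W_eq, jap_rpow hκ]
  rw [show ((N : ℝ) - 2) / 2 * (4 / ((N : ℝ) - 2)) = 2 by field_simp; ring, pot, pexp]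
  congr 1
  field_simp
  ring

/-! ### Exponents and Hölder's inequality -/

/-- The dual exponent `2N/(N+2)` of `2*`. -/
def expD (N : ℕ) : ℝ := 2 * N / (N + 2)

section holder
variable [hN : Fact (3 ≤ N)]

theorem three_le_cast : (3 : ℝ) ≤ N := by exact_mod_cast hN.out

instance holderTriple_N_S_2 : ENNReal.HolderTriple (N : ℝ≥0∞) (ENNReal.ofReal (expS N)) 2 := by
  have h := three_le_cast (N := N)
  have h2 : (N : ℝ) - 2 ≠ 0 := by linarith
  have hS : 0 < expS N := by linarith [two_lt_expS hN.out]
  constructor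
  rw [← ENNReal.ofReal_natCast, ← ENNReal.ofReal_ofNat 2,
    ← ENNReal.ofReal_inv_of_pos (by linarith), ← ENNReal.ofReal_inv_of_pos hS,
    ← ENNReal.ofReal_inv_of_pos two_pos, ← ENNReal.ofReal_add (by positivity) (by positivity)]
  congr 1
  rw [expS]; field_simp; ring

instance holderTriple_D_S_1 :
    ENNReal.HolderTriple (ENNReal.ofReal (expD N)) (ENNReal.ofReal (expS N)) 1 := by
  have h := three_le_cast (N := N)
  have h2 : (N : ℝ) - 2 ≠ 0 := by linarith
  have hS : 0 < expS N := by linarith [two_lt_expS hN.out]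
  have hD : 0 < expD N := by rw [expD]; positivity
  constructor
  rw [← ENNReal.ofReal_one, ← ENNReal.ofReal_inv_of_pos hD, ← ENNReal.ofReal_inv_of_pos hS,
    ← ENNReal.ofReal_inv_of_pos one_pos, ← ENNReal.ofReal_add (by positivity) (by positivity)]
  congr 1
  rw [expS, expD]; field_simp; ring

instance holderTriple_H_S_D : ENNReal.HolderTriple (ENNReal.ofReal ((N : ℝ) / 2))
    (ENNReal.ofReal (expS N)) (ENNReal.ofReal (expD N)) := by
  have h := three_le_cast (N := N)
  have h2 : (N : ℝ) - 2 ≠ 0 := by linarith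
  have hS : 0 < expS N := by linarith [two_lt_expS hN.out]
  have hD : 0 < expD N := by rw [expD]; positivity
  constructor
  rw [← ENNReal.ofReal_inv_of_pos (by linarith), ← ENNReal.ofReal_inv_of_pos hS,
    ← ENNReal.ofReal_inv_of_pos hD, ← ENNReal.ofReal_add (by positivity) (by positivity)]
  congr 1
  rw [expS, expD]; field_simp; ring

theorem one_le_expS : 1 ≤ ENNReal.ofReal (expS N) := by
  rw [ENNReal.one_le_ofReal]; linarith [two_lt_expS hN.out]

theorem integrable_mul_of_memLp {b u : Space N → ℝ} (hb : MemLp b (ENNReal.ofReal (expD N)) volume)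
    (hu : MemLp u (ENNReal.ofReal (expS N)) volume) : Integrable (fun x => b x * u x) volume :=
  memLp_one_iff_integrable.1 (hu.mul (r := 1) hb)

theorem abs_integral_mul_le {b u : Space N → ℝ} (hb : MemLp b (ENNReal.ofReal (expD N)) volume)
    (hu : MemLp u (ENNReal.ofReal (expS N)) volume) :
    |∫ x, b x * u x| ≤ (eLpNorm b (ENNReal.ofReal (expD N)) volume).toReal *
      (eLpNorm u (ENNReal.ofReal (expS N)) volume).toReal := by
  have h := eLpNorm_smul_le_mul_eLpNorm (p := ENNReal.ofReal (expD N))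
    (q := ENNReal.ofReal (expS N)) (r := 1) hu.1 hb.1
  rw [← ENNReal.toReal_mul]
  refine le_trans ?_ (ENNReal.toReal_mono
    (ENNReal.mul_ne_top hb.eLpNorm_lt_top.ne hu.eLpNorm_lt_top.ne) h)
  rw [eLpNorm_one_eq_lintegral_enorm, ← Real.norm_eq_abs]
  refine (norm_integral_le_lintegral_norm _).trans (le_of_eq ?_)
  congr 1
  refine lintegral_congr fun x => ?_
  rw [ofReal_norm]; rfl

theorem MemLp.mul_H_S {a u : Space N → ℝ} (ha : MemLp a (ENNReal.ofReal ((N : ℝ) / 2)) volume)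
    (hu : MemLp u (ENNReal.ofReal (expS N)) volume) :
    MemLp (fun x => a x * u x) (ENNReal.ofReal (expD N)) volume :=
  hu.mul ha

theorem eLpNorm_mul_H_S_le {a u : Space N → ℝ}
    (ha : MemLp a (ENNReal.ofReal ((N : ℝ) / 2)) volume)
    (hu : MemLp u (ENNReal.ofReal (expS N)) volume) :
    (eLpNorm (fun x => a x * u x) (ENNReal.ofReal (expD N)) volume).toReal ≤
      (eLpNorm a (ENNReal.ofReal ((N : ℝ) / 2)) volume).toReal *
      (eLpNorm u (ENNReal.ofReal (expS N)) volume).toReal := by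
  have h := eLpNorm_smul_le_mul_eLpNorm (p := ENNReal.ofReal ((N : ℝ) / 2))
    (q := ENNReal.ofReal (expS N)) (r := ENNReal.ofReal (expD N)) hu.1 ha.1
  rw [← ENNReal.toReal_mul]
  exact ENNReal.toReal_mono (ENNReal.mul_ne_top ha.eLpNorm_lt_top.ne hu.eLpNorm_lt_top.ne) h

end holder

/-! ### The space `Ḣ¹` -/

/-- `Ḣ¹(ℝ^N)` as a space of functions. Its elements are functions, not almost everywhere classes;
the seminorm is `‖gradLp u‖`. -/
def HDot (N : ℕ) : Submodule ℝ (Space N → ℝ) where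
  carrier := {u | MemHDot1 u}
  add_mem' := MemHDot1.add
  zero_mem' := MemHDot1.zero
  smul_mem' c _ h := h.smul c

/-- The weak gradient as a linear map into `L²`. -/
def gradLp : HDot N →ₗ[ℝ] Lp (Space N) 2 (volume : Measure (Space N)) where
  toFun u := (u.2.memLp_weakGradient).toLp (weakGradient u.1)
  map_add' u v := by
    rw [← MemLp.toLp_add, MemLp.toLp_eq_toLp_iff]
    exact weakGradient_eq (u.2.hasWeakGradient.add v.2.hasWeakGradient)
  map_smul' c u := by
    rw [RingHom.id_apply, ← MemLp.toLp_const_smul, MemLp.toLp_eq_toLp_iff]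
    exact weakGradient_eq (u.2.hasWeakGradient.smul c)

theorem gradLp_ae (u : HDot N) : gradLp u =ᵐ[volume] weakGradient u.1 :=
  MemLp.coeFn_toLp u.2.memLp_weakGradient

theorem gradLp_ae_of_hasWeakGradient (u : HDot N) {G : Space N → Space N}
    (h : HasWeakGradient u.1 G) : gradLp u =ᵐ[volume] G :=
  (gradLp_ae u).trans (weakGradient_eq h)

theorem gradLp_ae_of_contDiff (u : HDot N) (h : ContDiff ℝ ∞ u.1) :
    gradLp u =ᵐ[volume] gradient u.1 :=
  gradLp_ae_of_hasWeakGradient u (hasWeakGradient_gradient h)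

/-- The Dirichlet form `∫ ∇u · ∇v` on `Ḣ¹`. -/
def dir : HDot N →ₗ[ℝ] HDot N →ₗ[ℝ] ℝ := (innerₗ _).compl₁₂ gradLp gradLp

theorem dir_apply (u v : HDot N) : dir u v = inner ℝ (gradLp u) (gradLp v) := rfl

theorem dir_self (u : HDot N) : dir u u = ‖gradLp u‖ ^ 2 :=
  real_inner_self_eq_norm_sq (gradLp u)

theorem dir_comm (u v : HDot N) : dir u v = dir v u :=
  real_inner_comm (gradLp v) (gradLp u)

theorem abs_dir_le (u v : HDot N) : |dir u v| ≤ ‖gradLp u‖ * ‖gradLp v‖ :=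
  abs_real_inner_le_norm (gradLp u) (gradLp v)

theorem dir_eq_integral_of {u v : HDot N} {G H : Space N → Space N} (hu : gradLp u =ᵐ[volume] G)
    (hv : gradLp v =ᵐ[volume] H) : dir u v = ∫ x, inner ℝ (G x) (H x) := by
  rw [dir_apply, L2.inner_def]
  refine integral_congr_ae ?_
  filter_upwards [hu, hv] with x h1 h2
  rw [h1, h2]

theorem dir_self_eq_integral_of {u : HDot N} {G : Space N → Space N}
    (hu : gradLp u =ᵐ[volume] G) : dir u u = ∫ x, ‖G x‖ ^ 2 := by
  rw [dir_eq_integral_of hu hu]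
  simp only [real_inner_self_eq_norm_sq]

/-- A test function as an element of `Ḣ¹`. -/
def IsTest.toHDot {φ : Space N → ℝ} (h : IsTest φ) : HDot N := ⟨φ, h.memHDot1⟩

theorem norm_gradLp_sub_toHDot {φ : Space N → ℝ} (h : IsTest φ) (u : HDot N)
    {G : Space N → Space N} (hG : HasWeakGradient u.1 G) :
    ‖gradLp (h.toHDot - u)‖ = (eLpNorm (gradient φ - G) 2 volume).toReal := by
  rw [Lp.norm_def]
  congr 1
  refine eLpNorm_congr_ae ?_
  rw [map_sub]
  refine (Lp.coeFn_sub _ _).trans ?_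
  exact (gradLp_ae_of_contDiff _ h.1).sub (gradLp_ae_of_hasWeakGradient u hG)

section sobolev
variable [hN : Fact (3 ≤ N)]

/-- The `L^{2*}` norm. -/
def nS (u : Space N → ℝ) : ℝ := (eLpNorm u (ENNReal.ofReal (expS N)) volume).toReal

omit hN in
theorem nS_nonneg (u : Space N → ℝ) : 0 ≤ nS u := ENNReal.toReal_nonneg

theorem nS_add_le {u v : Space N → ℝ} (hu : MemLp u (ENNReal.ofReal (expS N)) volume)
    (hv : MemLp v (ENNReal.ofReal (expS N)) volume) : nS (u + v) ≤ nS u + nS v := by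
  rw [nS, nS, nS, ← ENNReal.toReal_add hu.eLpNorm_lt_top.ne hv.eLpNorm_lt_top.ne]
  exact ENNReal.toReal_mono (ENNReal.add_ne_top.2 ⟨hu.eLpNorm_lt_top.ne, hv.eLpNorm_lt_top.ne⟩)
    (eLpNorm_add_le hu.1 hv.1 one_le_expS)

omit hN in
theorem hdot_memLp (u : HDot N) : MemLp u.1 (ENNReal.ofReal (expS N)) volume := u.2.1

/-- Test functions are dense in `Ḣ¹`, and radial functions are limits of radial test functions. -/
theorem exists_test_near (u : HDot N) {ε : ℝ} (hε : 0 < ε) :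
    ∃ (φ : Space N → ℝ) (h : IsTest φ), ‖gradLp (h.toHDot - u)‖ ≤ ε ∧ nS (φ - u.1) ≤ ε ∧
      ∀ T : Space N ≃ₗᵢ[ℝ] Space N, u.1 ∘ T =ᵐ[volume] u.1 → ∀ x, φ (T x) = φ x := by
  obtain ⟨φ, h, h1, h2, h3⟩ := exists_test_approx (t := (N : ℝ≥0∞)) (s := ENNReal.ofReal (expS N))
    one_le_expS ENNReal.ofReal_ne_top (eLpNorm_gradient_plateau_le (by have := hN.out; omega))
    u.2.hasWeakGradient (hdot_memLp u) u.2.memLp_weakGradient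
    (ε := ENNReal.ofReal ε) (by simpa using hε)
  refine ⟨φ, h, ?_, ?_, h3⟩
  · rw [norm_gradLp_sub_toHDot h u u.2.hasWeakGradient]
    exact ENNReal.toReal_le_of_le_ofReal hε.le h2
  · exact ENNReal.toReal_le_of_le_ofReal hε.le h1

/-- The Gagliardo–Nirenberg–Sobolev inequality for test functions. -/
theorem exists_sobolev_test : ∃ S : ℝ, 0 < S ∧ ∀ φ : Space N → ℝ, IsTest φ →
    eLpNorm φ (ENNReal.ofReal (expS N)) volume ≤
      ENNReal.ofReal S * eLpNorm (gradient φ) 2 volume := by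
  have h := three_le_cast (N := N)
  have h2 : (N : ℝ) - 2 ≠ 0 := by linarith
  have hS : 0 < expS N := by linarith [two_lt_expS hN.out]
  set C := SNormLESNormFDerivOfEqConst ℝ (volume : Measure (Space N)) 2
  refine ⟨C + 1, by positivity, fun φ hφ => ?_⟩
  have key := eLpNorm_le_eLpNorm_fderiv_of_eq (volume : Measure (Space N)) (u := φ) (F := ℝ)
    (hφ.1.of_le (by simp)) hφ.2 (p := 2) (p' := (expS N).toNNReal) one_le_two
    (by rw [finrank_euclideanSpace, Fintype.card_fin]; have := hN.out; omega) (by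
      rw [Real.coe_toNNReal _ hS.le, expS, finrank_euclideanSpace, Fintype.card_fin]
      push_cast
      field_simp)
  have e : eLpNorm (fderiv ℝ φ) ((2 : ℝ≥0) : ℝ≥0∞) volume = eLpNorm (gradient φ) 2 volume := by
    refine eLpNorm_congr_norm_ae (ae_of_all _ fun x => ?_)
    rw [norm_gradient_eq]
  rw [e] at key
  refine (show eLpNorm φ (ENNReal.ofReal (expS N)) volume = _ from rfl).trans_le (key.trans ?_)
  gcongr
  change (C : ℝ≥0∞) ≤ _
  rw [← ENNReal.ofReal_coe_nnreal]
  exact ENNReal.ofReal_le_ofReal (by linarith)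

/-- **Sobolev inequality** on `Ḣ¹`. -/
theorem exists_sobolev : ∃ S : ℝ, 0 < S ∧ ∀ u : HDot N, nS u.1 ≤ S * ‖gradLp u‖ := by
  obtain ⟨S, hS, h⟩ := exists_sobolev_test (N := N)
  refine ⟨S, hS, fun u => ?_⟩
  refine le_of_forall_pos_le_add fun ε hε => ?_
  obtain ⟨φ, hφ, h1, h2, -⟩ := exists_test_near u (ε := ε / (S + 1)) (by positivity)
  have h3 : nS φ ≤ S * ‖gradLp hφ.toHDot‖ := by
    have := h φ hφ
    have e : ‖gradLp hφ.toHDot‖ = (eLpNorm (gradient φ) 2 volume).toReal := by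
      rw [Lp.norm_def, eLpNorm_congr_ae (gradLp_ae_of_contDiff hφ.toHDot hφ.1)]; rfl
    rw [e, nS, ← ENNReal.toReal_ofReal hS.le, ← ENNReal.toReal_mul]
    exact ENNReal.toReal_mono (ENNReal.mul_ne_top ENNReal.ofReal_ne_top
      (hφ.memLp_gradient 2).eLpNorm_lt_top.ne) this
  have h4 : nS u.1 ≤ nS φ + nS (φ - u.1) := by
    have e : u.1 = φ + -(φ - u.1) := by abel
    have hm := (hφ.memLp (ENNReal.ofReal (expS N))).sub (hdot_memLp u)
    calc nS u.1 = nS (φ + -(φ - u.1)) := by rw [← e]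
      _ ≤ nS φ + nS (-(φ - u.1)) := nS_add_le (hφ.memLp _) hm.neg
      _ = _ := by rw [nS, nS, nS, eLpNorm_neg]
  have h5 : ‖gradLp hφ.toHDot‖ ≤ ‖gradLp u‖ + ε / (S + 1) := by
    have : gradLp hφ.toHDot = gradLp u + gradLp (hφ.toHDot - u) := by rw [map_sub]; abel
    rw [this]
    exact (norm_add_le _ _).trans (by gcongr)
  have h6 : S * (ε / (S + 1)) + ε / (S + 1) = ε := by field_simp
  have h7 := mul_le_mul_of_nonneg_left h5 hS.le
  rw [mul_add] at h7
  linarith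

/-- A Sobolev constant. -/
def sob (N : ℕ) [Fact (3 ≤ N)] : ℝ := (exists_sobolev (N := N)).choose

theorem sob_pos : 0 < sob N := (exists_sobolev (N := N)).choose_spec.1

theorem sobolev (u : HDot N) : nS u.1 ≤ sob N * ‖gradLp u‖ :=
  (exists_sobolev (N := N)).choose_spec.2 u

/-! ### Continuous forms on `Ḣ¹` -/

/-- The functional `u ↦ ∫ b u` for `b` in the dual Lebesgue space. -/
def lform (b : Space N → ℝ) (hb : MemLp b (ENNReal.ofReal (expD N)) volume) :
    HDot N →ₗ[ℝ] ℝ where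
  toFun u := ∫ x, b x * u.1 x
  map_add' u v := by
    rw [← integral_add (integrable_mul_of_memLp hb (hdot_memLp u))
      (integrable_mul_of_memLp hb (hdot_memLp v))]
    refine integral_congr_ae (ae_of_all _ fun x => ?_)
    simp [mul_add]
  map_smul' c u := by
    rw [RingHom.id_apply, smul_eq_mul, ← integral_const_mul]
    refine integral_congr_ae (ae_of_all _ fun x => ?_)
    simp only [SetLike.val_smul, Pi.smul_apply, smul_eq_mul]
    ring

theorem lform_apply (b : Space N → ℝ) (hb) (u : HDot N) : lform b hb u = ∫ x, b x * u.1 x := rfl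

theorem abs_lform_le (b : Space N → ℝ) (hb) (u : HDot N) : |lform b hb u| ≤
    (eLpNorm b (ENNReal.ofReal (expD N)) volume).toReal * sob N * ‖gradLp u‖ := by
  refine (abs_integral_mul_le hb (hdot_memLp u)).trans ?_
  rw [mul_assoc]
  exact mul_le_mul_of_nonneg_left (sobolev u) ENNReal.toReal_nonneg

/-- The form `(u, v) ↦ ∫ a u v` for a weight `a ∈ L^{N/2}`. -/
def wform (a : Space N → ℝ) (ha : MemLp a (ENNReal.ofReal ((N : ℝ) / 2)) volume) :
    HDot N →ₗ[ℝ] HDot N →ₗ[ℝ] ℝ :=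
  LinearMap.mk₂ ℝ (fun u v => ∫ x, a x * u.1 x * v.1 x)
    (fun u u' v => by
      have h1 := integrable_mul_of_memLp (MemLp.mul_H_S ha (hdot_memLp u)) (hdot_memLp v)
      have h2 := integrable_mul_of_memLp (MemLp.mul_H_S ha (hdot_memLp u')) (hdot_memLp v)
      rw [← integral_add h1 h2]
      refine integral_congr_ae (ae_of_all _ fun x => ?_)
      simp only [Submodule.coe_add, Pi.add_apply]
      ring)
    (fun c u v => by
      rw [smul_eq_mul, ← integral_const_mul]
      refine integral_congr_ae (ae_of_all _ fun x => ?_)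
      simp only [SetLike.val_smul, Pi.smul_apply, smul_eq_mul]
      ring)
    (fun u v v' => (lform _ (MemLp.mul_H_S ha (hdot_memLp u))).map_add v v')
    (fun c u v => (lform _ (MemLp.mul_H_S ha (hdot_memLp u))).map_smul c v)

theorem wform_apply (a : Space N → ℝ) (ha) (u v : HDot N) :
    wform a ha u v = ∫ x, a x * u.1 x * v.1 x := rfl

theorem wform_comm (a : Space N → ℝ) (ha) (u v : HDot N) : wform a ha u v = wform a ha v u := by
  rw [wform_apply, wform_apply]
  refine integral_congr_ae (ae_of_all _ fun x => ?_)
  simp only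
  ring

theorem abs_wform_le (a : Space N → ℝ) (ha) (u v : HDot N) : |wform a ha u v| ≤
    (eLpNorm a (ENNReal.ofReal ((N : ℝ) / 2)) volume).toReal * sob N ^ 2 *
      (‖gradLp u‖ * ‖gradLp v‖) := by
  refine (abs_integral_mul_le (MemLp.mul_H_S ha (hdot_memLp u)) (hdot_memLp v)).trans ?_
  have h1 := eLpNorm_mul_H_S_le ha (hdot_memLp u)
  have h2 : nS u.1 ≤ _ := sobolev u
  have h3 : nS v.1 ≤ _ := sobolev v
  rw [nS] at h2 h3
  set A := (eLpNorm a (ENNReal.ofReal ((N : ℝ) / 2)) volume).toReal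
  have hA : 0 ≤ A := ENNReal.toReal_nonneg
  have hs := (sob_pos (N := N)).le
  calc _ ≤ (A * (sob N * ‖gradLp u‖)) * (sob N * ‖gradLp v‖) := by
        refine mul_le_mul (h1.trans ?_) h3 ENNReal.toReal_nonneg (by positivity)
        gcongr
    _ = _ := by ring

/-! ### Extension from test functions -/

/-- A continuous functional vanishing on test functions vanishes. -/
theorem eq_zero_of_test {l : HDot N → ℝ} {C : ℝ}
    (hsub : ∀ u v, l (u - v) = l u - l v) (hl : ∀ u, |l u| ≤ C * ‖gradLp u‖)
    (h : ∀ (φ : Space N → ℝ) (hφ : IsTest φ), l hφ.toHDot = 0) (u : HDot N) : l u = 0 := by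
  have hC : ∀ ε > 0, |l u| ≤ |C| * ε := fun ε hε => by
    obtain ⟨φ, hφ, h1, -, -⟩ := exists_test_near u hε
    have h2 := hl (hφ.toHDot - u)
    rw [hsub, h, zero_sub, abs_neg] at h2
    refine h2.trans ?_
    calc C * ‖gradLp (hφ.toHDot - u)‖ ≤ |C| * ‖gradLp (hφ.toHDot - u)‖ := by
          gcongr; exact le_abs_self C
      _ ≤ _ := by gcongr
  by_contra hne
  have hpos : 0 < |l u| := abs_pos.2 hne
  have := hC (|l u| / (2 * (|C| + 1))) (by positivity)
  rw [mul_div_assoc', le_div_iff₀ (by positivity)] at this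
  nlinarith [abs_nonneg C]

/-- Invariance of a function (up to null sets) under all hyperplane reflections. -/
def Inv (u : Space N → ℝ) : Prop :=
  ∀ e : Space N, u ∘ (ℝ ∙ e)ᗮ.reflection =ᵐ[volume] u

omit hN in
/-- A function invariant under all hyperplane reflections depends only on the norm. -/
theorem norm_invariant_of_reflections {φ : Space N → ℝ}
    (h : ∀ e x : Space N, φ ((ℝ ∙ e)ᗮ.reflection x) = φ x) {x y : Space N} (hxy : ‖x‖ = ‖y‖) :
    φ x = φ y := by
  rw [← h (x - y) x, Submodule.reflection_sub hxy]

/-- A quadratic inequality between continuous forms extends from radial test functions to all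
radial functions of `Ḣ¹`. -/
theorem nonneg_of_radial_test {B : HDot N →ₗ[ℝ] HDot N →ₗ[ℝ] ℝ} {C : ℝ}
    (hB : ∀ u v, |B u v| ≤ C * (‖gradLp u‖ * ‖gradLp v‖))
    (h : ∀ (φ : Space N → ℝ) (hφ : IsTest φ), (∀ x y, ‖x‖ = ‖y‖ → φ x = φ y) →
      0 ≤ B hφ.toHDot hφ.toHDot)
    (u : HDot N) (hu : Inv u.1) : 0 ≤ B u u := by
  refine le_of_forall_pos_le_add fun ε hε => ?_
  set M := |C| * (2 * ‖gradLp u‖ + 1) with hM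
  have hM0 : 0 ≤ M := by positivity
  obtain ⟨φ, hφ, h1, -, h3⟩ := exists_test_near u (ε := min 1 (ε / (M + 1)))
    (lt_min one_pos (by positivity))
  have hr := h φ hφ fun x y hxy =>
    norm_invariant_of_reflections (fun e x => h3 _ (hu e) x) hxy
  set d := hφ.toHDot - u with hd
  have e : hφ.toHDot = u + d := by rw [hd]; abel
  rw [e] at hr
  simp only [map_add, LinearMap.add_apply] at hr
  have h1' : ‖gradLp d‖ ≤ 1 := h1.trans (min_le_left _ _)
  have h1'' : ‖gradLp d‖ ≤ ε / (M + 1) := h1.trans (min_le_right _ _)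
  have b1 : ∀ a b : HDot N, B a b ≤ |C| * (‖gradLp a‖ * ‖gradLp b‖) := fun a b =>
    (le_abs_self _).trans ((hB a b).trans (by gcongr; exact le_abs_self C))
  have b2 := b1 u d
  have b3 := b1 d u
  have b4 := b1 d d
  have hsum : |C| * (‖gradLp u‖ * ‖gradLp d‖) + |C| * (‖gradLp d‖ * ‖gradLp u‖) +
      |C| * (‖gradLp d‖ * ‖gradLp d‖) ≤ M * ‖gradLp d‖ := by
    rw [hM]
    have : |C| * (‖gradLp d‖ * ‖gradLp d‖) ≤ |C| * (1 * ‖gradLp d‖) := by gcongr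
    nlinarith
  have hfin : M * ‖gradLp d‖ ≤ ε := by
    calc M * ‖gradLp d‖ ≤ M * (ε / (M + 1)) := by gcongr
      _ ≤ ε := by
        rw [mul_div_assoc', div_le_iff₀ (by positivity)]
        nlinarith
  linarith

end sobolev

/-! ### The spectral gap on radial functions -/

section gap
variable [hN : Fact (3 ≤ N)]

theorem pot_memLp : MemLp (pot N) (ENNReal.ofReal ((N : ℝ) / 2)) volume := by
  have h := three_le_cast (N := N)
  exact jap_memLp (kap_pos hN.out) (by linarith) (by linarith)

/-- The form `∫ W^{4/(N-2)} u v`. -/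
def mform : HDot N →ₗ[ℝ] HDot N →ₗ[ℝ] ℝ := wform (pot N) pot_memLp

theorem mform_apply (u v : HDot N) : mform u v = ∫ x, pot N x * u.1 x * v.1 x := rfl

theorem mform_comm (u v : HDot N) : mform u v = mform v u := wform_comm _ _ u v

theorem exists_abs_mform_le : ∃ C : ℝ, 0 ≤ C ∧ ∀ u v : HDot N,
    |mform u v| ≤ C * (‖gradLp u‖ * ‖gradLp v‖) :=
  ⟨_, mul_nonneg ENNReal.toReal_nonneg (sq_nonneg _), abs_wform_le (pot N) pot_memLp⟩

/-- The ground state as an element of `Ḣ¹`. -/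
def wH (N : ℕ) [hN : Fact (3 ≤ N)] : HDot N :=
  ⟨W N, by rw [W_eq]; exact jap_memHDot1 hN.out (kap_pos hN.out) le_rfl⟩

theorem LW_memHDot1 : MemHDot1 (scalingGenerator (W N)) := by
  have h := three_le_cast (N := N)
  have := ((jap_memHDot1 (N := N) hN.out (kap_pos hN.out) (b := N / 2) (by linarith)).smul
    ((N : ℝ) - 2)).add ((wH N).2.smul (-(((N : ℝ) - 2) / 2)))
  rwa [LW_eq hN.out]

/-- The generator of dilations `ΛW` as an element of `Ḣ¹`. -/
def lH (N : ℕ) [hN : Fact (3 ≤ N)] : HDot N := ⟨scalingGenerator (W N), LW_memHDot1⟩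

theorem W_contDiff : ContDiff ℝ ∞ (W N) := by
  rw [W_eq]; exact jap_contDiff (kap_pos hN.out) _

theorem LW_contDiff : ContDiff ℝ ∞ (scalingGenerator (W N)) := by
  rw [LW_eq hN.out]
  exact (contDiff_const.mul (jap_contDiff (kap_pos hN.out) _)).add (contDiff_const.mul W_contDiff)

/-- A smooth eigenfunction in `Ḣ¹` may be tested against all of `Ḣ¹`. -/
theorem WeakSol.dir_eq {c : ℝ} {u : HDot N} (hs : ContDiff ℝ ∞ u.1)
    (h : WeakSol (fun x => c * pot N x) u.1) (v : HDot N) : dir u v = c * mform u v := by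
  obtain ⟨C, -, hC⟩ := exists_abs_mform_le (N := N)
  rw [← sub_eq_zero]
  refine eq_zero_of_test (l := fun v => dir u v - c * mform u v)
    (C := ‖gradLp u‖ + |c| * (C * ‖gradLp u‖)) (fun v v' => ?_) (fun v => ?_) (fun φ hφ => ?_) v
  · simp only [map_sub]; ring
  · have h1 := abs_dir_le u v
    have h2 := mul_le_mul_of_nonneg_left (hC u v) (abs_nonneg c)
    refine (abs_sub _ _).trans ?_
    rw [abs_mul]
    linarith
  · rw [dir_eq_integral_of (gradLp_ae_of_contDiff u hs) (gradLp_ae_of_contDiff _ hφ.1), sub_eq_zero,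
      mform_apply, ← integral_const_mul]
    refine (h φ hφ).trans (integral_congr_ae (ae_of_all _ fun x => ?_))
    simp only [IsTest.toHDot]
    ring

theorem dir_wH (v : HDot N) : dir (wH N) v = mform (wH N) v := by
  have h : WeakSol (fun x => 1 * pot N x) (W N) := by
    simp_rw [one_mul]; exact weakSol_W hN.out
  rw [WeakSol.dir_eq (u := wH N) W_contDiff h v, one_mul]

theorem dir_lH (v : HDot N) : dir (lH N) v = pexp N * mform (lH N) v :=
  WeakSol.dir_eq (u := lH N) LW_contDiff (weakSol_LW hN.out) v

/-- Eigenfunctions for the distinct eigenvalues `1` and `p` are orthogonal. -/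
theorem mform_wH_lH : mform (wH N) (lH N) = 0 := by
  have h1 := dir_wH (lH N)
  have h2 := dir_lH (wH N)
  rw [dir_comm, h1, mform_comm (lH N)] at h2
  have := one_lt_pexp hN.out
  by_contra hne
  have : pexp N = 1 := mul_right_cancel₀ hne (by rw [← h2, one_mul])
  linarith

theorem pot_pos (x : Space N) : 0 < pot N x := jap_pos (kap_pos hN.out) _ x

theorem mform_self_pos {u : HDot N} (hu : Continuous u.1) {x : Space N} (hx : u.1 x ≠ 0) :
    0 < mform u u := by
  rw [mform_apply]
  have hc : Continuous fun x => pot N x * u.1 x * u.1 x :=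
    ((jap_contDiff (kap_pos hN.out) _).continuous.mul hu).mul hu
  refine integral_pos_of_integrable_nonneg_nonzero (x := x) hc
    (integrable_mul_of_memLp (MemLp.mul_H_S pot_memLp (hdot_memLp u)) (hdot_memLp u))
    (fun x => ?_) ?_
  · have := pot_pos x
    have h2 := mul_self_nonneg (u.1 x)
    simp only [Pi.zero_apply]
    rw [mul_assoc]
    positivity
  · have := pot_pos x
    positivity

theorem mform_wH_pos : 0 < mform (wH N) (wH N) :=
  mform_self_pos W_contDiff.continuous (x := 0) (jap_pos (kap_pos hN.out) _ _).ne'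

theorem mform_lH_pos : 0 < mform (lH N) (lH N) := by
  have h := three_le_cast (N := N)
  refine mform_self_pos LW_contDiff.continuous (x := 0) ?_
  change scalingGenerator (W N) 0 ≠ 0
  rw [LW_eq hN.out, W_eq]
  simp only [jap, norm_zero]
  norm_num
  intro h0
  linarith

omit hN in
theorem tendsto_form {B : HDot N →ₗ[ℝ] HDot N →ₗ[ℝ] ℝ} {C : ℝ}
    (hB : ∀ u v, |B u v| ≤ C * (‖gradLp u‖ * ‖gradLp v‖)) {ι : Type*} {l : Filter ι}
    {v : ι → HDot N} {u : HDot N} (h : Tendsto (fun i => ‖gradLp (v i - u)‖) l (𝓝 0)) :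
    Tendsto (fun i => B (v i) (v i)) l (𝓝 (B u u)) := by
  have e : ∀ i, B (v i) (v i) = B u u + (B u (v i - u) + B (v i - u) u +
      B (v i - u) (v i - u)) := fun i => by
    simp only [map_sub, LinearMap.sub_apply]; ring
  simp_rw [e]
  have z : ∀ {f : ι → ℝ} {g : ι → ℝ}, (∀ i, |f i| ≤ g i) → Tendsto g l (𝓝 0) →
      Tendsto f l (𝓝 0) := fun h1 h2 => squeeze_zero_norm h1 h2
  have t1 : Tendsto (fun i => B u (v i - u)) l (𝓝 0) := z (fun i => hB _ _) (by
    simpa using (h.const_mul ‖gradLp u‖).const_mul C)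
  have t2 : Tendsto (fun i => B (v i - u) u) l (𝓝 0) := z (fun i => hB _ _) (by
    simpa using (h.mul_const ‖gradLp u‖).const_mul C)
  have t3 : Tendsto (fun i => B (v i - u) (v i - u)) l (𝓝 0) := z (fun i => hB _ _) (by
    simpa using (h.mul h).const_mul C)
  simpa using ((t1.add t2).add t3).const_add (B u u)

/-- Smooth functions in `Ḣ¹` are limits of their truncations. -/
theorem tendsto_gradLp_truncation {u : HDot N} (hs : ContDiff ℝ ∞ u.1) :
    ∃ v : ℝ → HDot N, (∀ R, (v R).1 = fun x => plateau R x * u.1 x) ∧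
      Tendsto (fun R => ‖gradLp (v R - u)‖) atTop (𝓝 0) := by
  have hm : ∀ R : ℝ, MemHDot1 (fun x => plateau R x * u.1 x) := fun R => by
    by_cases hR : 0 < R
    · have : IsTest fun x => u.1 x * plateau R x := (plateau_isTest hR).mul_left hs
      simp_rw [mul_comm (plateau R _)]
      exact this.memHDot1
    · by_cases h0 : R = 0
      · have e : (fun x => plateau R x * u.1 x) = u.1 := by
          funext x
          rw [plateau, h0]
          simp [Real.smoothTransition.one_of_one_le]
        rw [e]; exact u.2
      · have : IsTest fun x => u.1 x * plateau (-R) x :=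
          (plateau_isTest (by
            rcases lt_or_gt_of_ne h0 with h | h
            · linarith
            · exact absurd h hR)).mul_left hs
        simp_rw [mul_comm (plateau R _)]
        refine (funext fun x => ?_ : (fun x => u.1 x * plateau R x) = _) ▸ this.memHDot1
        simp [plateau]
  refine ⟨fun R => ⟨_, hm R⟩, fun R => rfl, ?_⟩
  have hg : MemLp (gradient u.1) 2 volume :=
    u.2.memLp_weakGradient.ae_eq (weakGradient_eq (hasWeakGradient_gradient hs))
  have h := (tendsto_truncation (t := (N : ℝ≥0∞)) (s := ENNReal.ofReal (expS N)) one_le_expS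
    ENNReal.ofReal_ne_top (eLpNorm_gradient_plateau_le (by have := hN.out; omega)) hs (hdot_memLp u)
    hg).2
  have h2 := (ENNReal.tendsto_toReal ENNReal.zero_ne_top).comp h
  rw [ENNReal.toReal_zero] at h2
  refine h2.congr fun R => ?_
  have hsm : ContDiff ℝ ∞ (fun x => plateau R x * u.1 x) := (plateau_contDiff R).mul hs
  rw [Function.comp_apply, Lp.norm_def]
  congr 1
  refine eLpNorm_congr_ae ?_
  rw [map_sub]
  refine Filter.EventuallyEq.symm ((Lp.coeFn_sub _ _).trans ?_)
  exact (gradLp_ae_of_contDiff ⟨_, hm R⟩ hsm).sub (gradLp_ae_of_contDiff u hs)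

/-- A radial test function agrees on two spheres with a combination of `W` and `ΛW`. -/
theorem exists_comb_eq_on_spheres {φ : Space N → ℝ} (hφ : ∀ x y, ‖x‖ = ‖y‖ → φ x = φ y) {r₁ r₂ : ℝ}
    (h1 : 0 < r₁) (h12 : r₁ < r₂) : ∃ α β : ℝ, ∀ x, ‖x‖ = r₁ ∨ ‖x‖ = r₂ →
      φ x = α * W N x + β * scalingGenerator (W N) x := by
  have h := three_le_cast (N := N)
  have hκ := kap_pos hN.out
  have h2 : 0 < r₂ := h1.trans h12
  set κ := kap N
  obtain ⟨e, he⟩ : ∃ e : Space N, ‖e‖ = 1 := by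
    refine ⟨EuclideanSpace.single ⟨0, by have := hN.out; omega⟩ 1, by simp⟩
  -- radial profiles of `W` and of `ΛW / W`; as the latter is strictly decreasing, the
  -- linear system for the coefficients is invertible
  let w : ℝ → ℝ := fun r => (1 + r ^ 2 / κ) ^ (-(((N : ℝ) - 2) / 2))
  let s : ℝ → ℝ := fun r => ((N : ℝ) - 2) / (1 + r ^ 2 / κ) - ((N : ℝ) - 2) / 2
  have hw : ∀ r, 0 < w r := fun r => Real.rpow_pos_of_pos (by positivity) _
  have hL : ∀ x : Space N, scalingGenerator (W N) x = s ‖x‖ * W N x := fun x => by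
    have hb := base_mul_jap hκ (((N : ℝ) - 2) / 2) x
    have hp := jap_base_pos hκ x
    rw [LW_eq hN.out]
    simp only [s, W_eq]
    rw [show (N : ℝ) / 2 = ((N : ℝ) - 2) / 2 + 1 by ring, ← hb]
    change ((N : ℝ) - 2) * jap κ (((N : ℝ) - 2) / 2 + 1) x + _ = _
    set J := jap κ (((N : ℝ) - 2) / 2 + 1) x
    field_simp
    ring
  have hs : s r₁ - s r₂ ≠ 0 := by
    have : s r₂ < s r₁ := by
      simp only [s]
      gcongr
      linarith
    linarith
  set v₁ := φ (r₁ • e) / w r₁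
  set v₂ := φ (r₂ • e) / w r₂
  refine ⟨v₁ - (v₁ - v₂) / (s r₁ - s r₂) * s r₁, (v₁ - v₂) / (s r₁ - s r₂), fun x hx => ?_⟩
  have hW : W N x = w ‖x‖ := rfl
  rw [hL, hW]
  rcases hx with hx | hx
  · have e1 : φ x = v₁ * w r₁ := by
      rw [div_mul_cancel₀ _ (hw _).ne']
      exact hφ _ _ (by rw [norm_smul, he, hx, Real.norm_eq_abs, abs_of_pos h1, mul_one])
    rw [e1, hx]; ring
  · have e1 : φ x = v₂ * w r₂ := by
      rw [div_mul_cancel₀ _ (hw _).ne']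
      exact hφ _ _ (by rw [norm_smul, he, hx, Real.norm_eq_abs, abs_of_pos h2, mul_one])
    rw [e1, hx]
    field_simp
    ring

/-- A smooth function vanishing on two suitable spheres satisfies the Poincaré inequality with the
third radial eigenvalue. -/
theorem exists_gap_smooth : ∃ r₁ r₂ : ℝ, 0 < r₁ ∧ r₁ < r₂ ∧
    ∀ h : HDot N, ContDiff ℝ ∞ h.1 → (∀ x, ‖x‖ = r₁ ∨ ‖x‖ = r₂ → h.1 x = 0) →
      mu2 N * mform h h ≤ dir h h := by
  obtain ⟨r₁, r₂, h1, h12, H⟩ := exists_gap_radii (N := N) hN.out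
  refine ⟨r₁, r₂, h1, h12, fun h hs h0 => ?_⟩
  obtain ⟨v, hv, ht⟩ := tendsto_gradLp_truncation hs
  obtain ⟨C, -, hC⟩ := exists_abs_mform_le (N := N)
  refine le_of_tendsto_of_tendsto ((tendsto_form hC ht).const_mul _)
    (tendsto_form (C := 1) (fun u v => by simpa using abs_dir_le u v) ht) ?_
  filter_upwards [eventually_gt_atTop 0] with R hR
  have htest : IsTest (v R).1 := by
    have : IsTest fun x => h.1 x * plateau R x := (plateau_isTest hR).mul_left hs
    rw [hv]
    simpa only [mul_comm] using this
  have := H _ htest (fun x hx => by rw [hv]; simp only [h0 x (Or.inl hx), mul_zero])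
    (fun x hx => by rw [hv]; simp only [h0 x (Or.inr hx), mul_zero])
  rw [dir_self_eq_integral_of (gradLp_ae_of_contDiff _ htest.1), mform_apply, ← integral_const_mul]
  refine le_trans (le_of_eq (integral_congr_ae (ae_of_all _ fun x => ?_))) this
  simp only
  ring

/-- The form `∫ ∇u·∇v - μ₂ ∫ W^{4/(N-2)} u v`, corrected along `W` and `ΛW` so that these two
directions are in its kernel. -/
def gapForm : HDot N →ₗ[ℝ] HDot N →ₗ[ℝ] ℝ :=
  dir - mu2 N • mform +
    ((mu2 N - 1) / mform (wH N) (wH N)) •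
      (LinearMap.mul ℝ ℝ).compl₁₂ (mform (wH N)) (mform (wH N)) +
    ((mu2 N - pexp N) / mform (lH N) (lH N)) •
      (LinearMap.mul ℝ ℝ).compl₁₂ (mform (lH N)) (mform (lH N))

theorem gapForm_apply (u v : HDot N) : gapForm u v = dir u v - mu2 N * mform u v +
    (mu2 N - 1) / mform (wH N) (wH N) * (mform (wH N) u * mform (wH N) v) +
    (mu2 N - pexp N) / mform (lH N) (lH N) * (mform (lH N) u * mform (lH N) v) := rfl

theorem exists_abs_gapForm_le : ∃ C : ℝ, ∀ u v : HDot N,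
    |gapForm u v| ≤ C * (‖gradLp u‖ * ‖gradLp v‖) := by
  obtain ⟨C, hC0, hC⟩ := exists_abs_mform_le (N := N)
  have hl : ∀ (k : ℝ) (a u v : HDot N), |k * (mform a u * mform a v)| ≤
      |k| * (C * ‖gradLp a‖) ^ 2 * (‖gradLp u‖ * ‖gradLp v‖) := fun k a u v => by
    rw [abs_mul, abs_mul, mul_assoc]
    refine mul_le_mul_of_nonneg_left ?_ (abs_nonneg k)
    calc _ ≤ (C * (‖gradLp a‖ * ‖gradLp u‖)) * (C * (‖gradLp a‖ * ‖gradLp v‖)) :=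
          mul_le_mul (hC a u) (hC a v) (abs_nonneg _) (by positivity)
      _ = _ := by ring
  set k1 := (mu2 N - 1) / mform (wH N) (wH N)
  set k2 := (mu2 N - pexp N) / mform (lH N) (lH N)
  refine ⟨1 + |mu2 N| * C + |k1| * (C * ‖gradLp (wH N)‖) ^ 2 + |k2| * (C * ‖gradLp (lH N)‖) ^ 2,
    fun u v => ?_⟩
  rw [gapForm_apply]
  have h1 := abs_dir_le u v
  have h2 : |mu2 N * mform u v| ≤ |mu2 N| * (C * (‖gradLp u‖ * ‖gradLp v‖)) := by
    rw [abs_mul]; exact mul_le_mul_of_nonneg_left (hC u v) (abs_nonneg _)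
  refine (abs_add_le _ _).trans ((add_le_add ((abs_add_le _ _).trans
    (add_le_add ((abs_sub _ _).trans (add_le_add h1 h2)) (hl k1 _ u v))) (hl k2 _ u v)).trans
    (le_of_eq ?_))
  ring

theorem gapForm_comm (u v : HDot N) : gapForm u v = gapForm v u := by
  rw [gapForm_apply, gapForm_apply, dir_comm, mform_comm u v]; ring

theorem gapForm_wH (v : HDot N) : gapForm (wH N) v = 0 := by
  have := mform_wH_pos (N := N)
  rw [gapForm_apply, dir_wH, mform_comm (lH N) (wH N), mform_wH_lH]
  field_simp
  ring

theorem gapForm_lH (v : HDot N) : gapForm (lH N) v = 0 := by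
  have := mform_lH_pos (N := N)
  rw [gapForm_apply, dir_lH, mform_wH_lH]
  field_simp
  ring

/-- **Spectral gap**: on radial functions, `-Δ - μ₂ W^{4/(N-2)}` is nonnegative up to the two
directions `W` and `ΛW`. -/
theorem gapForm_nonneg (u : HDot N) (hu : Inv u.1) : 0 ≤ gapForm u u := by
  obtain ⟨C, hC⟩ := exists_abs_gapForm_le (N := N)
  refine nonneg_of_radial_test hC (fun φ hφ hr => ?_) u hu
  obtain ⟨r₁, r₂, h1, h12, H⟩ := exists_gap_smooth (N := N)
  obtain ⟨α, β, hab⟩ := exists_comb_eq_on_spheres hr h1 h12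
  set h : HDot N := hφ.toHDot - (α • wH N + β • lH N) with hh
  have hval : h.1 = φ - (α • W N + β • scalingGenerator (W N)) := rfl
  have e : gapForm hφ.toHDot hφ.toHDot = gapForm h h := by
    have e0 : hφ.toHDot = h + (α • wH N + β • lH N) := by rw [hh]; abel
    rw [e0]
    simp only [map_add, map_smul, LinearMap.add_apply, LinearMap.smul_apply, gapForm_wH, gapForm_lH,
      gapForm_comm h, smul_zero, add_zero]
  have h2 := H h (hval ▸ hφ.1.sub ((contDiff_const.smul W_contDiff).add
    (contDiff_const.smul LW_contDiff))) (fun x hx => by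
      rw [hval]
      simp only [Pi.sub_apply, Pi.add_apply, Pi.smul_apply, smul_eq_mul]
      rw [hab x hx, sub_self])
  have k0 := pexp_lt_mu2 hN.out
  have k1 := one_lt_pexp hN.out
  have m1 := mform_wH_pos (N := N)
  have m2 := mform_lH_pos (N := N)
  rw [e, gapForm_apply]
  have t1 : 0 ≤ (mu2 N - 1) / mform (wH N) (wH N) * (mform (wH N) h * mform (wH N) h) :=
    mul_nonneg (div_nonneg (by linarith) m1.le) (mul_self_nonneg _)
  have t2 : 0 ≤ (mu2 N - pexp N) / mform (lH N) (lH N) * (mform (lH N) h * mform (lH N) h) :=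
    mul_nonneg (div_nonneg (by linarith) m2.le) (mul_self_nonneg _)
  linarith

end gap

/-! ### Functions in `H¹` -/

theorem base_mul_jap_one {κ : ℝ} (hκ : 0 < κ) (x : Space N) :
    (1 + ‖x‖ ^ 2 / κ) * jap κ 1 x = 1 := by
  rw [jap, Real.rpow_neg (jap_base_pos hκ x).le, Real.rpow_one,
    mul_inv_cancel₀ (jap_base_pos hκ x).ne']

section inner
variable {F : Type*} [NormedAddCommGroup F] [InnerProductSpace ℝ F]

theorem integral_inner_eq {A B : Space N → F} (hA : MemLp A 2 volume) (hB : MemLp B 2 volume) :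
    ∫ x, inner ℝ (A x) (B x) = inner ℝ (hA.toLp A) (hB.toLp B) := by
  rw [L2.inner_def]
  refine integral_congr_ae ?_
  filter_upwards [hA.coeFn_toLp, hB.coeFn_toLp] with x h1 h2
  rw [h1, h2]

theorem integrable_inner_of_memLp {A B : Space N → F} (hA : MemLp A 2 volume)
    (hB : MemLp B 2 volume) : Integrable (fun x => inner ℝ (A x) (B x)) volume := by
  refine (L2.integrable_inner (𝕜 := ℝ) (hA.toLp A) (hB.toLp B)).congr ?_
  filter_upwards [hA.coeFn_toLp, hB.coeFn_toLp] with x h1 h2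
  rw [h1, h2]

theorem abs_integral_inner_le {A B : Space N → F} (hA : MemLp A 2 volume) (hB : MemLp B 2 volume) :
    |∫ x, inner ℝ (A x) (B x)| ≤ (eLpNorm A 2 volume).toReal * (eLpNorm B 2 volume).toReal := by
  rw [integral_inner_eq hA hB, ← Lp.norm_toLp A hA, ← Lp.norm_toLp B hB]
  exact abs_real_inner_le_norm _ _

theorem tendsto_integral_inner {A B : Space N → F} (hA : MemLp A 2 volume) (hB : MemLp B 2 volume)
    {b : ℕ → Space N → F} (hb : ∀ n, MemLp (b n) 2 volume)
    (h : Tendsto (fun n => eLpNorm (b n - B) 2 volume) atTop (𝓝 0)) :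
    Tendsto (fun n => ∫ x, inner ℝ (A x) (b n x)) atTop (𝓝 (∫ x, inner ℝ (A x) (B x))) := by
  rw [tendsto_iff_norm_sub_tendsto_zero]
  have h2 := ((ENNReal.tendsto_toReal ENNReal.zero_ne_top).comp h).const_mul
    (eLpNorm A 2 volume).toReal
  rw [ENNReal.toReal_zero, mul_zero] at h2
  refine squeeze_zero (fun n => norm_nonneg _) (fun n => ?_) h2
  rw [← integral_sub (integrable_inner_of_memLp hA (hb n)) (integrable_inner_of_memLp hA hB)]
  simp_rw [← inner_sub_right]
  exact abs_integral_inner_le hA ((hb n).sub hB)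

end inner

/-- Test functions are dense in `H¹`. -/
theorem MemH1.exists_seq {u : Space N → ℝ} (hu : MemH1 u) : ∃ φ : ℕ → Space N → ℝ,
    (∀ n, IsTest (φ n)) ∧ Tendsto (fun n => eLpNorm (φ n - u) 2 volume) atTop (𝓝 0) ∧
      Tendsto (fun n => eLpNorm (gradient (φ n) - weakGradient u) 2 volume) atTop (𝓝 0) := by
  obtain ⟨h2, G, hG, hG2⟩ := hu
  have hW := hasWeakGradient_weakGradient hG
  have hW2 : MemLp (weakGradient u) 2 volume := hG2.ae_eq (weakGradient_eq hG).symm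
  have hε : ∀ n : ℕ, ((n : ℝ≥0∞))⁻¹ ≠ 0 := fun n => by simp
  choose φ h1 h2 h3 _ using fun n => exists_test_approx (t := ⊤) (s := 2) one_le_two
    ENNReal.ofNat_ne_top eLpNorm_gradient_plateau_top_le hW h2 hW2 (hε n)
  exact ⟨φ, h1, tendsto_of_tendsto_of_tendsto_of_le_of_le tendsto_const_nhds
    ENNReal.tendsto_inv_nat_nhds_zero (fun _ => zero_le) h2,
    tendsto_of_tendsto_of_tendsto_of_le_of_le tendsto_const_nhds
    ENNReal.tendsto_inv_nat_nhds_zero (fun _ => zero_le) h3⟩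

theorem MemH1.memLp_weakGradient {u : Space N → ℝ} (hu : MemH1 u) :
    MemLp (weakGradient u) 2 volume := by
  obtain ⟨_, G, hG, hG2⟩ := hu
  exact hG2.ae_eq (weakGradient_eq hG).symm

theorem MemH1.hasWeakGradient {u : Space N → ℝ} (hu : MemH1 u) :
    HasWeakGradient u (weakGradient u) := by
  obtain ⟨_, G, hG, _⟩ := hu
  exact hasWeakGradient_weakGradient hG

section eig
variable [hN : Fact (3 ≤ N)]

/-- `H¹ ⊆ Ḣ¹`, by the Sobolev inequality and Fatou's lemma. -/
theorem MemH1.memHDot1 {u : Space N → ℝ} (hu : MemH1 u) : MemHDot1 u := by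
  refine ⟨?_, _, hu.hasWeakGradient, hu.memLp_weakGradient⟩
  obtain ⟨φ, hφ, h1, h2⟩ := hu.exists_seq
  obtain ⟨S, hS, hSob⟩ := exists_sobolev_test (N := N)
  have hm := tendstoInMeasure_of_tendsto_eLpNorm (two_ne_zero)
    (fun n => (hφ n).continuous.aestronglyMeasurable) hu.1.1 h1
  obtain ⟨ns, hns, hae⟩ := hm.exists_seq_tendsto_ae
  refine ⟨hu.1.1, ?_⟩
  have key := Lp.eLpNorm_lim_le_liminf_eLpNorm (p := ENNReal.ofReal (expS N)) (μ := volume)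
    (f := fun k => φ (ns k)) (fun k => (hφ _).continuous.aestronglyMeasurable) u hae
  refine key.trans_lt ?_
  have hb : ∀ᶠ k in atTop, eLpNorm (φ (ns k)) (ENNReal.ofReal (expS N)) volume ≤
      ENNReal.ofReal S * (1 + eLpNorm (weakGradient u) 2 volume) := by
    have h3 := (h2.comp hns.tendsto_atTop).eventually (eventually_le_nhds (b := 1) zero_lt_one)
    filter_upwards [h3] with k hk
    refine (hSob _ (hφ _)).trans ?_
    gcongr
    have e : gradient (φ (ns k)) = (gradient (φ (ns k)) - weakGradient u) + weakGradient u := by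
      abel
    rw [e]
    refine (eLpNorm_add_le ((((hφ _).memLp_gradient 2).sub hu.memLp_weakGradient).1)
      hu.memLp_weakGradient.1 one_le_two).trans ?_
    gcongr
    exact hk
  refine (liminf_le_of_frequently_le' hb.frequently).trans_lt ?_
  exact ENNReal.mul_lt_top ENNReal.ofReal_lt_top
    (ENNReal.add_lt_top.2 ⟨ENNReal.one_lt_top, hu.memLp_weakGradient.eLpNorm_lt_top⟩)

/-! ### Decay and symmetry of the eigenfunction -/

variable {ν : ℝ} {Y : Space N → ℝ}

theorem IsNegativeEigenpair.eigen' (hY : IsNegativeEigenpair N ν Y) {φ : Space N → ℝ}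
    (hφ : IsTest φ) : (∫ x, inner ℝ (weakGradient Y x) (gradient φ x)) -
      pexp N * (∫ x, pot N x * Y x * φ x) = -ν ^ 2 * ∫ x, Y x * φ x := by
  rw [← hY.eigen φ hφ, ← integral_const_mul]
  congr 1
  refine integral_congr_ae (ae_of_all _ fun x => ?_)
  simp only [deriv_nonlin_W hN.out]
  ring

theorem pot_le_one (x : Space N) : pot N x ≤ 1 := by
  rw [pot, jap, Real.rpow_neg (jap_base_pos (kap_pos hN.out) x).le]
  refine inv_le_one_of_one_le₀ (Real.one_le_rpow ?_ (by norm_num))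
  have := kap_pos hN.out
  have : 0 ≤ ‖x‖ ^ 2 / kap N := by positivity
  linarith

theorem continuous_pot : Continuous (pot N) := (jap_contDiff (kap_pos hN.out) _).continuous

/-- The eigenvalue equation tested against `m² Y`. -/
theorem IsNegativeEigenpair.weighted (hY : IsNegativeEigenpair N ν Y) {m : Space N → ℝ}
    (hm : ContDiff ℝ ∞ m) {C : ℝ} (h0 : ∀ x, |m x| ≤ C) (h1 : ∀ x, ‖gradient m x‖ ≤ C) :
    ν ^ 2 * ∫ x, m x ^ 2 * Y x ^ 2 ≤
      ∫ x, (pexp N * pot N x * m x ^ 2 + ‖gradient m x‖ ^ 2) * Y x ^ 2 := by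
  obtain ⟨φ, hφ, l1, l2⟩ := hY.memH1.exists_seq
  have hY2 := hY.memH1.1
  set G := weakGradient Y with hGd
  have hG2 : MemLp G 2 volume := hY.memH1.memLp_weakGradient
  have hC : 0 ≤ C := (abs_nonneg _).trans (h0 0)
  have hmc := hm.continuous
  have hgc := continuous_gradient hm
  have b2 : ∀ x, m x ^ 2 ≤ C ^ 2 := fun x => by
    rw [← sq_abs]; exact pow_le_pow_left₀ (abs_nonneg _) (h0 x) 2
  have A1 : MemLp (fun x => m x ^ 2 • G x) 2 volume := by
    refine hG2.of_le_mul (c := C ^ 2) ((hmc.pow 2).aestronglyMeasurable.smul hG2.1)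
      (ae_of_all _ fun x => ?_)
    rw [norm_smul, Real.norm_eq_abs, abs_of_nonneg (sq_nonneg _)]
    exact mul_le_mul_of_nonneg_right (b2 x) (norm_nonneg _)
  have A2 : MemLp (fun x => 2 * m x * inner ℝ (G x) (gradient m x)) 2 volume := by
    refine hG2.of_le_mul (c := 2 * C * C) (((continuous_const.mul hmc).aestronglyMeasurable).mul
      (hG2.1.inner hgc.aestronglyMeasurable)) (ae_of_all _ fun x => ?_)
    rw [norm_mul, norm_mul, Real.norm_eq_abs, Real.norm_eq_abs, Real.norm_eq_abs, abs_two]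
    have := abs_real_inner_le_norm (G x) (gradient m x)
    have h1x := h1 x
    have h0x := h0 x
    calc 2 * |m x| * |inner ℝ (G x) (gradient m x)| ≤ 2 * C * (‖G x‖ * C) := by
          gcongr
          exact this.trans (by gcongr)
      _ = _ := by ring
  have A3 : MemLp (fun x => (pexp N * pot N x - ν ^ 2) * m x ^ 2 * Y x) 2 volume := by
    refine hY2.of_le_mul (c := (|pexp N| + ν ^ 2) * C ^ 2)
      (((((continuous_const.mul continuous_pot).sub continuous_const).mul
        (hmc.pow 2)).aestronglyMeasurable).mul hY2.1) (ae_of_all _ fun x => ?_)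
    rw [norm_mul, norm_mul, Real.norm_eq_abs, Real.norm_eq_abs (m x ^ 2),
      abs_of_nonneg (sq_nonneg (m x))]
    refine mul_le_mul_of_nonneg_right (mul_le_mul ?_ (b2 x) (sq_nonneg _) (by positivity))
      (norm_nonneg _)
    · refine (abs_sub _ _).trans ?_
      rw [abs_mul, abs_of_pos (pot_pos x), abs_of_nonneg (sq_nonneg ν)]
      have := mul_le_mul_of_nonneg_left (pot_le_one x) (abs_nonneg (pexp N))
      linarith
  have t1 := tendsto_integral_inner A1 hG2 (fun n => (hφ n).memLp_gradient 2) l2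
  have t2 := tendsto_integral_inner A2 hY2 (fun n => (hφ n).memLp 2) l1
  have t3 := tendsto_integral_inner A3 hY2 (fun n => (hφ n).memLp 2) l1
  have hη : ∀ n, IsTest fun x => m x ^ 2 * φ n x := fun n => (hφ n).mul_left (hm.pow 2)
  have hgr : ∀ n x, gradient (fun x => m x ^ 2 * φ n x) x =
      m x ^ 2 • gradient (φ n) x + φ n x • ((2 * m x) • gradient m x) := fun n x => by
    rw [gradient_mul' ((hm.pow 2).diffAt x) ((hφ n).1.diffAt x),
      gradient_comp' (k := fun y => y ^ 2) (k' := 2 * m x) (by simpa using hasDerivAt_pow 2 (m x))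
        (hm.diffAt x)]
  have heq : ∀ n, (∫ x, inner ℝ (m x ^ 2 • G x) (gradient (φ n) x)) +
      (∫ x, inner ℝ (2 * m x * inner ℝ (G x) (gradient m x)) (φ n x)) -
      ∫ x, inner ℝ ((pexp N * pot N x - ν ^ 2) * m x ^ 2 * Y x) (φ n x) = 0 := fun n => by
    have h := hY.eigen' (hη n)
    have i1 : Integrable (fun x => pot N x * Y x * (m x ^ 2 * φ n x)) volume := by
      have := ((hη n).memLp 2).integrable_mul (hY2.mul
        (memLp_top_of_bound continuous_pot.aestronglyMeasurable 1 (ae_of_all _ fun x => by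
          rw [Real.norm_eq_abs, abs_of_pos (pot_pos x)]; exact pot_le_one x)) :
          MemLp (fun x => pot N x * Y x) 2 volume)
      refine this.congr (ae_of_all _ fun x => ?_)
      simp only [Pi.mul_apply]; ring
    have i2 : Integrable (fun x => Y x * (m x ^ 2 * φ n x)) volume :=
      hY2.integrable_mul ((hη n).memLp 2)
    have e1 : ∫ x, inner ℝ (G x) (gradient (fun x => m x ^ 2 * φ n x) x) =
        (∫ x, inner ℝ (m x ^ 2 • G x) (gradient (φ n) x)) +
        ∫ x, inner ℝ (2 * m x * inner ℝ (G x) (gradient m x)) (φ n x) := by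
      rw [← integral_add (integrable_inner_of_memLp A1 ((hφ n).memLp_gradient 2))
        (integrable_inner_of_memLp A2 ((hφ n).memLp 2))]
      refine integral_congr_ae (ae_of_all _ fun x => ?_)
      simp only [hgr, inner_add_right, inner_smul_right, inner_smul_left, RCLike.inner_apply,
        conj_trivial]
    have e2 : ∫ x, inner ℝ ((pexp N * pot N x - ν ^ 2) * m x ^ 2 * Y x) (φ n x) =
        pexp N * (∫ x, pot N x * Y x * (m x ^ 2 * φ n x)) -
          ν ^ 2 * ∫ x, Y x * (m x ^ 2 * φ n x) := by
      rw [← integral_const_mul, ← integral_const_mul, ← integral_sub (i1.const_mul _)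
        (i2.const_mul _)]
      refine integral_congr_ae (ae_of_all _ fun x => ?_)
      simp only [RCLike.inner_apply, conj_trivial]
      ring
    rw [← e1, e2]
    linarith
  have hlim := tendsto_nhds_unique ((t1.add t2).sub t3)
    (tendsto_const_nhds.congr fun n => (heq n).symm)
  have j1 := integrable_inner_of_memLp A1 hG2
  have j2 := integrable_inner_of_memLp A2 hY2
  have j3 := integrable_inner_of_memLp A3 hY2
  have mY : MemLp (fun x => m x * Y x) 2 volume := by
    refine hY2.of_le_mul (c := C) (hmc.aestronglyMeasurable.mul hY2.1) (ae_of_all _ fun x => ?_)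
    rw [norm_mul]
    exact mul_le_mul_of_nonneg_right (h0 x) (norm_nonneg _)
  have gY : MemLp (fun x => Y x • gradient m x) 2 volume := by
    refine hY2.of_le_mul (c := C) (hY2.1.smul hgc.aestronglyMeasurable) (ae_of_all _ fun x => ?_)
    rw [norm_smul, mul_comm]
    exact mul_le_mul_of_nonneg_right (h1 x) (norm_nonneg _)
  have j4 : Integrable (fun x => m x ^ 2 * Y x ^ 2) volume := by
    refine mY.integrable_sq.congr (ae_of_all _ fun x => ?_)
    simp only; ring
  have j5 : Integrable (fun x => ‖gradient m x‖ ^ 2 * Y x ^ 2) volume := by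
    refine gY.norm.integrable_sq.congr (ae_of_all _ fun x => ?_)
    simp only [norm_smul, Real.norm_eq_abs, mul_pow, sq_abs]; ring
  have e5 : (∫ x, (pexp N * pot N x * m x ^ 2 + ‖gradient m x‖ ^ 2) * Y x ^ 2) -
      ν ^ 2 * (∫ x, m x ^ 2 * Y x ^ 2) =
      (∫ x, inner ℝ ((pexp N * pot N x - ν ^ 2) * m x ^ 2 * Y x) (Y x)) +
        ∫ x, ‖gradient m x‖ ^ 2 * Y x ^ 2 := by
    have j6 : Integrable (fun x => (pexp N * pot N x * m x ^ 2 + ‖gradient m x‖ ^ 2) * Y x ^ 2)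
        volume := by
      refine ((j3.add (j4.const_mul (ν ^ 2))).add j5).congr (ae_of_all _ fun x => ?_)
      simp only [Pi.add_apply, RCLike.inner_apply, conj_trivial]
      ring
    rw [← integral_const_mul, ← integral_sub j6 (j4.const_mul _), ← integral_add j3 j5]
    refine integral_congr_ae (ae_of_all _ fun x => ?_)
    simp only [RCLike.inner_apply, conj_trivial]
    ring
  -- the sum is `∫ |∇(m Y)|²`
  have e6 : 0 ≤ (∫ x, inner ℝ (m x ^ 2 • G x) (G x)) +
      (∫ x, inner ℝ (2 * m x * inner ℝ (G x) (gradient m x)) (Y x)) +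
      ∫ x, ‖gradient m x‖ ^ 2 * Y x ^ 2 := by
    have e7 := integral_add (j1.add j2) j5
    simp only [Pi.add_apply] at e7
    rw [← integral_add j1 j2, ← e7]
    refine integral_nonneg fun x => ?_
    have h := sq_nonneg ‖m x • G x + Y x • gradient m x‖
    rw [← real_inner_self_eq_norm_sq] at h
    simp only [inner_add_left, inner_add_right, inner_smul_left, inner_smul_right,
      real_inner_self_eq_norm_sq, conj_trivial, real_inner_comm (G x) (gradient m x)] at h
    simp only [Pi.zero_apply, RCLike.inner_apply, conj_trivial, inner_smul_left,
      real_inner_self_eq_norm_sq]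
    nlinarith [h]
  linarith

/-- Agmon-type bound. The weight `m = (1+|x|²)/(1+|x|²/k)` is bounded, with a gradient that is
small compared with `m` at infinity, uniformly in `k`. -/
theorem IsNegativeEigenpair.weighted_bound (hY : IsNegativeEigenpair N ν Y) :
    ∃ C : ℝ, ∀ k : ℝ, 1 ≤ k → ∫ x, ((1 + ‖x‖ ^ 2) * jap k 1 x * Y x) ^ 2 ≤ C := by
  have hν := hY.nu_pos
  have hκ := kap_pos hN.out
  set K : ℝ := max 1 (kap N)
  have hK1 : 1 ≤ K := le_max_left _ _
  have hp : 0 < pexp N := by linarith [one_lt_pexp hN.out]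
  -- pointwise, `p W^{4/(N-2)} m² + |∇m|² ≤ (ν²/2) m² + C0`; the first term on the right is absorbed
  set C0 : ℝ := pexp N * K ^ 2 + 8 / ν ^ 2
  refine ⟨C0 * (2 / ν ^ 2), fun k hk => ?_⟩
  have hk0 : 0 < k := by linarith
  set m : Space N → ℝ := fun x => k - (k - 1) * jap k 1 x with hm
  have hms : ContDiff ℝ ∞ m := contDiff_const.sub (contDiff_const.mul (jap_contDiff hk0 1))
  -- the form of `m` in its definition is the one that is easy to differentiate
  have hm1 : ∀ x, m x = (1 + ‖x‖ ^ 2) * jap k 1 x := fun x => by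
    have := base_mul_jap_one hk0 x
    calc m x = k * ((1 + ‖x‖ ^ 2 / k) * jap k 1 x) - (k - 1) * jap k 1 x := by rw [this, mul_one]
      _ = _ := by field_simp; ring
  have hj1 : ∀ x : Space N, jap k 1 x ≤ 1 := fun x => by
    rw [jap, Real.rpow_neg (jap_base_pos hk0 x).le, Real.rpow_one]
    refine inv_le_one_of_one_le₀ ?_
    have : 0 ≤ ‖x‖ ^ 2 / k := by positivity
    linarith
  have hj0 : ∀ x : Space N, 0 < jap k 1 x := fun x => jap_pos hk0 1 x
  have hg : ∀ x, gradient m x = ((k - 1) * (2 / k) * jap k 2 x) • x := fun x => by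
    have e : m = (fun _ => k) - (k - 1) • jap k 1 := rfl
    rw [e, gradient_sub' (differentiableAt_const _)
        (((jap_contDiff hk0 1).diffAt x).const_smul (k - 1)),
      gradient_smul' _ ((jap_contDiff hk0 1).diffAt x), gradient_jap hk0]
    simp only [gradient, Pi.zero_apply, map_zero, fderiv_fun_const, zero_sub, smul_smul,
      ← neg_smul]
    norm_num
    congr 1
    ring
  have hj2 : ∀ x : Space N, jap k 2 x = jap k 1 x * jap k 1 x := fun x => by
    rw [jap_mul hk0]; norm_num
  have hgn : ∀ x, ‖gradient m x‖ ^ 2 ≤ 4 * ‖x‖ ^ 2 * jap k 1 x ^ 2 * jap k 1 x := fun x => by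
    have h0 := hj0 x
    have h1 : (k - 1) * (2 / k) ≤ 2 := by
      rw [mul_div_assoc', div_le_iff₀ hk0]; linarith
    have h1' : 0 ≤ (k - 1) * (2 / k) := mul_nonneg (by linarith) (by positivity)
    rw [hg, norm_smul, Real.norm_eq_abs, abs_of_nonneg (mul_nonneg h1' (jap_pos hk0 _ x).le), hj2]
    calc ((k - 1) * (2 / k) * (jap k 1 x * jap k 1 x) * ‖x‖) ^ 2
        ≤ (2 * (jap k 1 x * jap k 1 x) * ‖x‖) ^ 2 := by gcongr
      _ = 4 * ‖x‖ ^ 2 * jap k 1 x ^ 2 * (jap k 1 x * jap k 1 x) := by ring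
      _ ≤ 4 * ‖x‖ ^ 2 * jap k 1 x ^ 2 * (1 * jap k 1 x) := by gcongr; exact hj1 x
      _ = _ := by ring
  have hxj : ∀ x : Space N, ‖x‖ ^ 2 * jap k 1 x ≤ k := fun x => by
    have := hm1 x
    have h0 := hj0 x
    have h2 : m x ≤ k := by simp only [hm]; nlinarith
    nlinarith
  have hb0 : ∀ x, |m x| ≤ 4 * k := fun x => by
    have h0 := hj0 x
    rw [abs_of_nonneg (by rw [hm1]; positivity)]
    simp only [hm]; nlinarith
  have hb1 : ∀ x, ‖gradient m x‖ ≤ 4 * k := fun x => by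
    have h0 := hj0 x
    refine abs_le_of_sq_le_sq' ?_ (by positivity) |>.2
    refine (hgn x).trans ?_
    calc 4 * ‖x‖ ^ 2 * jap k 1 x ^ 2 * jap k 1 x
        = 4 * (‖x‖ ^ 2 * jap k 1 x) * (jap k 1 x * jap k 1 x) := by ring
      _ ≤ 4 * k * (1 * 1) := by gcongr <;> first | exact hxj x | exact hj1 x
      _ ≤ (4 * k) ^ 2 := by nlinarith
  have key := hY.weighted hms hb0 hb1
  have hY2 := hY.memH1.1
  have iY : Integrable (fun x => Y x ^ 2) volume := hY2.integrable_sq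
  have i1 : Integrable (fun x => m x ^ 2 * Y x ^ 2) volume := by
    have : MemLp (fun x => m x * Y x) 2 volume := by
      refine hY2.of_le_mul (c := 4 * k) (hms.continuous.aestronglyMeasurable.mul hY2.1)
        (ae_of_all _ fun x => ?_)
      rw [norm_mul]
      exact mul_le_mul_of_nonneg_right (hb0 x) (norm_nonneg _)
    refine this.integrable_sq.congr (ae_of_all _ fun x => ?_)
    simp only; ring
  have hpt : ∀ x, (pexp N * pot N x * m x ^ 2 + ‖gradient m x‖ ^ 2) * Y x ^ 2 ≤
      ν ^ 2 / 2 * (m x ^ 2 * Y x ^ 2) + C0 * Y x ^ 2 := fun x => by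
    rw [← mul_assoc, ← add_mul]
    refine mul_le_mul_of_nonneg_right ?_ (sq_nonneg _)
    have h0 := hj0 x
    have a1 : pot N x * m x ^ 2 ≤ K ^ 2 := by
      have e : pot N x = (jap (kap N) 1 x) ^ 2 := by
        rw [pot, sq, jap_mul hκ]; norm_num
      have b : jap (kap N) 1 x * (1 + ‖x‖ ^ 2) ≤ K := by
        have e2 := base_mul_jap_one hκ x
        have hjp := jap_pos hκ 1 x
        have : 1 + ‖x‖ ^ 2 ≤ K * (1 + ‖x‖ ^ 2 / kap N) := by
          have : ‖x‖ ^ 2 ≤ K * (‖x‖ ^ 2 / kap N) := by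
            calc ‖x‖ ^ 2 = kap N * (‖x‖ ^ 2 / kap N) := by field_simp
              _ ≤ _ := by gcongr; exact le_max_right _ _
          linarith
        calc jap (kap N) 1 x * (1 + ‖x‖ ^ 2) ≤ jap (kap N) 1 x * (K * (1 + ‖x‖ ^ 2 / kap N)) := by
              gcongr
          _ = K * ((1 + ‖x‖ ^ 2 / kap N) * jap (kap N) 1 x) := by ring
          _ = K := by rw [e2, mul_one]
      have hjp := jap_pos hκ 1 x
      rw [e, hm1, ← mul_pow]
      refine pow_le_pow_left₀ (by positivity) ?_ 2
      calc jap (kap N) 1 x * ((1 + ‖x‖ ^ 2) * jap k 1 x)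
          = (jap (kap N) 1 x * (1 + ‖x‖ ^ 2)) * jap k 1 x := by ring
        _ ≤ K * 1 := by gcongr; exact hj1 x
        _ = K := mul_one K
    have a2 : ‖gradient m x‖ ^ 2 ≤ ν ^ 2 / 2 * m x ^ 2 + 8 / ν ^ 2 := by
      have h3 : 4 * ‖x‖ ^ 2 ≤ ν ^ 2 / 2 * (1 + ‖x‖ ^ 2) ^ 2 + 8 / ν ^ 2 := by
        have h4 : 0 ≤ (ν ^ 2 * (1 + ‖x‖ ^ 2) - 4) ^ 2 / (2 * ν ^ 2) := by positivity
        have h5 : (ν ^ 2 * (1 + ‖x‖ ^ 2) - 4) ^ 2 / (2 * ν ^ 2) =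
          ν ^ 2 / 2 * (1 + ‖x‖ ^ 2) ^ 2 - 4 * (1 + ‖x‖ ^ 2) + 8 / ν ^ 2 := by field_simp; ring
        linarith
      calc ‖gradient m x‖ ^ 2 ≤ 4 * ‖x‖ ^ 2 * jap k 1 x ^ 2 * jap k 1 x := hgn x
        _ ≤ 4 * ‖x‖ ^ 2 * jap k 1 x ^ 2 * 1 := by gcongr; exact hj1 x
        _ = 4 * ‖x‖ ^ 2 * jap k 1 x ^ 2 := mul_one _
        _ ≤ (ν ^ 2 / 2 * (1 + ‖x‖ ^ 2) ^ 2 + 8 / ν ^ 2) * jap k 1 x ^ 2 := by gcongr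
        _ = ν ^ 2 / 2 * m x ^ 2 + 8 / ν ^ 2 * jap k 1 x ^ 2 := by rw [hm1]; ring
        _ ≤ _ := by
          gcongr
          have h6 : jap k 1 x ^ 2 ≤ 1 := pow_le_one₀ h0.le (hj1 x)
          exact mul_le_of_le_one_right (by positivity) h6
    have a3 := mul_le_mul_of_nonneg_left a1 hp.le
    rw [mul_assoc]
    linarith
  have i2 : Integrable (fun x => ν ^ 2 / 2 * (m x ^ 2 * Y x ^ 2) + C0 * Y x ^ 2) volume :=
    (i1.const_mul _).add (iY.const_mul _)
  have hle : ∫ x, (pexp N * pot N x * m x ^ 2 + ‖gradient m x‖ ^ 2) * Y x ^ 2 ≤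
      ∫ x, (ν ^ 2 / 2 * (m x ^ 2 * Y x ^ 2) + C0 * Y x ^ 2) := by
    refine integral_mono_of_nonneg (ae_of_all _ fun x => ?_) i2 (ae_of_all _ hpt)
    have := pot_pos x
    simp only [Pi.zero_apply]
    positivity
  rw [integral_add (i1.const_mul _) (iY.const_mul _), integral_const_mul, integral_const_mul,
    hY.normalized] at hle
  have e : ∫ x, ((1 + ‖x‖ ^ 2) * jap k 1 x * Y x) ^ 2 = ∫ x, m x ^ 2 * Y x ^ 2 := by
    refine integral_congr_ae (ae_of_all _ fun x => ?_)
    simp only [hm1]; ring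
  rw [e, mul_div_assoc', le_div_iff₀ (by positivity)]
  linarith

instance holderTriple_N_2_D :
    ENNReal.HolderTriple (ENNReal.ofReal N) 2 (ENNReal.ofReal (expD N)) := by
  have h := three_le_cast (N := N)
  have hD : 0 < expD N := by rw [expD]; positivity
  constructor
  rw [← ENNReal.ofReal_ofNat 2,
    ← ENNReal.ofReal_inv_of_pos (by linarith), ← ENNReal.ofReal_inv_of_pos hD,
    ← ENNReal.ofReal_inv_of_pos two_pos, ← ENNReal.ofReal_add (by positivity) (by positivity)]
  congr 1
  rw [expD]; field_simp; ring

/-- The eigenfunction decays: `(1+|x|²) Y ∈ L²`. -/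
theorem IsNegativeEigenpair.decay (hY : IsNegativeEigenpair N ν Y) :
    MemLp (fun x => (1 + ‖x‖ ^ 2) * Y x) 2 volume := by
  obtain ⟨C, hC⟩ := hY.weighted_bound
  have hY2 := hY.memH1.1
  have hw : Continuous fun x : Space N => 1 + ‖x‖ ^ 2 := by fun_prop
  have hmeas : ∀ n : ℕ, AEStronglyMeasurable
      (fun x => (1 + ‖x‖ ^ 2) * jap ((n : ℝ) + 1) 1 x * Y x) volume := fun n =>
    (hw.mul (jap_contDiff (by positivity) 1).continuous).aestronglyMeasurable.mul hY2.1
  refine ⟨hw.aestronglyMeasurable.mul hY2.1, ?_⟩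
  have hlim : ∀ x : Space N, Tendsto (fun n : ℕ => (1 + ‖x‖ ^ 2) * jap ((n : ℝ) + 1) 1 x * Y x)
      atTop (𝓝 ((1 + ‖x‖ ^ 2) * Y x)) := fun x => by
    have h1 : Tendsto (fun n : ℕ => 1 + ‖x‖ ^ 2 / ((n : ℝ) + 1)) atTop (𝓝 (1 + 0)) :=
      (tendsto_const_nhds.div_atTop (tendsto_atTop_add_const_right _ _
        tendsto_natCast_atTop_atTop)).const_add 1
    have h2 := (h1.inv₀ (by norm_num)).const_mul (1 + ‖x‖ ^ 2) |>.mul_const (Y x)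
    simp only [add_zero, inv_one, mul_one] at h2
    refine h2.congr fun n => ?_
    rw [jap, Real.rpow_neg (by positivity), Real.rpow_one]
  have key := Lp.eLpNorm_lim_le_liminf_eLpNorm (p := 2) (μ := volume) hmeas _ (ae_of_all _ hlim)
  refine key.trans_lt ?_
  have hb : ∀ n : ℕ, eLpNorm (fun x => (1 + ‖x‖ ^ 2) * jap ((n : ℝ) + 1) 1 x * Y x) 2 volume ≤
      ENNReal.ofReal (√C) := fun n => by
    have hm2 : MemLp (fun x => (1 + ‖x‖ ^ 2) * jap ((n : ℝ) + 1) 1 x * Y x) 2 volume := by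
      refine hY2.of_le_mul (c := (n : ℝ) + 1) (hmeas n) (ae_of_all _ fun x => ?_)
      rw [norm_mul]
      gcongr
      have hn : (0 : ℝ) < (n : ℝ) + 1 := by positivity
      have hp := jap_pos hn 1 x
      rw [Real.norm_eq_abs, abs_of_pos (by positivity), jap, Real.rpow_neg (by positivity),
        Real.rpow_one, ← div_eq_mul_inv, div_le_iff₀ (by positivity)]
      field_simp
      nlinarith [sq_nonneg ‖x‖, (Nat.cast_nonneg n : (0 : ℝ) ≤ n)]
    have h1 := hC ((n : ℝ) + 1) (by linarith [(Nat.cast_nonneg n : (0 : ℝ) ≤ n)])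
    rw [← ENNReal.ofReal_toReal hm2.eLpNorm_lt_top.ne]
    refine ENNReal.ofReal_le_ofReal ?_
    rw [← Lp.norm_toLp _ hm2]
    refine Real.le_sqrt_of_sq_le ?_
    rw [← real_inner_self_eq_norm_sq, ← integral_inner_eq hm2 hm2]
    refine le_trans (le_of_eq (integral_congr_ae (ae_of_all _ fun x => ?_))) h1
    simp only [RCLike.inner_apply, conj_trivial]; ring
  refine (liminf_le_of_frequently_le' (Eventually.of_forall hb).frequently).trans_lt
    ENNReal.ofReal_lt_top

/-- The eigenfunction lies in the dual Lebesgue space, so `u ↦ ⟨Y, u⟩` is continuous on `Ḣ¹`. -/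
theorem IsNegativeEigenpair.memLp_expD (hY : IsNegativeEigenpair N ν Y) :
    MemLp Y (ENNReal.ofReal (expD N)) volume := by
  have h := three_le_cast (N := N)
  have hj : MemLp (jap 1 1 : Space N → ℝ) (ENNReal.ofReal N) volume :=
    jap_memLp one_pos (by linarith) (by linarith)
  have := hY.decay.mul (r := ENNReal.ofReal (expD N)) hj
  refine this.ae_eq (ae_of_all _ fun x => ?_)
  have hb := base_mul_jap_one one_pos x
  rw [div_one] at hb
  simp only [Pi.mul_apply]
  rw [← mul_assoc, mul_comm (jap 1 1 x), hb, one_mul]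

/-- The eigenfunction as an element of `Ḣ¹`. -/
def IsNegativeEigenpair.toHDot (hY : IsNegativeEigenpair N ν Y) : HDot N := ⟨Y, hY.memH1.memHDot1⟩

/-- The functional `u ↦ ⟨Y, u⟩` on `Ḣ¹`. -/
def IsNegativeEigenpair.form (hY : IsNegativeEigenpair N ν Y) : HDot N →ₗ[ℝ] ℝ :=
  lform Y hY.memLp_expD

theorem IsNegativeEigenpair.form_self (hY : IsNegativeEigenpair N ν Y) : hY.form hY.toHDot = 1 := by
  rw [← hY.normalized]
  refine integral_congr_ae (ae_of_all _ fun x => ?_)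
  simp only [toHDot]; ring

/-- The eigenvalue equation on `Ḣ¹`. -/
theorem IsNegativeEigenpair.dir_eq (hY : IsNegativeEigenpair N ν Y) (v : HDot N) :
    dir hY.toHDot v - pexp N * mform hY.toHDot v = -ν ^ 2 * hY.form v := by
  obtain ⟨C, -, hC⟩ := exists_abs_mform_le (N := N)
  rw [← sub_eq_zero]
  set C2 := (eLpNorm Y (ENNReal.ofReal (expD N)) volume).toReal * sob N
  refine eq_zero_of_test (l := fun v => dir hY.toHDot v - pexp N * mform hY.toHDot v -
    -ν ^ 2 * hY.form v) (C := ‖gradLp hY.toHDot‖ + |pexp N| * (C * ‖gradLp hY.toHDot‖) +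
      ν ^ 2 * C2) (fun v v' => ?_) (fun v => ?_) (fun φ hφ => ?_) v
  · simp only [map_sub]; ring
  · have h1 := abs_dir_le hY.toHDot v
    have h2 := mul_le_mul_of_nonneg_left (hC hY.toHDot v) (abs_nonneg (pexp N))
    have h3 := mul_le_mul_of_nonneg_left (abs_lform_le Y hY.memLp_expD v) (sq_nonneg ν)
    refine (abs_sub _ _).trans ((add_le_add (abs_sub _ _) le_rfl).trans ?_)
    rw [abs_mul, abs_mul, abs_neg, abs_of_nonneg (sq_nonneg ν)]
    change ν ^ 2 * |hY.form v| ≤ _ at h3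
    linarith
  · have h := hY.eigen' hφ
    rw [dir_eq_integral_of (gradLp_ae _) (gradLp_ae_of_contDiff _ hφ.1), mform_apply, sub_eq_zero]
    exact h

/-- The linearized form `∫ ∇u·∇v - f'(W) u v`. -/
def qform : HDot N →ₗ[ℝ] HDot N →ₗ[ℝ] ℝ := dir - pexp N • mform

theorem qform_apply (u v : HDot N) : qform u v = dir u v - pexp N * mform u v := rfl

theorem qform_comm (u v : HDot N) : qform u v = qform v u := by
  rw [qform_apply, qform_apply, dir_comm, mform_comm]

theorem exists_abs_qform_le : ∃ C : ℝ, 0 ≤ C ∧ ∀ u v : HDot N,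
    |qform u v| ≤ C * (‖gradLp u‖ * ‖gradLp v‖) := by
  obtain ⟨C, hC0, hC⟩ := exists_abs_mform_le (N := N)
  refine ⟨1 + |pexp N| * C, by positivity, fun u v => ?_⟩
  have h1 := abs_dir_le u v
  have h2 := mul_le_mul_of_nonneg_left (hC u v) (abs_nonneg (pexp N))
  rw [qform_apply]
  refine (abs_sub _ _).trans ?_
  rw [abs_mul]
  linarith

omit hN in
theorem dir_comp_isometry {φ : Space N → ℝ} (hφ : IsTest φ) (T : Space N ≃ₗᵢ[ℝ] Space N) :
    dir (hφ.comp_isometry T).toHDot (hφ.comp_isometry T).toHDot = dir hφ.toHDot hφ.toHDot := by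
  rw [dir_self_eq_integral_of (gradLp_ae_of_contDiff _ (hφ.comp_isometry T).1),
    dir_self_eq_integral_of (gradLp_ae_of_contDiff _ hφ.1)]
  have h := (T.measurePreserving).integral_comp T.toHomeomorph.measurableEmbedding
    (fun x => ‖gradient φ x‖ ^ 2)
  refine Eq.trans (integral_congr_ae (ae_of_all _ fun x => ?_)) h
  change ‖gradient (φ ∘ T) x‖ ^ 2 = _
  rw [gradient_comp_isometry hφ.1, LinearIsometryEquiv.norm_map]

theorem mform_comp_isometry {φ : Space N → ℝ} (hφ : IsTest φ) (T : Space N ≃ₗᵢ[ℝ] Space N) :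
    mform (hφ.comp_isometry T).toHDot (hφ.comp_isometry T).toHDot = mform hφ.toHDot hφ.toHDot := by
  have h := (T.measurePreserving).integral_comp T.toHomeomorph.measurableEmbedding
    (fun x => pot N x * φ x * φ x)
  rw [mform_apply, mform_apply]
  refine Eq.trans (integral_congr_ae (ae_of_all _ fun x => ?_)) h
  simp only [IsTest.toHDot, Function.comp_apply, pot, jap_isometry]

/-- The linearized form of a test function against its odd part is nonnegative. -/
theorem qform_sub_reflection_nonneg {φ : Space N → ℝ} (hφ : IsTest φ) {e : Space N} (he : ‖e‖ = 1) :
    0 ≤ qform hφ.toHDot (hφ.toHDot - (hφ.comp_isometry (ℝ ∙ e)ᗮ.reflection).toHDot) := by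
  set T := (ℝ ∙ e)ᗮ.reflection
  set A := hφ.toHDot
  set B := (hφ.comp_isometry T).toHDot
  have ho : IsTest (φ - φ ∘ T) := hφ.sub (hφ.comp_isometry T)
  have h1 := odd_test_nonneg hN.out he ho fun x => by
    simp only [Pi.sub_apply, Function.comp_apply]
    rw [Submodule.reflection_reflection]
    ring
  have h2 : 0 ≤ qform (A - B) (A - B) := by
    change 0 ≤ qform ho.toHDot ho.toHDot
    rw [qform_apply, dir_self_eq_integral_of (gradLp_ae_of_contDiff _ ho.1), mform_apply,
      ← integral_const_mul, sub_nonneg]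
    refine le_trans (le_of_eq (integral_congr_ae (ae_of_all _ fun x => ?_))) h1
    simp only [IsTest.toHDot]
    ring
  have h3 : qform B B = qform A A := by
    rw [qform_apply, qform_apply, dir_comp_isometry, mform_comp_isometry]
  simp only [map_sub, LinearMap.sub_apply] at h2 ⊢
  rw [h3, qform_comm B A] at h2
  linarith

/-- The eigenfunction is radial: its odd part under a reflection would be a negative direction. -/
theorem IsNegativeEigenpair.inv (hY : IsNegativeEigenpair N ν Y) : Inv Y := by
  have main : ∀ e : Space N, ‖e‖ = 1 → Y ∘ (ℝ ∙ e)ᗮ.reflection =ᵐ[volume] Y := fun e he => by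
    set T := (ℝ ∙ e)ᗮ.reflection
    have hT : MeasurePreserving T volume volume := T.measurePreserving
    obtain ⟨φ, hφ, l1, l2⟩ := hY.memH1.exists_seq
    have hY2 := hY.memH1.1
    have hYT : MemLp (Y ∘ T) 2 volume := hY2.comp_measurePreserving hT
    obtain ⟨C, hC0, hC⟩ := exists_abs_qform_le (N := N)
    set y := hY.toHDot
    set B : ℕ → HDot N := fun n => ((hφ n).comp_isometry T).toHDot
    set δ : ℕ → ℝ := fun n => ‖gradLp ((hφ n).toHDot - y)‖ with hδ
    have ld : Tendsto δ atTop (𝓝 0) := by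
      have := (ENNReal.tendsto_toReal ENNReal.zero_ne_top).comp l2
      refine this.congr fun n => ?_
      rw [hδ]
      exact (norm_gradLp_sub_toHDot (hφ n) y hY.memH1.hasWeakGradient).symm
    have t1 : Tendsto (fun n => ∫ x, inner ℝ (Y x) ((φ n - φ n ∘ T) x)) atTop
        (𝓝 (∫ x, inner ℝ (Y x) ((Y - Y ∘ T) x))) := by
      refine tendsto_integral_inner hY2 (hY2.sub hYT)
        (fun n => ((hφ n).sub ((hφ n).comp_isometry T)).memLp 2) ?_
      have h2 : Tendsto (fun n => eLpNorm (φ n - Y) 2 volume + eLpNorm (φ n - Y) 2 volume) atTop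
          (𝓝 0) := by simpa using l1.add l1
      refine tendsto_of_tendsto_of_tendsto_of_le_of_le tendsto_const_nhds h2 (fun _ => zero_le)
        fun n => ?_
      have hm := ((hφ n).memLp 2).sub hY2
      have e1 : φ n - φ n ∘ T - (Y - Y ∘ T) = (φ n - Y) - (φ n - Y) ∘ T := by
        funext x; simp only [Pi.sub_apply, Function.comp_apply]; ring
      simp only
      rw [e1]
      refine (eLpNorm_sub_le hm.1 (hm.1.comp_measurePreserving hT) one_le_two).trans ?_
      rw [eLpNorm_comp_measurePreserving hm.1 hT]
    have hle : ∀ n, 0 ≤ -ν ^ 2 * (∫ x, inner ℝ (Y x) ((φ n - φ n ∘ T) x)) +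
        C * (δ n * (2 * (‖gradLp y‖ + δ n))) := fun n => by
      set A := (hφ n).toHDot
      have h1 : 0 ≤ qform A (A - B n) := qform_sub_reflection_nonneg (hφ n) he
      have h2 : qform A (A - B n) = qform y (A - B n) + qform (A - y) (A - B n) := by
        simp only [map_sub, LinearMap.sub_apply]; ring
      have h3 : qform y (A - B n) = -ν ^ 2 * ∫ x, inner ℝ (Y x) ((φ n - φ n ∘ T) x) := by
        rw [qform_apply, hY.dir_eq]
        congr 1
        refine integral_congr_ae (ae_of_all _ fun x => ?_)
        simp only [RCLike.inner_apply, conj_trivial, mul_comm]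
        rfl
      have h4 : ‖gradLp A‖ ≤ ‖gradLp y‖ + δ n := by
        have : gradLp A = gradLp y + gradLp (A - y) := by rw [map_sub]; abel
        rw [this]
        exact norm_add_le _ _
      have h5 : ‖gradLp (B n)‖ = ‖gradLp A‖ := by
        have h := dir_comp_isometry (hφ n) T
        rw [dir_self, dir_self] at h
        exact (pow_left_inj₀ (norm_nonneg _) (norm_nonneg _) two_ne_zero).1 h
      have h6 : ‖gradLp (A - B n)‖ ≤ 2 * (‖gradLp y‖ + δ n) := by
        rw [map_sub]
        refine (norm_sub_le _ _).trans ?_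
        rw [h5]; linarith
      have h7 := (le_abs_self _).trans (hC (A - y) (A - B n))
      have h8 : C * (δ n * ‖gradLp (A - B n)‖) ≤ C * (δ n * (2 * (‖gradLp y‖ + δ n))) := by
        gcongr
      have h9 : qform (A - y) (A - B n) ≤ C * (δ n * ‖gradLp (A - B n)‖) := h7
      rw [← h3]
      linarith
    have hlim := ge_of_tendsto' ((t1.const_mul (-ν ^ 2)).add
      ((ld.mul ((ld.const_add ‖gradLp y‖).const_mul 2)).const_mul C)) hle
    rw [zero_mul, mul_zero, add_zero] at hlim
    have hν := hY.nu_pos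
    have hneg : ∫ x, inner ℝ (Y x) ((Y - Y ∘ T) x) ≤ 0 := by
      by_contra hpos
      push Not at hpos
      have : 0 < ν ^ 2 * ∫ x, inner ℝ (Y x) ((Y - Y ∘ T) x) := by positivity
      linarith
    have hsq : ∫ x, (Y - Y ∘ T) x ^ 2 = 2 * ∫ x, inner ℝ (Y x) ((Y - Y ∘ T) x) := by
      have hinv : ∫ x, (Y ∘ T) x ^ 2 = ∫ x, Y x ^ 2 :=
        hT.integral_comp T.toHomeomorph.measurableEmbedding (fun x => Y x ^ 2)
      have j1 := hY2.integrable_sq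
      have j2 := hYT.integrable_sq
      have j3 := integrable_inner_of_memLp hY2 (hY2.sub hYT)
      rw [← sub_eq_zero, ← integral_const_mul, ← integral_sub (hY2.sub hYT).integrable_sq
        (j3.const_mul 2)]
      rw [← sub_eq_zero, ← integral_sub j2 j1] at hinv
      rw [← hinv]
      refine integral_congr_ae (ae_of_all _ fun x => ?_)
      simp only [Pi.sub_apply, RCLike.inner_apply, conj_trivial]
      ring
    have hz : (fun x => (Y - Y ∘ T) x ^ 2) =ᵐ[volume] 0 :=
      (integral_eq_zero_iff_of_nonneg (fun x => sq_nonneg _) (hY2.sub hYT).integrable_sq).1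
        (le_antisymm (by linarith) (integral_nonneg fun x => sq_nonneg _))
    filter_upwards [hz] with x hx
    have := pow_eq_zero_iff (two_ne_zero) |>.1 hx
    simp only [Pi.sub_apply] at this
    linarith
  intro e
  by_cases h0 : e = 0
  · refine ae_of_all _ fun x => ?_
    have : (ℝ ∙ e)ᗮ.reflection x = x := by
      refine Submodule.reflection_mem_subspace_eq_self ?_
      rw [h0, Submodule.mem_orthogonal_singleton_iff_inner_right, inner_zero_left]
    rw [Function.comp_apply, this]
  · have hne : ‖e‖ ≠ 0 := norm_ne_zero_iff.2 h0
    have h := main (‖e‖⁻¹ • e) (by rw [norm_smul, norm_inv, norm_norm, inv_mul_cancel₀ hne])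
    have hs : (ℝ ∙ (‖e‖⁻¹ • e)) = (ℝ ∙ e) :=
      Submodule.span_singleton_smul_eq (IsUnit.mk0 _ (inv_ne_zero hne)) e
    simp only [hs] at h
    exact h

end eig

/-! ### Coercivity of the linearized form -/

theorem Inv.add {u v : Space N → ℝ} (hu : Inv u) (hv : Inv v) : Inv (u + v) := fun e =>
  (hu e).add (hv e)

theorem Inv.smul {u : Space N → ℝ} (c : ℝ) (hu : Inv u) : Inv (c • u) := fun e =>
  (hu e).const_smul c

theorem sq_sub_sub_le (a b c : ℝ) : (a - b - c) ^ 2 ≤ 3 * (a ^ 2 + b ^ 2 + c ^ 2) := by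
  have e : 3 * (a ^ 2 + b ^ 2 + c ^ 2) - (a - b - c) ^ 2 =
      (a + b) ^ 2 + (a + c) ^ 2 + (b - c) ^ 2 := by
    ring
  have := sq_nonneg (a + b)
  have := sq_nonneg (a + c)
  have := sq_nonneg (b - c)
  linarith

section coercive
variable [hN : Fact (3 ≤ N)]

/-- The coefficient of `u` along `W`, for the orthogonal projection with respect to `mform`. -/
def cw (u : HDot N) : ℝ := mform (wH N) u / mform (wH N) (wH N)

/-- The coefficient of `u` along `ΛW`, for the orthogonal projection with respect to `mform`. -/
def cl (u : HDot N) : ℝ := mform (lH N) u / mform (lH N) (lH N)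

/-- The component of `u` orthogonal to `W` and `ΛW` for `mform`. -/
def rest (u : HDot N) : HDot N := u - (cw u • wH N + cl u • lH N)

theorem eq_rest_add (u : HDot N) : u = rest u + (cw u • wH N + cl u • lH N) := by
  rw [rest]; abel

theorem mform_wH_rest (u : HDot N) : mform (wH N) (rest u) = 0 := by
  have := (mform_wH_pos (N := N)).ne'
  simp only [rest, map_sub, map_add, map_smul, smul_eq_mul, mform_wH_lH, cw]
  field_simp
  ring

theorem mform_lH_rest (u : HDot N) : mform (lH N) (rest u) = 0 := by
  have := (mform_lH_pos (N := N)).ne'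
  simp only [rest, map_sub, map_add, map_smul, smul_eq_mul, mform_comm (lH N) (wH N), mform_wH_lH,
    cl]
  field_simp
  ring

theorem qform_wH (v : HDot N) : qform (wH N) v = (1 - pexp N) * mform (wH N) v := by
  rw [qform_apply, dir_wH]; ring

theorem qform_lH (v : HDot N) : qform (lH N) v = 0 := by
  rw [qform_apply, dir_lH]; ring

/-- The linearized form is diagonal: negative along `W`, zero along `ΛW`. -/
theorem qform_eq (u v : HDot N) : qform u v =
    -((pexp N - 1) * mform (wH N) (wH N)) * (cw u * cw v) + qform (rest u) (rest v) := by
  conv_lhs => rw [eq_rest_add u, eq_rest_add v]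
  simp only [map_add, map_smul, LinearMap.add_apply, LinearMap.smul_apply, smul_eq_mul,
    qform_comm (rest u) (wH N), qform_comm (rest u) (lH N), qform_wH, qform_lH, mform_wH_rest,
    mform_wH_lH]
  ring

theorem dir_self_eq (u : HDot N) : dir u u = cw u ^ 2 * mform (wH N) (wH N) +
    cl u ^ 2 * (pexp N * mform (lH N) (lH N)) + dir (rest u) (rest u) := by
  conv_lhs => rw [eq_rest_add u]
  simp only [map_add, map_smul, LinearMap.add_apply, LinearMap.smul_apply, smul_eq_mul,
    dir_comm (rest u) (wH N), dir_comm (rest u) (lH N), dir_wH, dir_lH, mform_wH_rest,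
    mform_lH_rest, mform_wH_lH, mform_comm (lH N) (wH N)]
  ring

/-- The spectral gap: since `p < μ₂`, the linearized form is coercive on the radial functions
orthogonal to `W` and `ΛW`. -/
theorem qform_rest_ge {u : HDot N} (hu : Inv u.1) :
    (1 - pexp N / mu2 N) * dir (rest u) (rest u) ≤ qform (rest u) (rest u) := by
  have hg := gapForm_nonneg u hu
  have e : gapForm u u = gapForm (rest u) (rest u) := by
    conv_lhs => rw [eq_rest_add u]
    simp only [map_add, map_smul, LinearMap.add_apply, LinearMap.smul_apply, gapForm_wH, gapForm_lH,
      gapForm_comm (rest u), smul_zero, add_zero]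
  rw [e, gapForm_apply, mform_wH_rest, mform_lH_rest] at hg
  have h1 := one_lt_pexp hN.out
  have h2 := pexp_lt_mu2 hN.out
  have hμ : 0 < mu2 N := by linarith
  rw [qform_apply, sub_mul, one_mul]
  have : pexp N * mform (rest u) (rest u) ≤ pexp N / mu2 N * dir (rest u) (rest u) := by
    rw [div_mul_eq_mul_div, le_div_iff₀ hμ]
    nlinarith
  linarith

theorem gap_const_pos : 0 < 1 - pexp N / mu2 N := by
  have h1 := one_lt_pexp hN.out
  have h2 := pexp_lt_mu2 hN.out
  rw [sub_pos, div_lt_one (by linarith)]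
  exact h2

theorem qform_rest_nonneg {u : HDot N} (hu : Inv u.1) : 0 ≤ qform (rest u) (rest u) := by
  refine le_trans (mul_nonneg gap_const_pos.le ?_) (qform_rest_ge hu)
  rw [dir_self]; positivity

theorem rest_add_smul (u v : HDot N) (s : ℝ) : rest (s • u + v) = s • rest u + rest v := by
  simp only [rest, cw, cl, map_add, map_smul, smul_eq_mul, smul_sub, smul_add, smul_smul, add_div,
    add_smul, mul_div_assoc]
  abel

/-- Cauchy–Schwarz inequality for the linearized form on the complement of `W` and `ΛW`. -/
theorem sq_qform_rest_le {u v : HDot N} (hu : Inv u.1) (hv : Inv v.1) :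
    qform (rest u) (rest v) ^ 2 ≤ qform (rest u) (rest u) * qform (rest v) (rest v) := by
  have h : ∀ s : ℝ, 0 ≤ qform (rest u) (rest u) * (s * s) + 2 * qform (rest u) (rest v) * s +
      qform (rest v) (rest v) := fun s => by
    have h1 := qform_rest_nonneg (u := s • u + v) ((hu.smul s).add hv)
    rw [rest_add_smul] at h1
    simp only [map_add, map_smul, LinearMap.add_apply, LinearMap.smul_apply, smul_eq_mul,
      qform_comm (rest v) (rest u)] at h1
    linarith
  have := discrim_le_zero h
  rw [discrim] at this
  nlinarith

variable {ν : ℝ} {Y Z : Space N → ℝ}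

/-- On radial functions orthogonal to the eigenfunction, the negative direction `W` of the
linearized form is dominated: this is the Cauchy–Schwarz inequality for the nonnegative part. -/
theorem IsNegativeEigenpair.exists_qform_ge (hY : IsNegativeEigenpair N ν Y) : ∃ κ : ℝ, 0 < κ ∧
    ∀ u : HDot N, Inv u.1 → hY.form u = 0 →
      κ * qform (rest u) (rest u) ≤ qform u u ∧
      (pexp N - 1) * mform (wH N) (wH N) * cw u ^ 2 ≤ qform (rest u) (rest u) := by
  set y := hY.toHDot with hy
  set A := (pexp N - 1) * mform (wH N) (wH N) with hA
  have hA0 : 0 < A := mul_pos (by linarith [one_lt_pexp hN.out]) mform_wH_pos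
  have hν := hY.nu_pos
  have hyy : qform y y = -ν ^ 2 := by
    rw [qform_apply, hY.dir_eq, hY.form_self, mul_one]
  have hyr := qform_rest_nonneg (u := y) hY.inv
  rw [qform_eq] at hyy
  set y0 := cw y
  have hy0 : 0 < A * y0 ^ 2 := by nlinarith [pow_pos hν 2]
  refine ⟨ν ^ 2 / (A * y0 ^ 2), by positivity, fun u hu h0 => ?_⟩
  have h1 : qform y u = 0 := by rw [qform_apply, hY.dir_eq, h0, mul_zero]
  rw [qform_eq] at h1
  have hcs := sq_qform_rest_le (u := y) (v := u) hY.inv hu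
  have hr := qform_rest_nonneg hu
  rw [qform_eq u u]
  set q := qform (rest u) (rest u)
  set a := cw u
  have e1 : qform (rest y) (rest u) = A * (y0 * a) := by linarith
  -- `A y0² - ν² < A y0²` is the quantitative gain in the Cauchy–Schwarz inequality below
  have e2 : qform (rest y) (rest y) = A * y0 ^ 2 - ν ^ 2 := by nlinarith
  rw [e1, e2] at hcs
  have h3 : A * a ^ 2 ≤ q - ν ^ 2 / (A * y0 ^ 2) * q := by
    have : (A * y0 ^ 2) * (A * a ^ 2) ≤ (A * y0 ^ 2) * (q - ν ^ 2 / (A * y0 ^ 2) * q) := by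
      have e : (A * y0 ^ 2) * (q - ν ^ 2 / (A * y0 ^ 2) * q) = (A * y0 ^ 2 - ν ^ 2) * q := by
        rw [mul_sub, ← mul_assoc, mul_div_cancel₀ _ hy0.ne', sub_mul]
      rw [e]; nlinarith
    exact le_of_mul_le_mul_left this hy0
  have h4 : 0 ≤ ν ^ 2 / (A * y0 ^ 2) * q := by positivity
  constructor
  · nlinarith
  · linarith

/-- **Coercivity of the linearized form around one bubble**, on radial functions. -/
theorem IsNegativeEigenpair.coercive (hY : IsNegativeEigenpair N ν Y) (hZ : IsTest Z)
    (hZW : 0 < pairing Z (scalingGenerator (W N))) (hZY : pairing Z Y = 0) :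
    ∃ c : ℝ, 0 < c ∧ ∀ u : HDot N, Inv u.1 →
      c * dir u u ≤ qform u u + 2 * ν ^ 2 * hY.form u ^ 2 + (lform Z (hZ.memLp _) u) ^ 2 := by
  obtain ⟨κ, hκ, H⟩ := hY.exists_qform_ge
  set y := hY.toHDot with hy
  set z := lform Z (hZ.memLp _) with hz
  have hzl : z (lH N) = pairing Z (scalingGenerator (W N)) := rfl
  have hzy : z y = 0 := hZY
  rw [← hzl] at hZW
  set ζ := z (lH N)
  set A := (pexp N - 1) * mform (wH N) (wH N) with hA
  have hp := one_lt_pexp hN.out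
  have hA0 : 0 < A := mul_pos (by linarith) mform_wH_pos
  set c0 := 1 - pexp N / mu2 N with hc0
  have hc0p : 0 < c0 := gap_const_pos
  set Cz := (eLpNorm Z (ENNReal.ofReal (expD N)) volume).toReal * sob N
  set mw := mform (wH N) (wH N)
  set ml := mform (lH N) (lH N)
  have hmw : 0 < mw := mform_wH_pos
  have hml : 0 < ml := mform_lH_pos
  set K2 := 3 * (pexp N * ml) / ζ ^ 2 with hK2
  set K1 := mw / A + K2 * (z (wH N) ^ 2 / A + Cz ^ 2 / c0) + 1 / c0 with hK1
  have hK20 : 0 < K2 := by positivity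
  have hK10 : 0 < K1 := by positivity
  have hν := hY.nu_pos
  have hdy : 0 ≤ dir y y := by rw [dir_self]; positivity
  set K := 2 * (K1 / κ) + 2 * K2 + 2 * dir y y / ν ^ 2 with hK
  have hK0 : 0 < K := by positivity
  refine ⟨K⁻¹, by positivity, fun u hu => ?_⟩
  set s := hY.form u
  -- the component of `u` orthogonal to the eigenfunction
  set v := u - s • y with hv
  have huv : u = v + s • y := by rw [hv]; abel
  have hvi : Inv v.1 := by
    have : v.1 = u.1 + (-s) • Y := by
      rw [hv, neg_smul, ← sub_eq_add_neg]; rfl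
    rw [this]
    exact hu.add (hY.inv.smul _)
  have hv0 : hY.form v = 0 := by
    rw [hv, map_sub, map_smul, hY.form_self, smul_eq_mul, mul_one, sub_self]
  obtain ⟨h1, h2⟩ := H v hvi hv0
  have h3 := qform_rest_ge hvi
  have h4 := qform_rest_nonneg hvi
  have hzv : z v = z u := by rw [hv, map_sub, map_smul, hzy, smul_zero, sub_zero]
  -- the splitting is orthogonal for the linearized form
  have hqu : qform u u = qform v v - ν ^ 2 * s ^ 2 := by
    have e1 : qform y v = 0 := by rw [qform_apply, hY.dir_eq, hv0, mul_zero]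
    have e2 : qform y y = -ν ^ 2 := by rw [qform_apply, hY.dir_eq, hY.form_self, mul_one]
    rw [huv]
    simp only [map_add, map_smul, LinearMap.add_apply, LinearMap.smul_apply, smul_eq_mul,
      qform_comm v y, e1, e2]
    ring
  have hdu : dir u u ≤ 2 * dir v v + 2 * s ^ 2 * dir y y := by
    have e : 0 ≤ dir (v - s • y) (v - s • y) := by rw [dir_self]; positivity
    rw [huv]
    simp only [map_add, map_sub, map_smul, LinearMap.add_apply, LinearMap.sub_apply,
      LinearMap.smul_apply, smul_eq_mul] at e ⊢
    rw [dir_comm y v] at *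
    linarith
  set q := qform (rest v) (rest v)
  set a := cw v
  set b := cl v
  set h := rest v
  have hzh : z h ^ 2 ≤ Cz ^ 2 * dir h h := by
    have := abs_lform_le Z (hZ.memLp _) h
    rw [dir_self, ← mul_pow, ← sq_abs (z h)]
    exact pow_le_pow_left₀ (abs_nonneg _) this 2
  -- as `⟨Z, ΛW⟩ ≠ 0`, the value of `⟨Z, u⟩` controls the coefficient of `ΛW`
  have hb : b ^ 2 * (pexp N * ml) ≤ K2 * (z u ^ 2 + a ^ 2 * z (wH N) ^ 2 + z h ^ 2) := by
    have e : z v = z h + (a * z (wH N) + b * ζ) := by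
      conv_lhs => rw [eq_rest_add v]
      simp only [map_add, map_smul, smul_eq_mul]
      rfl
    rw [hzv] at e
    have hb1 : b * ζ = z u - a * z (wH N) - z h := by linarith
    have hb2 : b ^ 2 * ζ ^ 2 ≤ 3 * (z u ^ 2 + a ^ 2 * z (wH N) ^ 2 + z h ^ 2) := by
      rw [← mul_pow, hb1, ← mul_pow]
      exact sq_sub_sub_le _ _ _
    have hpm : 0 < pexp N * ml := by positivity
    rw [hK2, div_mul_eq_mul_div, le_div_iff₀ (by positivity)]
    calc b ^ 2 * (pexp N * ml) * ζ ^ 2 = (pexp N * ml) * (b ^ 2 * ζ ^ 2) := by ring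
      _ ≤ (pexp N * ml) * (3 * (z u ^ 2 + a ^ 2 * z (wH N) ^ 2 + z h ^ 2)) := by gcongr
      _ = _ := by ring
  have hqa : a ^ 2 ≤ q / A := by rw [le_div_iff₀ hA0]; linarith
  have hqh : dir h h ≤ q / c0 := by rw [le_div_iff₀ hc0p]; linarith
  have hdv : dir v v ≤ K1 * q + K2 * z u ^ 2 := by
    rw [dir_self_eq]
    have i1 : a ^ 2 * mw ≤ q / A * mw := by gcongr
    have i2 : K2 * (a ^ 2 * z (wH N) ^ 2) ≤ K2 * (q / A * z (wH N) ^ 2) := by gcongr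
    have i3 : K2 * z h ^ 2 ≤ K2 * (Cz ^ 2 * (q / c0)) := by
      gcongr
      exact hzh.trans (by gcongr)
    have e : K1 * q = q / A * mw + K2 * (q / A * z (wH N) ^ 2) + K2 * (Cz ^ 2 * (q / c0)) +
        q / c0 := by
      rw [hK1]; field_simp; ring
    rw [e]
    linarith
  have hq2 : K1 * q ≤ K1 / κ * qform v v := by
    rw [div_mul_eq_mul_div, le_div_iff₀ hκ]
    calc K1 * q * κ = K1 * (κ * q) := by ring
      _ ≤ K1 * qform v v := by gcongr
  have hqv : 0 ≤ qform v v := le_trans (by positivity) h1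
  rw [inv_mul_le_iff₀ hK0, hqu]
  have f1 : 2 * s ^ 2 * dir y y = 2 * dir y y / ν ^ 2 * (ν ^ 2 * s ^ 2) := by field_simp
  have f2 : 0 ≤ 2 * dir y y / ν ^ 2 := by positivity
  have f3 : 0 ≤ K1 / κ := by positivity
  have f4 : 0 ≤ ν ^ 2 * s ^ 2 := by positivity
  have f5 := sq_nonneg (z u)
  calc dir u u ≤ 2 * (K1 / κ) * qform v v + 2 * K2 * z u ^ 2 +
        2 * dir y y / ν ^ 2 * (ν ^ 2 * s ^ 2) := by
        rw [f1] at hdu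
        linarith only [hdu, hdv, hq2]
    _ ≤ K * qform v v + K * z u ^ 2 + K * (ν ^ 2 * s ^ 2) := by
        gcongr <;> rw [hK] <;> linarith only [f2, f3, hK20]
    _ = _ := by ring

end coercive

/-! ### Dilations -/

theorem integral_comp_smul' (f : Space N → ℝ) {r : ℝ} (hr : 0 < r) :
    ∫ x, f (r • x) = (r ^ N)⁻¹ * ∫ x, f x := by
  rw [Measure.integral_comp_smul, finrank_euclideanSpace, Fintype.card_fin, smul_eq_mul,
    abs_of_pos (by positivity)]

theorem MemLp.comp_smul' {F : Type*} [NormedAddCommGroup F] {f : Space N → F} {p : ℝ≥0∞}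
    (hf : MemLp f p volume) {r : ℝ} (hr : r ≠ 0) : MemLp (fun x => f (r • x)) p volume := by
  have he : MeasurableEmbedding fun x : Space N => r • x :=
    (Homeomorph.smulOfNeZero r hr).measurableEmbedding
  refine (he.memLp_map_measure_iff (g := f)).1 ?_
  rw [Measure.map_addHaar_smul _ hr]
  exact hf.smul_measure ENNReal.ofReal_ne_top

theorem IsTest.comp_smul {φ : Space N → ℝ} (h : IsTest φ) {r : ℝ} (hr : r ≠ 0) :
    IsTest fun x => φ (r • x) :=
  ⟨h.1.comp (contDiff_const_smul r), h.2.comp_homeomorph (Homeomorph.smulOfNeZero r hr)⟩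

theorem gradient_comp_smul (f : Space N → ℝ) (r : ℝ) (x : Space N) :
    gradient (fun y => f (r • y)) x = r • gradient f (r • x) := by
  simp only [gradient, fderiv_comp_smul, map_smul]

/-- The inverse of the dilation `v ↦ v_λ`, which preserves the `Ḣ¹` norm. -/
def unscale (r : ℝ) (g : Space N → ℝ) : Space N → ℝ := fun y => r ^ (((N : ℝ) - 2) / 2) * g (r • y)

theorem IsTest.unscale {g : Space N → ℝ} (h : IsTest g) {r : ℝ} (hr : 0 < r) :
    IsTest (unscale r g) := (h.comp_smul hr.ne').smul (r ^ (((N : ℝ) - 2) / 2))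

/-- The dilation `unscale` preserves `∫ |∇g|²`; this is the identity of exponents behind it. -/
theorem rpow_half_sq {r : ℝ} (hr : 0 < r) : (r ^ (((N : ℝ) - 2) / 2)) ^ 2 * r ^ 2 = r ^ N := by
  rw [← Real.rpow_natCast (r ^ _), ← Real.rpow_mul hr.le, ← Real.rpow_natCast r 2,
    ← Real.rpow_add hr, ← Real.rpow_natCast r N]
  congr 1
  push_cast
  ring

theorem integral_gradient_unscale {g : Space N → ℝ} (h : IsTest g) {r : ℝ} (hr : 0 < r) :
    ∫ x, ‖gradient (unscale r g) x‖ ^ 2 = ∫ x, ‖gradient g x‖ ^ 2 := by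
  have h1 := integral_comp_smul' (fun x => ‖gradient g x‖ ^ 2) hr
  have e : ∀ x, ‖gradient (unscale r g) x‖ ^ 2 = r ^ N * ‖gradient g (r • x)‖ ^ 2 := fun x => by
    have e0 : unscale r g = r ^ (((N : ℝ) - 2) / 2) • fun y => g (r • y) := rfl
    rw [e0, gradient_smul' _ ((h.comp_smul hr.ne').1.diffAt x), gradient_comp_smul, norm_smul,
      norm_smul, mul_pow, mul_pow, Real.norm_eq_abs, sq_abs, Real.norm_eq_abs, sq_abs, ← mul_assoc,
      rpow_half_sq hr]
  simp_rw [e]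
  rw [integral_const_mul, h1, ← mul_assoc, mul_inv_cancel₀ (by positivity), one_mul]

/-- A potential `a` at unit scale becomes the potential `r⁻² a(x/r)`. -/
theorem integral_mul_unscale_sq (a g : Space N → ℝ) {r : ℝ} (hr : 0 < r) :
    ∫ x, a x * unscale r g x * unscale r g x = ∫ x, (r ^ 2)⁻¹ * a (r⁻¹ • x) * g x * g x := by
  have h1 := integral_comp_smul' (fun x => (r ^ 2)⁻¹ * a (r⁻¹ • x) * g x * g x) hr
  have e : ∀ x, a x * unscale r g x * unscale r g x =
      r ^ N * ((r ^ 2)⁻¹ * a (r⁻¹ • r • x) * g (r • x) * g (r • x)) := fun x => by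
    rw [← rpow_half_sq hr, inv_smul_smul₀ hr.ne']
    simp only [unscale]
    field_simp
  simp_rw [e]
  rw [integral_const_mul, h1, ← mul_assoc, mul_inv_cancel₀ (by positivity), one_mul]

/-- A functional at unit scale becomes `r⁻¹` times its `L²`-rescaling. -/
theorem integral_mul_unscale (b g : Space N → ℝ) {r : ℝ} (hr : 0 < r) :
    ∫ x, b x * unscale r g x = r⁻¹ * ∫ x, scaleL2 r b x * g x := by
  have h1 := integral_comp_smul' (fun x => scaleL2 r b x * g x) hr
  have e : ∀ x, b x * unscale r g x = r⁻¹ * r ^ N * (scaleL2 r b (r • x) * g (r • x)) := fun x => by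
    have e2 : r⁻¹ * r ^ N * r ^ (-((N : ℝ) / 2)) = r ^ (((N : ℝ) - 2) / 2) := by
      rw [← Real.rpow_neg_one r, ← Real.rpow_natCast r N, ← Real.rpow_add hr, ← Real.rpow_add hr]
      congr 1
      ring
    simp only [unscale, scaleL2]
    rw [inv_smul_smul₀ hr.ne', ← e2]
    ring
  simp_rw [e]
  rw [integral_const_mul, h1, ← mul_assoc, mul_assoc r⁻¹, mul_inv_cancel₀ (by positivity), mul_one]

/-! ### The partition of unity separating the two scales -/

/-- The angle `arctan (((|x|² + λ₁²) / (λ₁ λ₂)) ^ ε)`. The functions `cos (cutAngle ε λ₁ λ₂)` and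
`sin (cutAngle ε λ₁ λ₂)` are concentrated on the scales `λ₁` and `λ₂` respectively; a small exponent
`ε` makes the transition between them slow. -/
def cutAngle (ε l₁ l₂ : ℝ) (x : Space N) : ℝ := Real.arctan (((‖x‖ ^ 2 + l₁ ^ 2) / (l₁ * l₂)) ^ ε)

theorem cutAngle_contDiff (ε : ℝ) {l₁ l₂ : ℝ} (h1 : 0 < l₁) (h2 : 0 < l₂) :
    ContDiff ℝ ∞ (cutAngle ε l₁ l₂ : Space N → ℝ) :=
  Real.contDiff_arctan.comp ((((contDiff_norm_sq ℝ).add contDiff_const).div_const _)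
    |>.rpow_const_of_ne fun x => by positivity)

/-- The partition varies slowly on the logarithmic scale. -/
theorem norm_gradient_cutAngle_sq_le {ε : ℝ} (hε : 0 < ε) {l₁ l₂ : ℝ} (h1 : 0 < l₁) (h2 : 0 < l₂)
    (x : Space N) : ‖gradient (cutAngle ε l₁ l₂) x‖ ^ 2 ≤ ε ^ 2 / (‖x‖ ^ 2 + l₁ ^ 2) := by
  set q : Space N → ℝ := fun x => (‖x‖ ^ 2 + l₁ ^ 2) / (l₁ * l₂) with hq
  have hqd : HasFDerivAt q ((l₁ * l₂)⁻¹ • ((2 : ℕ) • innerSL ℝ x)) x := by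
    have := (((hasStrictFDerivAt_norm_sq x).hasFDerivAt.add_const (l₁ ^ 2)).const_mul (l₁ * l₂)⁻¹)
    refine this.congr_of_eventuallyEq (Eventually.of_forall fun y => ?_)
    simp only [hq, div_eq_inv_mul]
  have hq0 : 0 < q x := by simp only [hq]; positivity
  have hgq : gradient q x = (2 / (l₁ * l₂)) • x := by
    refine ext_inner_right ℝ fun e => ?_
    rw [inner_gradient_apply, hqd.fderiv, inner_smul_left]
    simp
    ring
  set s := q x ^ ε with hs
  have hs0 : 0 < s := Real.rpow_pos_of_pos hq0 _
  have hk : HasDerivAt (fun t : ℝ => Real.arctan (t ^ ε)) (1 / (1 + s ^ 2) * (ε * q x ^ (ε - 1)))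
      (q x) := (Real.hasDerivAt_rpow_const (Or.inl hq0.ne')).arctan
  have hcut : cutAngle ε l₁ l₂ = fun x => Real.arctan (q x ^ ε) := rfl
  have hg := gradient_comp' (k := fun t => Real.arctan (t ^ ε)) hk hqd.differentiableAt
  have hτ : 0 < ‖x‖ ^ 2 + l₁ ^ 2 := by positivity
  have e : 1 / (1 + s ^ 2) * (ε * q x ^ (ε - 1)) * (2 / (l₁ * l₂)) =
      ε * (2 * s / (1 + s ^ 2)) * (‖x‖ ^ 2 + l₁ ^ 2)⁻¹ := by
    rw [Real.rpow_sub_one hq0.ne', ← hs]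
    simp only [hq]
    field_simp
  have hs1 : 2 * s / (1 + s ^ 2) ≤ 1 := by
    rw [div_le_one (by positivity)]; nlinarith [sq_nonneg (s - 1)]
  have hs2 : 0 ≤ 2 * s / (1 + s ^ 2) := by positivity
  rw [hcut, hg, hgq, smul_smul, norm_smul, e, mul_pow, Real.norm_eq_abs, sq_abs, mul_pow, mul_pow]
  calc ε ^ 2 * (2 * s / (1 + s ^ 2)) ^ 2 * ((‖x‖ ^ 2 + l₁ ^ 2)⁻¹) ^ 2 * ‖x‖ ^ 2
      ≤ ε ^ 2 * 1 * ((‖x‖ ^ 2 + l₁ ^ 2)⁻¹) ^ 2 * (‖x‖ ^ 2 + l₁ ^ 2) := by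
        gcongr
        · exact pow_le_one₀ hs2 hs1
        · linarith [sq_nonneg l₁]
    _ = _ := by field_simp

theorem gradient_cos_mul {θ g : Space N → ℝ} (hθ : ContDiff ℝ ∞ θ) (hg : ContDiff ℝ ∞ g)
    (x : Space N) : gradient (fun x => Real.cos (θ x) * g x) x =
      Real.cos (θ x) • gradient g x + g x • (-Real.sin (θ x) • gradient θ x) := by
  have hc : ContDiff ℝ ∞ fun x => Real.cos (θ x) := Real.contDiff_cos.comp hθ
  rw [gradient_mul' (hc.diffAt x) (hg.diffAt x),
    gradient_comp' (Real.hasDerivAt_cos _) (hθ.diffAt x)]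

theorem gradient_sin_mul {θ g : Space N → ℝ} (hθ : ContDiff ℝ ∞ θ) (hg : ContDiff ℝ ∞ g)
    (x : Space N) : gradient (fun x => Real.sin (θ x) * g x) x =
      Real.sin (θ x) • gradient g x + g x • (Real.cos (θ x) • gradient θ x) := by
  have hc : ContDiff ℝ ∞ fun x => Real.sin (θ x) := Real.contDiff_sin.comp hθ
  rw [gradient_mul' (hc.diffAt x) (hg.diffAt x),
    gradient_comp' (Real.hasDerivAt_sin _) (hθ.diffAt x)]

theorem IsTest.cos_mul {θ g : Space N → ℝ} (hθ : ContDiff ℝ ∞ θ) (hg : IsTest g) :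
    IsTest fun x => Real.cos (θ x) * g x := hg.mul_left (Real.contDiff_cos.comp hθ)

theorem IsTest.sin_mul {θ g : Space N → ℝ} (hθ : ContDiff ℝ ∞ θ) (hg : IsTest g) :
    IsTest fun x => Real.sin (θ x) * g x := hg.mul_left (Real.contDiff_sin.comp hθ)

theorem IsTest.integrable_gradient_sq {g : Space N → ℝ} (hg : IsTest g) :
    Integrable (fun x => ‖gradient g x‖ ^ 2) volume :=
  (hg.memLp_gradient 2).norm.integrable_sq

/-- The IMS localization formula. -/
theorem ims {θ g : Space N → ℝ} (hθ : ContDiff ℝ ∞ θ) (hg : IsTest g) :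
    (∫ x, ‖gradient (fun x => Real.cos (θ x) * g x) x‖ ^ 2) +
      ∫ x, ‖gradient (fun x => Real.sin (θ x) * g x) x‖ ^ 2 =
    (∫ x, ‖gradient g x‖ ^ 2) + ∫ x, ‖gradient θ x‖ ^ 2 * g x ^ 2 := by
  have i : Integrable (fun x => ‖gradient θ x‖ ^ 2 * g x ^ 2) volume := by
    have h := (hg.mul_left hg.1).integrable_mul (((continuous_gradient hθ).norm).pow 2)
    refine h.congr (ae_of_all _ fun x => ?_)
    simp only [sq, Pi.mul_apply]
  rw [← integral_add (hg.cos_mul hθ).integrable_gradient_sq (hg.sin_mul hθ).integrable_gradient_sq,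
    ← integral_add hg.integrable_gradient_sq i]
  refine integral_congr_ae (ae_of_all _ fun x => ?_)
  simp only [gradient_cos_mul hθ hg.1, gradient_sin_mul hθ hg.1]
  simp only [← real_inner_self_eq_norm_sq, inner_add_left, inner_add_right, inner_smul_left,
    inner_smul_right, conj_trivial, real_inner_comm (gradient g x) (gradient θ x)]
  have := Real.sin_sq_add_cos_sq (θ x)
  linear_combination (inner ℝ (gradient g x) (gradient g x) +
    g x ^ 2 * inner ℝ (gradient θ x) (gradient θ x)) * this

/-- By Hardy's inequality, the localization error in `ims` for the angle `cutAngle ε` is `O(ε²)`,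
uniformly in the two scales. -/
theorem localization_le (hN : 3 ≤ N) {ε : ℝ} (hε : 0 < ε) {l₁ l₂ : ℝ} (h1 : 0 < l₁) (h2 : 0 < l₂)
    {g : Space N → ℝ} (hg : IsTest g) :
    (∫ x, ‖gradient (fun x => Real.cos (cutAngle ε l₁ l₂ x) * g x) x‖ ^ 2) +
      ∫ x, ‖gradient (fun x => Real.sin (cutAngle ε l₁ l₂ x) * g x) x‖ ^ 2 ≤
    (1 + 4 * ε ^ 2) * ∫ x, ‖gradient g x‖ ^ 2 := by
  have hθ := cutAngle_contDiff (N := N) ε h1 h2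
  have hN' : (3 : ℝ) ≤ N := by exact_mod_cast hN
  have hH := hardy hN hg (δ := l₁ ^ 2) (by positivity)
  have hI0 : 0 ≤ ∫ x, g x ^ 2 / (‖x‖ ^ 2 + l₁ ^ 2) := integral_nonneg fun x => by positivity
  have hH2 : 1 / 4 * ∫ x, g x ^ 2 / (‖x‖ ^ 2 + l₁ ^ 2) ≤ ∫ x, ‖gradient g x‖ ^ 2 := by
    refine le_trans (mul_le_mul_of_nonneg_right ?_ hI0) hH
    nlinarith
  have i : Integrable (fun x => g x ^ 2 / (‖x‖ ^ 2 + l₁ ^ 2)) volume := by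
    have hc : Continuous fun x : Space N => (‖x‖ ^ 2 + l₁ ^ 2)⁻¹ :=
      Continuous.inv₀ (by fun_prop) fun x => by positivity
    refine ((hg.mul_left hg.1).integrable_mul hc).congr (ae_of_all _ fun x => ?_)
    simp only; ring
  have hle : ∫ x, ‖gradient (cutAngle ε l₁ l₂) x‖ ^ 2 * g x ^ 2 ≤
      ε ^ 2 * ∫ x, g x ^ 2 / (‖x‖ ^ 2 + l₁ ^ 2) := by
    rw [← integral_const_mul]
    refine integral_mono_of_nonneg (ae_of_all _ fun x => by positivity) (i.const_mul _)
      (ae_of_all _ fun x => ?_)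
    refine (mul_le_mul_of_nonneg_right (norm_gradient_cutAngle_sq_le hε h1 h2 x)
      (sq_nonneg (g x))).trans (le_of_eq ?_)
    ring
  rw [ims hθ hg]
  nlinarith [sq_nonneg ε]

/-- Seen from the scale `λ₁`, the angle tends to `0` as `λ₁/λ₂ → 0`. -/
theorem cutAngle_smul_left (ε : ℝ) {l₁ l₂ : ℝ} (h1 : 0 < l₁) (h2 : 0 < l₂) (y : Space N) :
    cutAngle ε l₁ l₂ (l₁ • y) = Real.arctan ((l₁ / l₂ * (‖y‖ ^ 2 + 1)) ^ ε) := by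
  rw [cutAngle, norm_smul, Real.norm_eq_abs, abs_of_pos h1]
  congr 2
  field_simp

/-- Seen from the scale `λ₂`, the angle tends to `π/2` as `λ₁/λ₂ → 0`, away from the origin. -/
theorem cutAngle_smul_right (ε : ℝ) {l₁ l₂ : ℝ} (h1 : 0 < l₁) (h2 : 0 < l₂) (y : Space N) :
    cutAngle ε l₁ l₂ (l₂ • y) = Real.arctan (((‖y‖ ^ 2 + (l₁ / l₂) ^ 2) / (l₁ / l₂)) ^ ε) := by
  rw [cutAngle, norm_smul, Real.norm_eq_abs, abs_of_pos h2]
  congr 2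
  field_simp

theorem cos_sin_cutAngle_nonneg (ε l₁ l₂ : ℝ) (x : Space N) (h1 : 0 < l₁) (h2 : 0 < l₂) :
    0 ≤ Real.cos (cutAngle ε l₁ l₂ x) ∧ 0 ≤ Real.sin (cutAngle ε l₁ l₂ x) := by
  have hs : 0 < ((‖x‖ ^ 2 + l₁ ^ 2) / (l₁ * l₂)) ^ ε := by positivity
  rw [cutAngle, Real.cos_arctan, Real.sin_arctan]
  constructor <;> positivity

/-! ### Coercivity for two separated bubbles -/

section local_coercive
variable [hN : Fact (3 ≤ N)] {ν : ℝ} {Y Z : Space N → ℝ}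

/-- If `χ → 1`, replacing `u` by `χ u` in `∫ b u` costs `o(1) ‖∇u‖`. -/
theorem tendsto_lform_error {ι : Type*} {l : Filter ι} [l.IsCountablyGenerated]
    {χ : ι → Space N → ℝ} (hc : ∀ᶠ i in l, ContDiff ℝ ∞ (χ i)) (h0 : ∀ᶠ i in l, ∀ x, 0 ≤ χ i x)
    (h1 : ∀ᶠ i in l, ∀ x, χ i x ≤ 1) (hlim : ∀ᵐ x, Tendsto (fun i => χ i x) l (𝓝 1))
    (b : Space N → ℝ) (hb : MemLp b (ENNReal.ofReal (expD N)) volume) {δ : ℝ} (hδ : 0 < δ) :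
    ∀ᶠ i in l, ∀ (u : Space N → ℝ) (hu : IsTest u) (hv : IsTest fun x => χ i x * u x),
      lform b hb hv.toHDot ^ 2 ≤ lform b hb hu.toHDot ^ 2 + δ * dir hu.toHDot hu.toHDot := by
  have h := three_le_cast (N := N)
  have hD : 0 < expD N := by rw [expD]; positivity
  have ht := tendsto_eLpNorm_smul_zero (l := l) (p := ENNReal.ofReal (expD N)) (by simpa using hD)
    ENNReal.ofReal_ne_top hb (m := fun i x => 1 - χ i x)
    (hc.mono fun i hi => (continuous_const.sub hi.continuous).aestronglyMeasurable)
    (by filter_upwards [h0, h1] with i a b x; rw [abs_le]; constructor <;> linarith [a x, b x])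
    (hlim.mono fun x hx => by simpa using hx.const_sub 1)
  set K := (eLpNorm b (ENNReal.ofReal (expD N)) volume).toReal * sob N
  have hK : 0 ≤ K := mul_nonneg ENNReal.toReal_nonneg sob_pos.le
  have hs := sob_pos (N := N)
  have ht2 : Tendsto (fun i => (2 * K + (eLpNorm (fun x => (1 - χ i x) • b x)
      (ENNReal.ofReal (expD N)) volume).toReal * sob N) * ((eLpNorm (fun x => (1 - χ i x) • b x)
      (ENNReal.ofReal (expD N)) volume).toReal * sob N)) l (𝓝 0) := by
    have a := ((ENNReal.tendsto_toReal ENNReal.zero_ne_top).comp ht).mul_const (sob N)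
    simpa using (a.const_add (2 * K)).mul a
  filter_upwards [hc, h0, h1, ht2.eventually (eventually_le_nhds hδ)] with i ci c0 c1 hi u hu hv
  have hb' : MemLp (fun x => (1 - χ i x) • b x) (ENNReal.ofReal (expD N)) volume :=
    hb.of_le ((continuous_const.sub ci.continuous).aestronglyMeasurable.smul hb.1)
      (ae_of_all _ fun x => by
        rw [norm_smul, Real.norm_eq_abs, abs_of_nonneg (by linarith [c1 x])]
        exact mul_le_of_le_one_left (norm_nonneg _) (by linarith [c0 x]))
  set e := (eLpNorm (fun x => (1 - χ i x) • b x) (ENNReal.ofReal (expD N)) volume).toReal * sob N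
  have he : 0 ≤ e := mul_nonneg ENNReal.toReal_nonneg hs.le
  have e1 := abs_lform_le b hb hu.toHDot
  have e2 := abs_lform_le _ hb' hu.toHDot
  have e3 : lform b hb hv.toHDot = lform b hb hu.toHDot - lform _ hb' hu.toHDot := by
    rw [lform_apply, lform_apply, lform_apply, ← integral_sub
      (integrable_mul_of_memLp hb (hdot_memLp _)) (integrable_mul_of_memLp hb' (hdot_memLp _))]
    refine integral_congr_ae (ae_of_all _ fun x => ?_)
    simp only [IsTest.toHDot, smul_eq_mul]
    ring
  rw [e3, dir_self]
  set A := lform b hb hu.toHDot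
  set E := lform _ hb' hu.toHDot
  set n := ‖gradLp hu.toHDot‖
  have hn : 0 ≤ n := norm_nonneg _
  calc (A - E) ^ 2 = A ^ 2 + (-2 * A * E + E ^ 2) := by ring
    _ ≤ A ^ 2 + (2 * |A| * |E| + |E| ^ 2) := by
        rw [sq_abs]
        have := neg_abs_le (A * E)
        rw [abs_mul] at this
        linarith
    _ ≤ A ^ 2 + (2 * (K * n) * (e * n) + (e * n) ^ 2) := by gcongr
    _ = A ^ 2 + (2 * K + e) * e * n ^ 2 := by ring
    _ ≤ A ^ 2 + δ * n ^ 2 := by gcongr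

/-- If `χ → 1`, replacing `u` by `χ u` in `∫ a u²` costs `o(1) ‖∇u‖²`. -/
theorem tendsto_wform_error {ι : Type*} {l : Filter ι} [l.IsCountablyGenerated]
    {χ : ι → Space N → ℝ} (hc : ∀ᶠ i in l, ContDiff ℝ ∞ (χ i)) (h0 : ∀ᶠ i in l, ∀ x, 0 ≤ χ i x)
    (h1 : ∀ᶠ i in l, ∀ x, χ i x ≤ 1) (hlim : ∀ᵐ x, Tendsto (fun i => χ i x) l (𝓝 1))
    {a : Space N → ℝ} (ha : MemLp a (ENNReal.ofReal ((N : ℝ) / 2)) volume) {δ : ℝ} (hδ : 0 < δ) :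
    ∀ᶠ i in l, ∀ (u : Space N → ℝ) (hu : IsTest u) (hv : IsTest fun x => χ i x * u x),
      wform a ha hu.toHDot hu.toHDot ≤ wform a ha hv.toHDot hv.toHDot +
        δ * dir hu.toHDot hu.toHDot := by
  have h := three_le_cast (N := N)
  have hsq : ∀ i x, 0 ≤ χ i x → χ i x ≤ 1 → 0 ≤ 1 - χ i x ^ 2 ∧ 1 - χ i x ^ 2 ≤ 1 :=
    fun i x a b => ⟨by nlinarith, by nlinarith [sq_nonneg (χ i x)]⟩
  have ht := tendsto_eLpNorm_smul_zero (l := l) (p := ENNReal.ofReal ((N : ℝ) / 2))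
    (by have := hN.out; simp; omega)
    ENNReal.ofReal_ne_top ha (m := fun i x => 1 - χ i x ^ 2)
    (hc.mono fun i hi => (continuous_const.sub (hi.continuous.pow 2)).aestronglyMeasurable)
    (by filter_upwards [h0, h1] with i a b x
        rw [abs_of_nonneg (hsq i x (a x) (b x)).1]; exact (hsq i x (a x) (b x)).2)
    (hlim.mono fun x hx => by simpa using (hx.pow 2).const_sub 1)
  have ht2 := ((ENNReal.tendsto_toReal ENNReal.zero_ne_top).comp ht).mul_const (sob N ^ 2)
  rw [ENNReal.toReal_zero, zero_mul] at ht2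
  filter_upwards [hc, h0, h1, ht2.eventually (eventually_le_nhds hδ)] with i ci c0 c1 hi u hu hv
  have ha' : MemLp (fun x => (1 - χ i x ^ 2) • a x) (ENNReal.ofReal ((N : ℝ) / 2)) volume :=
    ha.of_le ((continuous_const.sub (ci.continuous.pow 2)).aestronglyMeasurable.smul ha.1)
      (ae_of_all _ fun x => by
        have := hsq i x (c0 x) (c1 x)
        rw [norm_smul, Real.norm_eq_abs, abs_of_nonneg this.1]
        exact mul_le_of_le_one_left (norm_nonneg _) this.2)
  have e2 := abs_wform_le _ ha' hu.toHDot hu.toHDot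
  have e3 : wform a ha hu.toHDot hu.toHDot = wform a ha hv.toHDot hv.toHDot +
      wform _ ha' hu.toHDot hu.toHDot := by
    have j1 : ∀ (a : Space N → ℝ) (ha : MemLp a (ENNReal.ofReal ((N : ℝ) / 2)) volume) (u : HDot N),
        Integrable (fun x => a x * u.1 x * u.1 x) volume := fun a ha u =>
      integrable_mul_of_memLp (MemLp.mul_H_S ha (hdot_memLp u)) (hdot_memLp u)
    rw [wform_apply, wform_apply, wform_apply, ← integral_add (j1 a ha _) (j1 _ ha' _)]
    refine integral_congr_ae (ae_of_all _ fun x => ?_)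
    simp only [IsTest.toHDot, smul_eq_mul]
    ring
  rw [e3, dir_self]
  have e4 := (le_abs_self _).trans e2
  refine add_le_add le_rfl (e4.trans ?_)
  rw [← sq]
  exact mul_le_mul_of_nonneg_right hi (sq_nonneg _)

/-- The one-bubble coercivity with `u` replaced by `χ u`, for cutoffs `χ → 1`: the terms carrying
the potential and the functionals are insensitive to the cutoff up to `δ ∫ |∇u|²`, so that only the
Dirichlet form of the localized function is used up. -/
theorem IsNegativeEigenpair.local_coercive (hY : IsNegativeEigenpair N ν Y) (hZ : IsTest Z)
    (hZW : 0 < pairing Z (scalingGenerator (W N))) (hZY : pairing Z Y = 0) :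
    ∃ c : ℝ, 0 < c ∧ c ≤ 1 ∧ ∀ {ι : Type} {l : Filter ι} [l.IsCountablyGenerated]
      {χ : ι → Space N → ℝ}, (∀ᶠ i in l, ContDiff ℝ ∞ (χ i)) → (∀ᶠ i in l, ∀ x, 0 ≤ χ i x) →
      (∀ᶠ i in l, ∀ x, χ i x ≤ 1) → (∀ᵐ x, Tendsto (fun i => χ i x) l (𝓝 1)) →
      (∀ i x y, ‖x‖ = ‖y‖ → χ i x = χ i y) → ∀ δ : ℝ, 0 < δ →
      ∀ᶠ i in l, ∀ (u : Space N → ℝ) (hu : IsTest u) (hv : IsTest fun x => χ i x * u x),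
        (∀ x y, ‖x‖ = ‖y‖ → u x = u y) →
        pexp N * mform hu.toHDot hu.toHDot - 2 * ν ^ 2 * hY.form hu.toHDot ^ 2 -
          lform Z (hZ.memLp _) hu.toHDot ^ 2 ≤
        (1 - c) * dir hv.toHDot hv.toHDot + δ * dir hu.toHDot hu.toHDot := by
  obtain ⟨c, hc, H⟩ := hY.coercive hZ hZW hZY
  refine ⟨min c 1, lt_min hc one_pos, min_le_right _ _, ?_⟩
  intro ι l _ χ ch h0 h1 hlim hr δ hδ
  have hν := hY.nu_pos
  have hp : 0 < pexp N := by linarith [one_lt_pexp hN.out]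
  have E1 := tendsto_wform_error ch h0 h1 hlim (pot_memLp (N := N)) (δ := δ / (3 * pexp N))
    (by positivity)
  have E2 := tendsto_lform_error ch h0 h1 hlim Y hY.memLp_expD (δ := δ / (6 * ν ^ 2))
    (by positivity)
  have E3 := tendsto_lform_error ch h0 h1 hlim Z (hZ.memLp _) (δ := δ / 3) (by positivity)
  filter_upwards [E1, E2, E3] with i e1 e2 e3 u hu hv hur
  have f1 := mul_le_mul_of_nonneg_left (e1 u hu hv) hp.le
  have f2 := mul_le_mul_of_nonneg_left (e2 u hu hv) (by positivity : 0 ≤ 2 * ν ^ 2)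
  have f3 := e3 u hu hv
  have hinv : Inv (hv.toHDot).1 := fun e => ae_of_all _ fun x => by
    simp only [IsTest.toHDot, Function.comp_apply]
    rw [hr i _ x (LinearIsometryEquiv.norm_map _ _), hur _ x (LinearIsometryEquiv.norm_map _ _)]
  have hH := H hv.toHDot hinv
  have hd : 0 ≤ dir hv.toHDot hv.toHDot := by rw [dir_self]; positivity
  have hH2 := mul_le_mul_of_nonneg_right (min_le_left c 1) hd
  rw [qform_apply] at hH
  rw [mul_add] at f1 f2
  have g1 : pexp N * (δ / (3 * pexp N) * dir hu.toHDot hu.toHDot) =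
    δ / 3 * dir hu.toHDot hu.toHDot := by field_simp
  have g2 : 2 * ν ^ 2 * (δ / (6 * ν ^ 2) * dir hu.toHDot hu.toHDot) =
    δ / 3 * dir hu.toHDot hu.toHDot := by field_simp; ring
  rw [g1] at f1
  rw [g2] at f2
  change pexp N * mform _ _ ≤ pexp N * mform _ _ + _ at f1
  change 2 * ν ^ 2 * hY.form _ ^ 2 ≤ 2 * ν ^ 2 * hY.form _ ^ 2 + _ at f2
  linarith only [f1, f2, f3, hH, hH2]

/-- The potential `f'(W_λ)/p` of the bubble at scale `λ`. -/
def potL (N : ℕ) (r : ℝ) (x : Space N) : ℝ := (r ^ 2)⁻¹ * pot N (r⁻¹ • x)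

theorem potL_memLp {r : ℝ} (hr : 0 < r) :
    MemLp (potL N r) (ENNReal.ofReal ((N : ℝ) / 2)) volume :=
  ((MemLp.comp_smul' pot_memLp (inv_ne_zero hr.ne')).const_mul (r ^ 2)⁻¹)

omit hN in
theorem scaleL2_memLp {b : Space N → ℝ} {q : ℝ≥0∞} (hb : MemLp b q volume) {r : ℝ} (hr : 0 < r) :
    MemLp (scaleL2 r b) q volume :=
  ((MemLp.comp_smul' hb (inv_ne_zero hr.ne')).const_mul _)

/-- **Coercivity for two bubbles** at well separated scales, for radial test functions. -/
theorem IsNegativeEigenpair.two_coercive_test (hY : IsNegativeEigenpair N ν Y) (hZ : IsTest Z)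
    (hZW : 0 < pairing Z (scalingGenerator (W N))) (hZY : pairing Z Y = 0) :
    ∃ l₀ : ℝ, 0 < l₀ ∧ ∃ c : ℝ, 0 < c ∧ ∀ l₁ l₂ : ℝ, 0 < l₁ → 0 < l₂ → l₁ / l₂ < l₀ →
      ∀ (g : Space N → ℝ), IsTest g → (∀ x y, ‖x‖ = ‖y‖ → g x = g y) →
      c * (∫ x, ‖gradient g x‖ ^ 2) ≤ (∫ x, ‖gradient g x‖ ^ 2) -
        pexp N * ((∫ x, potL N l₁ x * g x * g x) + ∫ x, potL N l₂ x * g x * g x) +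
        2 * ν ^ 2 * ((l₁⁻¹ * ∫ x, scaleL2 l₁ Y x * g x) ^ 2 +
          (l₂⁻¹ * ∫ x, scaleL2 l₂ Y x * g x) ^ 2) +
        ((l₁⁻¹ * ∫ x, scaleL2 l₁ Z x * g x) ^ 2 + (l₂⁻¹ * ∫ x, scaleL2 l₂ Z x * g x) ^ 2) := by
  obtain ⟨c, hc0, hc1, H⟩ := hY.local_coercive hZ hZW hZY
  -- with these choices the localization error and the two truncation errors use up half of `c`
  set ε : ℝ := √c / 4 with hε
  have hε0 : 0 < ε := by positivity
  have hε2 : 4 * ε ^ 2 = c / 4 := by rw [hε, div_pow, Real.sq_sqrt hc0.le]; ring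
  set δ : ℝ := c / 8
  have hδ : 0 < δ := by positivity
  -- the two cutoffs in the variable of each bubble, as functions of the ratio of the scales
  set χ₁ : ℝ → Space N → ℝ := fun r y => Real.cos (Real.arctan ((r * (‖y‖ ^ 2 + 1)) ^ ε)) with hχ₁
  set χ₂ : ℝ → Space N → ℝ := fun r y =>
    Real.sin (Real.arctan (((‖y‖ ^ 2 + r ^ 2) / r) ^ ε)) with hχ₂
  have d1 : ∀ l₁ l₂ : ℝ, 0 < l₁ → 0 < l₂ →
      χ₁ (l₁ / l₂) = fun y => Real.cos (cutAngle ε l₁ l₂ (l₁ • y)) := fun l₁ l₂ h1 h2 => by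
    funext y; rw [cutAngle_smul_left ε h1 h2]
  have d2 : ∀ l₁ l₂ : ℝ, 0 < l₁ → 0 < l₂ →
      χ₂ (l₁ / l₂) = fun y => Real.sin (cutAngle ε l₁ l₂ (l₂ • y)) := fun l₁ l₂ h1 h2 => by
    funext y; rw [cutAngle_smul_right ε h1 h2]
  have hpos : ∀ᶠ r : ℝ in 𝓝[>] 0, 0 < r := self_mem_nhdsWithin
  have hnh : Tendsto (fun r : ℝ => r) (𝓝[>] 0) (𝓝 0) := nhdsWithin_le_nhds
  have E1 := H (l := 𝓝[>] (0 : ℝ)) (χ := χ₁)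
    (by filter_upwards [hpos] with r hr
        have := d1 r 1 hr one_pos
        rw [div_one] at this
        rw [this]
        exact Real.contDiff_cos.comp
          ((cutAngle_contDiff ε hr one_pos).comp (contDiff_const_smul r)))
    (by filter_upwards [hpos] with r hr x
        have := d1 r 1 hr one_pos
        rw [div_one] at this
        rw [this]
        exact (cos_sin_cutAngle_nonneg ε r 1 _ hr one_pos).1)
    (Eventually.of_forall fun r x => Real.cos_le_one _)
    (ae_of_all _ fun x => by
      have t : Tendsto (fun r : ℝ => (r * (‖x‖ ^ 2 + 1)) ^ ε) (𝓝[>] 0) (𝓝 0) := by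
        have := (hnh.mul_const (‖x‖ ^ 2 + 1)).rpow_const (p := ε) (Or.inr hε0.le)
        rwa [zero_mul, Real.zero_rpow hε0.ne'] at this
      have t2 := (Real.continuous_cos.comp Real.continuous_arctan).tendsto 0 |>.comp t
      simp only [Function.comp_apply, Real.arctan_zero, Real.cos_zero] at t2
      exact t2)
    (fun r x y hxy => by simp only [hχ₁, hxy]) δ hδ
  have hne : ∀ᵐ x : Space N, x ≠ 0 := by
    have : Nonempty (Fin N) := ⟨⟨0, by have := hN.out; omega⟩⟩
    exact Measure.ae_ne volume 0
  have E2 := H (l := 𝓝[>] (0 : ℝ)) (χ := χ₂)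
    (by filter_upwards [hpos] with r hr
        have := d2 r 1 hr one_pos
        rw [div_one] at this
        rw [this]
        exact Real.contDiff_sin.comp
          ((cutAngle_contDiff ε hr one_pos).comp (contDiff_const_smul _)))
    (by filter_upwards [hpos] with r hr x
        have := d2 r 1 hr one_pos
        rw [div_one] at this
        rw [this]
        exact (cos_sin_cutAngle_nonneg ε r 1 _ hr one_pos).2)
    (Eventually.of_forall fun r x => Real.sin_le_one _)
    (hne.mono fun x hx => by
      have hx0 : 0 < ‖x‖ ^ 2 := by positivity
      have t : Tendsto (fun r : ℝ => (‖x‖ ^ 2 + r ^ 2) / r) (𝓝[>] 0) atTop := by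
        have a1 : Tendsto (fun r : ℝ => ‖x‖ ^ 2 + r ^ 2) (𝓝[>] 0) (𝓝 (‖x‖ ^ 2)) := by
          have := (hnh.pow 2).const_add (‖x‖ ^ 2)
          simpa using this
        exact a1.pos_mul_atTop hx0 tendsto_inv_nhdsGT_zero
      have t1 := (tendsto_rpow_atTop hε0).comp t
      have t2 := (tendsto_nhds_of_tendsto_nhdsWithin Real.tendsto_arctan_atTop).comp t1
      have t3 := (Real.continuous_sin.tendsto (Real.pi / 2)).comp t2
      rw [Real.sin_pi_div_two] at t3
      exact t3)
    (fun r x y hxy => by simp only [hχ₂, hxy]) δ hδ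
  obtain ⟨l₀, hl₀, hE⟩ := mem_nhdsGT_iff_exists_Ioo_subset.1 (E1.and E2)
  refine ⟨l₀, hl₀, c / 2, by positivity, fun l₁ l₂ h1 h2 h12 g hg hgr => ?_⟩
  obtain ⟨e1, e2⟩ := hE ⟨div_pos h1 h2, h12⟩
  have hθ := cutAngle_contDiff (N := N) ε h1 h2
  have v1 : (fun x => χ₁ (l₁ / l₂) x * unscale l₁ g x) =
      unscale l₁ fun x => Real.cos (cutAngle ε l₁ l₂ x) * g x := by
    rw [d1 l₁ l₂ h1 h2]
    funext x
    simp only [unscale]; ring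
  have v2 : (fun x => χ₂ (l₁ / l₂) x * unscale l₂ g x) =
      unscale l₂ fun x => Real.sin (cutAngle ε l₁ l₂ x) * g x := by
    rw [d2 l₁ l₂ h1 h2]
    funext x
    simp only [unscale]; ring
  have t1 : IsTest fun x => χ₁ (l₁ / l₂) x * unscale l₁ g x := by
    rw [v1]; exact (hg.cos_mul hθ).unscale h1
  have t2 : IsTest fun x => χ₂ (l₁ / l₂) x * unscale l₂ g x := by
    rw [v2]; exact (hg.sin_mul hθ).unscale h2
  have hrad : ∀ r : ℝ, ∀ x y : Space N, ‖x‖ = ‖y‖ → unscale r g x = unscale r g y :=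
    fun r x y hxy => by
      simp only [unscale]
      rw [hgr (r • x) (r • y) (by rw [norm_smul, norm_smul, hxy])]
  have f1 := e1 _ (hg.unscale h1) t1 (hrad l₁)
  have f2 := e2 _ (hg.unscale h2) t2 (hrad l₂)
  have D : ∀ (φ : Space N → ℝ) (h : IsTest φ), dir h.toHDot h.toHDot = ∫ x, ‖gradient φ x‖ ^ 2 :=
    fun φ h => dir_self_eq_integral_of (gradLp_ae_of_contDiff _ h.1)
  have M : ∀ r (hr : 0 < r), mform (hg.unscale hr).toHDot (hg.unscale hr).toHDot =
      ∫ x, potL N r x * g x * g x := fun r hr => integral_mul_unscale_sq (pot N) g hr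
  have LY : ∀ r (hr : 0 < r), hY.form (hg.unscale hr).toHDot = r⁻¹ * ∫ x, scaleL2 r Y x * g x :=
    fun r hr => integral_mul_unscale Y g hr
  have LZ : ∀ r (hr : 0 < r), lform Z (hZ.memLp _) (hg.unscale hr).toHDot =
      r⁻¹ * ∫ x, scaleL2 r Z x * g x := fun r hr => integral_mul_unscale Z g hr
  rw [D, D, M l₁ h1, LY l₁ h1, LZ l₁ h1, v1, integral_gradient_unscale (hg.cos_mul hθ) h1,
    integral_gradient_unscale hg h1] at f1
  rw [D, D, M l₂ h2, LY l₂ h2, LZ l₂ h2, v2, integral_gradient_unscale (hg.sin_mul hθ) h2,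
    integral_gradient_unscale hg h2] at f2
  -- summing the two local estimates, only the localization error remains
  have hloc := localization_le hN.out hε0 h1 h2 hg
  rw [hε2] at hloc
  set D0 := ∫ x, ‖gradient g x‖ ^ 2
  have hD0 : 0 ≤ D0 := integral_nonneg fun x => by positivity
  have hl2 := mul_le_mul_of_nonneg_left hloc (by linarith : 0 ≤ 1 - c)
  have hl3 : (1 - c) * ((1 + c / 4) * D0) ≤ (1 - c + c / 4) * D0 := by
    rw [← mul_assoc]
    refine mul_le_mul_of_nonneg_right ?_ hD0
    nlinarith
  have hδ2 : δ * D0 = c / 8 * D0 := rfl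
  linarith only [f1, f2, hl2, hl3, hδ2]

/-- Continuity of a bilinear form on `Ḣ¹`. -/
def Bdd (B : HDot N →ₗ[ℝ] HDot N →ₗ[ℝ] ℝ) : Prop :=
  ∃ C : ℝ, ∀ u v, |B u v| ≤ C * (‖gradLp u‖ * ‖gradLp v‖)

omit hN in
theorem Bdd.add {A B : HDot N →ₗ[ℝ] HDot N →ₗ[ℝ] ℝ} (hA : Bdd A) (hB : Bdd B) : Bdd (A + B) := by
  obtain ⟨C, hC⟩ := hA
  obtain ⟨D, hD⟩ := hB
  refine ⟨C + D, fun u v => ?_⟩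
  rw [LinearMap.add_apply, LinearMap.add_apply, add_mul]
  exact (abs_add_le _ _).trans (add_le_add (hC u v) (hD u v))

omit hN in
theorem Bdd.smul {B : HDot N →ₗ[ℝ] HDot N →ₗ[ℝ] ℝ} (c : ℝ) (hB : Bdd B) : Bdd (c • B) := by
  obtain ⟨D, hD⟩ := hB
  refine ⟨|c| * D, fun u v => ?_⟩
  rw [LinearMap.smul_apply, LinearMap.smul_apply, smul_eq_mul, abs_mul, mul_assoc]
  exact mul_le_mul_of_nonneg_left (hD u v) (abs_nonneg c)

omit hN in
theorem bdd_dir : Bdd (dir (N := N)) := ⟨1, fun u v => by simpa using abs_dir_le u v⟩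

theorem bdd_wform (a : Space N → ℝ) (ha) : Bdd (wform a ha) := ⟨_, abs_wform_le a ha⟩

/-- The square of a linear functional, as a bilinear form. -/
def tensorSq (φ : HDot N →ₗ[ℝ] ℝ) : HDot N →ₗ[ℝ] HDot N →ₗ[ℝ] ℝ :=
  (LinearMap.mul ℝ ℝ).compl₁₂ φ φ

omit hN in
theorem tensorSq_apply (φ : HDot N →ₗ[ℝ] ℝ) (u v : HDot N) : tensorSq φ u v = φ u * φ v := rfl

theorem bdd_tensorSq_lform (b : Space N → ℝ) (hb) : Bdd (tensorSq (lform b hb)) := by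
  have h := abs_lform_le b hb
  set K := (eLpNorm b (ENNReal.ofReal (expD N)) volume).toReal * sob N
  have hK : 0 ≤ K := mul_nonneg ENNReal.toReal_nonneg sob_pos.le
  refine ⟨K * K, fun u v => ?_⟩
  rw [tensorSq_apply, abs_mul]
  calc _ ≤ (K * ‖gradLp u‖) * (K * ‖gradLp v‖) :=
        mul_le_mul (h u) (h v) (abs_nonneg _) (by positivity)
    _ = _ := by ring

/-- **Coercivity for two bubbles** at well separated scales, on radial functions. -/
theorem IsNegativeEigenpair.two_coercive (hY : IsNegativeEigenpair N ν Y) (hZ : IsTest Z)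
    (hZW : 0 < pairing Z (scalingGenerator (W N))) (hZY : pairing Z Y = 0) :
    ∃ l₀ : ℝ, 0 < l₀ ∧ ∃ c : ℝ, 0 < c ∧ ∀ l₁ l₂ : ℝ, 0 < l₁ → 0 < l₂ → l₁ / l₂ < l₀ →
      ∀ g : HDot N, Inv g.1 →
      c * dir g g ≤ dir g g -
        pexp N * ((∫ x, potL N l₁ x * g.1 x * g.1 x) + ∫ x, potL N l₂ x * g.1 x * g.1 x) +
        2 * ν ^ 2 * ((l₁⁻¹ * ∫ x, scaleL2 l₁ Y x * g.1 x) ^ 2 +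
          (l₂⁻¹ * ∫ x, scaleL2 l₂ Y x * g.1 x) ^ 2) +
        ((l₁⁻¹ * ∫ x, scaleL2 l₁ Z x * g.1 x) ^ 2 + (l₂⁻¹ * ∫ x, scaleL2 l₂ Z x * g.1 x) ^ 2) := by
  obtain ⟨l₀, hl₀, c, hc, H⟩ := hY.two_coercive_test hZ hZW hZY
  refine ⟨l₀, hl₀, c, hc, fun l₁ l₂ h1 h2 h12 g hg => ?_⟩
  -- both sides are continuous quadratic forms of `g`, so radial test functions suffice
  have hY1 := scaleL2_memLp hY.memLp_expD h1
  have hY2 := scaleL2_memLp hY.memLp_expD h2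
  have hZ1 := scaleL2_memLp (hZ.memLp (ENNReal.ofReal (expD N))) h1
  have hZ2 := scaleL2_memLp (hZ.memLp (ENNReal.ofReal (expD N))) h2
  set B : HDot N →ₗ[ℝ] HDot N →ₗ[ℝ] ℝ := (1 - c) • dir +
    (-pexp N) • (wform _ (potL_memLp h1) + wform _ (potL_memLp h2)) +
    (2 * ν ^ 2 * (l₁⁻¹) ^ 2) • tensorSq (lform _ hY1) +
    (2 * ν ^ 2 * (l₂⁻¹) ^ 2) • tensorSq (lform _ hY2) +
    ((l₁⁻¹) ^ 2) • tensorSq (lform _ hZ1) + ((l₂⁻¹) ^ 2) • tensorSq (lform _ hZ2) with hB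
  have hBb : Bdd B := (((((bdd_dir.smul _).add (((bdd_wform _ _).add (bdd_wform _ _)).smul _)).add
    ((bdd_tensorSq_lform _ _).smul _)).add ((bdd_tensorSq_lform _ _).smul _)).add
    ((bdd_tensorSq_lform _ _).smul _)).add ((bdd_tensorSq_lform _ _).smul _)
  have hBa : ∀ u : HDot N, B u u = (1 - c) * dir u u -
        pexp N * ((∫ x, potL N l₁ x * u.1 x * u.1 x) + ∫ x, potL N l₂ x * u.1 x * u.1 x) +
        2 * ν ^ 2 * ((l₁⁻¹ * ∫ x, scaleL2 l₁ Y x * u.1 x) ^ 2 +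
          (l₂⁻¹ * ∫ x, scaleL2 l₂ Y x * u.1 x) ^ 2) +
        ((l₁⁻¹ * ∫ x, scaleL2 l₁ Z x * u.1 x) ^ 2 + (l₂⁻¹ * ∫ x, scaleL2 l₂ Z x * u.1 x) ^ 2) :=
    fun u => by
      simp only [hB, LinearMap.add_apply, LinearMap.smul_apply, smul_eq_mul, tensorSq_apply,
        lform_apply, wform_apply]
      ring
  obtain ⟨C, hC⟩ := hBb
  have key := nonneg_of_radial_test hC (fun φ hφ hr => ?_) g hg
  · rw [hBa] at key
    linarith only [key]
  · have := H l₁ l₂ h1 h2 h12 φ hφ hr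
    rw [hBa, dir_self_eq_integral_of (gradLp_ae_of_contDiff _ hφ.1)]
    simp only [IsTest.toHDot]
    linarith only [this]

/-- The interaction with a bubble is controlled by the `Ḣ¹` norm, uniformly in the scale. -/
theorem exists_integral_potL_le : ∃ C : ℝ, 0 ≤ C ∧ ∀ r : ℝ, 0 < r → ∀ g : HDot N, Inv g.1 →
    ∫ x, potL N r x * g.1 x * g.1 x ≤ C * dir g g := by
  obtain ⟨C, hC0, hC⟩ := exists_abs_mform_le (N := N)
  refine ⟨C, hC0, fun r hr g hg => ?_⟩
  obtain ⟨K, hK⟩ := (bdd_dir (N := N).smul C).add ((bdd_wform _ (potL_memLp (N := N) hr)).smul (-1))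
  have key := nonneg_of_radial_test hK (fun φ hφ _ => ?_) g hg
  · simp only [LinearMap.add_apply, LinearMap.smul_apply, smul_eq_mul, wform_apply] at key
    linarith
  · have h := (le_abs_self _).trans (hC (hφ.unscale hr).toHDot (hφ.unscale hr).toHDot)
    rw [← sq, ← dir_self, dir_self_eq_integral_of (gradLp_ae_of_contDiff _ (hφ.unscale hr).1)] at h
    have e1 : mform (hφ.unscale hr).toHDot (hφ.unscale hr).toHDot =
      ∫ x, potL N r x * φ x * φ x := integral_mul_unscale_sq (pot N) φ hr
    have e2 := integral_gradient_unscale hφ hr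
    simp only [IsTest.toHDot] at h e1
    rw [e1, e2] at h
    simp only [LinearMap.add_apply, LinearMap.smul_apply, smul_eq_mul, wform_apply]
    rw [dir_self_eq_integral_of (gradLp_ae_of_contDiff _ hφ.1)]
    simp only [IsTest.toHDot]
    linarith

end local_coercive

/-! ### The Hessian of the energy -/

section hess
variable [hN : Fact (3 ≤ N)]

/-- The exponent `4/(N-2)`. -/
def qexp (N : ℕ) : ℝ := 4 / ((N : ℝ) - 2)

theorem qexp_pos : 0 < qexp N := by
  have h := three_le_cast (N := N)
  exact div_pos (by norm_num) (by linarith)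

theorem qexp_add_one : qexp N + 1 = pexp N := by
  have h := three_le_cast (N := N)
  have h2 : (N : ℝ) - 2 ≠ 0 := by linarith
  rw [qexp, pexp]; field_simp; ring

theorem qexp_add_two : qexp N + 2 = expS N := by
  have h := three_le_cast (N := N)
  have h2 : (N : ℝ) - 2 ≠ 0 := by linarith
  rw [qexp, expS]; field_simp; ring

omit hN in
theorem nonlin_eq (u : ℝ) : nonlin N u = |u| ^ qexp N * u := rfl

theorem hasDerivAt_potential (u : ℝ) : HasDerivAt (potential N) (nonlin N u) u := by
  have h := three_le_cast (N := N)
  have h2 : (N : ℝ) - 2 ≠ 0 := by linarith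
  have h0 : (N : ℝ) ≠ 0 := by linarith
  have hd := (hasDerivAt_abs_rpow u (p := expS N) (by linarith [two_lt_expS hN.out])).const_mul
    (((N : ℝ) - 2) / (2 * N))
  have e : ((N : ℝ) - 2) / (2 * N) * (expS N * |u| ^ (expS N - 2) * u) = nonlin N u := by
    rw [nonlin_eq, ← qexp_add_two, add_sub_cancel_right, qexp_add_two, expS]
    field_simp
  rw [e] at hd
  exact hd

theorem hasDerivAt_nonlin (u : ℝ) : HasDerivAt (nonlin N) (pexp N * |u| ^ qexp N) u := by
  have hq := qexp_pos (N := N)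
  have hp : ∀ v : ℝ, 0 < v → HasDerivAt (nonlin N) (pexp N * |v| ^ qexp N) v := fun v hv => by
    have hd := Real.hasDerivAt_rpow_const (x := v) (p := pexp N) (Or.inl hv.ne')
    rw [← qexp_add_one, add_sub_cancel_right, qexp_add_one] at hd
    rw [abs_of_pos hv]
    refine hd.congr_of_eventuallyEq ?_
    filter_upwards [lt_mem_nhds hv] with w hw
    rw [nonlin_eq, abs_of_pos hw, ← qexp_add_one, Real.rpow_add_one hw.ne']
  have hodd : ∀ v : ℝ, nonlin N (-v) = -nonlin N v := fun v => by
    rw [nonlin_eq, nonlin_eq, abs_neg]; ring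
  rcases lt_trichotomy u 0 with hu | hu | hu
  · have h1 := (hp (-u) (by linarith)).comp u (hasDerivAt_neg u)
    have h2 := h1.neg
    rw [abs_neg] at h2
    refine (h2.congr_of_eventuallyEq (Eventually.of_forall fun v => ?_)).congr_deriv (by ring)
    simp only [Pi.neg_apply, Function.comp_apply, hodd, neg_neg]
  · subst hu
    rw [abs_zero, Real.zero_rpow hq.ne', mul_zero, hasDerivAt_iff_tendsto_slope]
    have hc : Continuous fun v : ℝ => |v| ^ qexp N :=
      continuous_abs.rpow_const fun _ => Or.inr hq.le
    have ht := hc.tendsto 0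
    simp only [abs_zero, Real.zero_rpow hq.ne'] at ht
    refine (ht.mono_left (nhdsWithin_le_nhds (s := {0}ᶜ))).congr' ?_
    filter_upwards [self_mem_nhdsWithin] with v hv
    have hv0 : v ≠ 0 := hv
    rw [slope_def_field, nonlin_eq, nonlin_eq]
    field_simp
    ring
  · exact hp u hu

theorem continuous_potential : Continuous (potential N) :=
  continuous_iff_continuousAt.2 fun u => (hasDerivAt_potential u).continuousAt

theorem continuous_nonlin : Continuous (nonlin N) :=
  continuous_iff_continuousAt.2 fun u => (hasDerivAt_nonlin u).continuousAt

theorem continuous_abs_rpow : Continuous fun v : ℝ => |v| ^ qexp N :=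
  continuous_abs.rpow_const fun _ => Or.inr qexp_pos.le

theorem rpow_mul_self_mul_self {w : ℝ} (hw : 0 ≤ w) : w ^ qexp N * w * w = w ^ expS N := by
  rw [← qexp_add_two, Real.rpow_add_of_nonneg hw qexp_pos.le (by norm_num), Real.rpow_two]
  ring

theorem integrable_abs_rpow_expS {u : Space N → ℝ} (hu : MemLp u (ENNReal.ofReal (expS N)) volume) :
    Integrable (fun x => |u x| ^ expS N) volume := by
  have hS : 0 < expS N := by linarith [two_lt_expS hN.out]
  have := hu.integrable_norm_rpow (by simpa using hS) ENNReal.ofReal_ne_top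
  rw [ENNReal.toReal_ofReal hS.le] at this
  exact this

section deriv
variable {u g : Space N → ℝ} (hu : MemLp u (ENNReal.ofReal (expS N)) volume)
  (hg : MemLp g (ENNReal.ofReal (expS N)) volume)
include hu hg

theorem integrable_dominant : Integrable (fun x => (|u x| + |g x|) ^ expS N) volume := by
  have h := integrable_abs_rpow_expS (hu.abs.add hg.abs)
  refine h.congr (ae_of_all _ fun x => ?_)
  have e : (|u| + |g|) x = |u x| + |g x| := rfl
  simp only [e]
  rw [abs_of_nonneg (by positivity)]

omit hN hu hg in
theorem abs_add_mul_le {t : ℝ} (ht : t ∈ Metric.ball (0 : ℝ) 1) (x : Space N) :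
    |u x + t * g x| ≤ |u x| + |g x| := by
  rw [Metric.mem_ball, dist_zero_right, Real.norm_eq_abs] at ht
  refine (abs_add_le _ _).trans (add_le_add le_rfl ?_)
  rw [abs_mul]
  exact mul_le_of_le_one_left (abs_nonneg _) ht.le

theorem hasDerivAt_integral_potential {t : ℝ} (ht : t ∈ Metric.ball (0 : ℝ) 1) :
    HasDerivAt (fun t => ∫ x, potential N (u x + t * g x))
      (∫ x, nonlin N (u x + t * g x) * g x) t := by
  have hm : ∀ t : ℝ, AEStronglyMeasurable (fun x => u x + t * g x) volume := fun t =>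
    hu.1.add (hg.1.const_mul t)
  have hi : Integrable (fun x => potential N (u x + t * g x)) volume :=
    (integrable_abs_rpow_expS (hu.add (hg.const_mul t))).const_mul _
  refine (hasDerivAt_integral_of_dominated_loc_of_deriv_le (μ := volume)
    (F := fun t x => potential N (u x + t * g x))
    (F' := fun t x => nonlin N (u x + t * g x) * g x) (Metric.isOpen_ball.mem_nhds ht)
    (Eventually.of_forall fun t => continuous_potential.comp_aestronglyMeasurable (hm t)) hi
    ((continuous_nonlin.comp_aestronglyMeasurable (hm t)).mul hg.1)
    (bound := fun x => (|u x| + |g x|) ^ expS N) (ae_of_all _ fun x s hs => ?_)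
    (integrable_dominant hu hg) (ae_of_all _ fun x s hs => ?_)).2
  · have h := abs_add_mul_le (u := u) (g := g) hs x
    set w := |u x| + |g x|
    have hw : 0 ≤ w := by positivity
    have hgw : |g x| ≤ w := by simp only [w]; linarith [abs_nonneg (u x)]
    have hq := qexp_pos (N := N)
    rw [Real.norm_eq_abs, abs_mul, nonlin_eq, abs_mul,
      abs_of_nonneg (Real.rpow_nonneg (abs_nonneg _) _), ← rpow_mul_self_mul_self hw]
    gcongr
  · have h1 : HasDerivAt (fun t => u x + t * g x) (g x) s := by
      simpa using ((hasDerivAt_id s).mul_const (g x)).const_add (u x)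
    exact HasDerivAt.comp (h₂ := potential N) s (hasDerivAt_potential (u x + s * g x)) h1

theorem hasDerivAt_integral_nonlin :
    HasDerivAt (fun t => ∫ x, nonlin N (u x + t * g x) * g x)
      (∫ x, pexp N * |u x| ^ qexp N * g x * g x) 0 := by
  have hm : ∀ t : ℝ, AEStronglyMeasurable (fun x => u x + t * g x) volume := fun t =>
    hu.1.add (hg.1.const_mul t)
  have hp : 0 < pexp N := by linarith [one_lt_pexp hN.out]
  have h0 : (0 : ℝ) ∈ Metric.ball (0 : ℝ) 1 := Metric.mem_ball_self one_pos
  have hi : Integrable (fun x => nonlin N (u x + 0 * g x) * g x) volume := by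
    refine (integrable_dominant hu hg).mono'
      (((continuous_nonlin (N := N)).comp_aestronglyMeasurable (hm 0)).mul hg.1)
      (ae_of_all _ fun x => ?_)
    have h := abs_add_mul_le (u := u) (g := g) h0 x
    set w := |u x| + |g x|
    have hw : 0 ≤ w := by positivity
    have hgw : |g x| ≤ w := by simp only [w]; linarith [abs_nonneg (u x)]
    have hq := qexp_pos (N := N)
    rw [Real.norm_eq_abs, abs_mul, nonlin_eq, abs_mul,
      abs_of_nonneg (Real.rpow_nonneg (abs_nonneg _) _), ← rpow_mul_self_mul_self hw]
    gcongr
  have key := (hasDerivAt_integral_of_dominated_loc_of_deriv_le (μ := volume)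
    (F := fun t x => nonlin N (u x + t * g x) * g x)
    (F' := fun t x => pexp N * |u x + t * g x| ^ qexp N * g x * g x)
    (Metric.isOpen_ball.mem_nhds h0)
    (Eventually.of_forall fun t =>
      ((continuous_nonlin (N := N)).comp_aestronglyMeasurable (hm t)).mul hg.1) hi
    (((((continuous_abs_rpow (N := N)).comp_aestronglyMeasurable (hm 0)).const_mul (pexp N)).mul
      hg.1).mul hg.1)
    (bound := fun x => pexp N * (|u x| + |g x|) ^ expS N) (ae_of_all _ fun x s hs => ?_)
    ((integrable_dominant hu hg).const_mul _) (ae_of_all _ fun x s hs => ?_)).2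
  · simpa only [zero_mul, add_zero] using key
  · have h := abs_add_mul_le (u := u) (g := g) hs x
    set w := |u x| + |g x|
    have hw : 0 ≤ w := by positivity
    have hgw : |g x| ≤ w := by simp only [w]; linarith [abs_nonneg (u x)]
    have hq := qexp_pos (N := N)
    rw [Real.norm_eq_abs, abs_mul, abs_mul, abs_mul, abs_of_pos hp,
      abs_of_nonneg (Real.rpow_nonneg (abs_nonneg _) _), ← rpow_mul_self_mul_self hw, mul_assoc,
      mul_assoc, mul_assoc (w ^ qexp N)]
    gcongr
  · have h1 : HasDerivAt (fun t => u x + t * g x) (g x) s := by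
      simpa using ((hasDerivAt_id s).mul_const (g x)).const_add (u x)
    have h2 := ((hasDerivAt_nonlin (N := N) (u x + s * g x)).comp s h1).mul_const (g x)
    exact h2

end deriv

/-- The Hessian quadratic form of the energy. -/
theorem hessian_eq {U g : Pair N} (hU1 : MemHDot1 U.1) (hU2 : MemLp U.2 2 volume)
    (hg1 : MemHDot1 g.1) (hg2 : MemLp g.2 2 volume) :
    hessian U g = (∫ x, g.2 x ^ 2) + (∫ x, ‖weakGradient g.1 x‖ ^ 2) -
      ∫ x, pexp N * |U.1 x| ^ qexp N * g.1 x * g.1 x := by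
  have hS1 : MemLp U.1 (ENNReal.ofReal (expS N)) volume := hU1.1
  have hS2 : MemLp g.1 (ENNReal.ofReal (expS N)) volume := hg1.1
  have hGU := hU1.memLp_weakGradient
  have hGg := hg1.memLp_weakGradient
  set A : ℝ := ∫ x, (1 / 2 * U.2 x ^ 2 + 1 / 2 * ‖weakGradient U.1 x‖ ^ 2) with hA
  set B : ℝ := ∫ x, (U.2 x * g.2 x + inner ℝ (weakGradient U.1 x) (weakGradient g.1 x)) with hB
  set C : ℝ := (∫ x, g.2 x ^ 2) + ∫ x, ‖weakGradient g.1 x‖ ^ 2 with hC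
  have iA : Integrable (fun x => 1 / 2 * U.2 x ^ 2 + 1 / 2 * ‖weakGradient U.1 x‖ ^ 2) volume :=
    (hU2.integrable_sq.const_mul _).add (hGU.norm.integrable_sq.const_mul _)
  have iB : Integrable (fun x => U.2 x * g.2 x +
      inner ℝ (weakGradient U.1 x) (weakGradient g.1 x)) volume :=
    (hU2.integrable_mul hg2).add (integrable_inner_of_memLp hGU hGg)
  have iC : Integrable (fun x => g.2 x ^ 2 + ‖weakGradient g.1 x‖ ^ 2) volume :=
    hg2.integrable_sq.add hGg.norm.integrable_sq
  -- the energy along the line is quadratic in `t`, apart from the potential term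
  have hE : ∀ t : ℝ, energy (U + t • g) =
      A + t * B + t ^ 2 / 2 * C - ∫ x, potential N (U.1 x + t * g.1 x) := fun t => by
    have iP : Integrable (fun x => potential N (U.1 x + t * g.1 x)) volume :=
      (integrable_abs_rpow_expS (hS1.add (hS2.const_mul t))).const_mul _
    have hw : weakGradient (U + t • g).1 =ᵐ[volume]
        fun x => weakGradient U.1 x + t • weakGradient g.1 x :=
      weakGradient_eq (hU1.hasWeakGradient.add (hg1.hasWeakGradient.smul t))
    rw [hC, ← integral_add hg2.integrable_sq hGg.norm.integrable_sq, hA, hB, ← integral_const_mul,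
      ← integral_const_mul, ← integral_add iA (iB.const_mul t)]
    have hAB : Integrable (fun x => 1 / 2 * U.2 x ^ 2 + 1 / 2 * ‖weakGradient U.1 x‖ ^ 2 +
      t * (U.2 x * g.2 x + inner ℝ (weakGradient U.1 x) (weakGradient g.1 x))) volume :=
      iA.add (iB.const_mul t)
    rw [← integral_add hAB (iC.const_mul _)]
    have hABC : Integrable (fun x => 1 / 2 * U.2 x ^ 2 + 1 / 2 * ‖weakGradient U.1 x‖ ^ 2 +
      t * (U.2 x * g.2 x + inner ℝ (weakGradient U.1 x) (weakGradient g.1 x)) +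
      t ^ 2 / 2 * (g.2 x ^ 2 + ‖weakGradient g.1 x‖ ^ 2)) volume := hAB.add (iC.const_mul _)
    rw [← integral_sub hABC iP, energy]
    refine integral_congr_ae ?_
    filter_upwards [hw] with x hx
    rw [hx]
    simp only [Prod.fst_add, Prod.snd_add, Prod.smul_fst, Prod.smul_snd, Pi.add_apply,
      Pi.smul_apply, smul_eq_mul]
    rw [norm_add_sq_real, inner_smul_right, norm_smul, mul_pow, Real.norm_eq_abs, sq_abs]
    ring
  have hd1 : ∀ t ∈ Metric.ball (0 : ℝ) 1, HasDerivAt (fun t => energy (U + t • g))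
      (B + t * C - ∫ x, nonlin N (U.1 x + t * g.1 x) * g.1 x) t := fun t ht => by
    have h1 : HasDerivAt (fun t : ℝ => A + t * B + t ^ 2 / 2 * C) (B + t * C) t := by
      have a := ((hasDerivAt_id t).mul_const B).const_add A
      have b := ((hasDerivAt_pow 2 t).div_const 2).mul_const C
      refine (a.add b).congr_deriv ?_
      norm_num
    have h2 := h1.sub (hasDerivAt_integral_potential hS1 hS2 ht)
    refine h2.congr_of_eventuallyEq (Eventually.of_forall fun s => ?_)
    exact hE s
  have hd2 : deriv (fun t => energy (U + t • g)) =ᶠ[𝓝 0]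
      fun t => B + t * C - ∫ x, nonlin N (U.1 x + t * g.1 x) * g.1 x := by
    filter_upwards [Metric.ball_mem_nhds (0 : ℝ) one_pos] with t ht
    exact (hd1 t ht).deriv
  have hd3 : HasDerivAt (fun t : ℝ => B + t * C - ∫ x, nonlin N (U.1 x + t * g.1 x) * g.1 x)
      (C - ∫ x, pexp N * |U.1 x| ^ qexp N * g.1 x * g.1 x) 0 := by
    have a := ((hasDerivAt_id (0 : ℝ)).mul_const C).const_add B
    refine (a.sub (hasDerivAt_integral_nonlin hS1 hS2)).congr_deriv ?_
    rw [one_mul]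
  rw [hessian, iteratedDeriv_succ, iteratedDeriv_one, hd2.deriv_eq, hd3.deriv]

/-! ### Perturbation of the potential -/

/-- For every `δ > 0`, `|a+b|^q ≤ (1+δ)|a|^q + C |b|^q`. -/
theorem exists_abs_add_rpow_le {q : ℝ} (hq : 0 < q) {δ : ℝ} (hδ : 0 < δ) : ∃ C : ℝ, 0 ≤ C ∧
    ∀ a b : ℝ, |a + b| ^ q ≤ (1 + δ) * |a| ^ q + C * |b| ^ q := by
  obtain ⟨k, hk0, hk⟩ : ∃ k : ℝ, 0 < k ∧ (1 + k) ^ q ≤ 1 + δ := by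
    have hc : Tendsto (fun k : ℝ => (1 + k) ^ q) (𝓝[>] 0) (𝓝 1) := by
      have h1 : Tendsto (fun k : ℝ => 1 + k) (𝓝[>] 0) (𝓝 (1 + 0)) :=
        (tendsto_id.mono_left nhdsWithin_le_nhds).const_add 1
      simpa using h1.rpow_const (p := q) (Or.inr hq.le)
    have := (hc.eventually (eventually_le_nhds (by linarith : (1 : ℝ) < 1 + δ))).and
      self_mem_nhdsWithin
    obtain ⟨k, h1, h2⟩ := this.exists
    exact ⟨k, h2, h1⟩
  refine ⟨(1 + 1 / k) ^ q, by positivity, fun a b => ?_⟩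
  have hab := abs_add_le a b
  have ha := abs_nonneg a
  have hb := abs_nonneg b
  by_cases h : |b| ≤ k * |a|
  · have h1 : |a + b| ≤ (1 + k) * |a| := by linarith
    calc |a + b| ^ q ≤ ((1 + k) * |a|) ^ q := by gcongr
      _ = (1 + k) ^ q * |a| ^ q := Real.mul_rpow (by positivity) ha
      _ ≤ (1 + δ) * |a| ^ q := by gcongr
      _ ≤ _ := le_add_of_nonneg_right (by positivity)
  · have h1 : |a + b| ≤ (1 + 1 / k) * |b| := by
      have : |a| ≤ 1 / k * |b| := by
        rw [one_div, ← div_eq_inv_mul, le_div_iff₀ hk0]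
        linarith
      linarith
    calc |a + b| ^ q ≤ ((1 + 1 / k) * |b|) ^ q := by gcongr
      _ = (1 + 1 / k) ^ q * |b| ^ q := Real.mul_rpow (by positivity) hb
      _ ≤ _ := le_add_of_nonneg_left (by positivity)

theorem abs_sub_rpow_le {q : ℝ} (hq : 0 < q) {a b : ℝ} (ha : 0 ≤ a) (hb : 0 ≤ b) :
    |a - b| ^ q ≤ a ^ q + b ^ q := by
  have h1 := Real.rpow_nonneg ha q
  have h2 := Real.rpow_nonneg hb q
  rcases le_total a b with h | h
  · have : |a - b| ≤ b := by rw [abs_of_nonpos (by linarith)]; linarith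
    have := Real.rpow_le_rpow (abs_nonneg _) this hq.le
    linarith
  · have : |a - b| ≤ a := by rw [abs_of_nonneg (by linarith)]; linarith
    have := Real.rpow_le_rpow (abs_nonneg _) this hq.le
    linarith

/-- Weights `|d|^{4/(N-2)}` with `d ∈ L^{2*}` lie in `L^{N/2}`, with the expected norm. -/
theorem abs_rpow_qexp_memLp {d : Space N → ℝ} (hd : MemLp d (ENNReal.ofReal (expS N)) volume) :
    MemLp (fun x => |d x| ^ qexp N) (ENNReal.ofReal ((N : ℝ) / 2)) volume ∧
    (eLpNorm (fun x => |d x| ^ qexp N) (ENNReal.ofReal ((N : ℝ) / 2)) volume).toReal =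
      nS d ^ qexp N := by
  have h := three_le_cast (N := N)
  have h2 : (N : ℝ) - 2 ≠ 0 := by linarith
  have hq := qexp_pos (N := N)
  have e := eLpNorm_norm_rpow (p := ENNReal.ofReal ((N : ℝ) / 2)) (μ := volume) d hq
  have e2 : ENNReal.ofReal ((N : ℝ) / 2) * ENNReal.ofReal (qexp N) = ENNReal.ofReal (expS N) := by
    rw [← ENNReal.ofReal_mul (by positivity)]
    congr 1
    rw [qexp, expS]; field_simp
    norm_num
  rw [e2] at e
  simp only [Real.norm_eq_abs] at e
  refine ⟨⟨continuous_abs_rpow.comp_aestronglyMeasurable hd.1, ?_⟩, ?_⟩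
  · rw [e]
    exact ENNReal.rpow_lt_top_of_nonneg hq.le hd.eLpNorm_lt_top.ne
  · rw [e, nS, ENNReal.toReal_rpow]

/-- The rescaled ground state is a multiple of the bracket with constant `κ λ²`, hence in `Ḣ¹`. -/
theorem scaleHDot1_W_memHDot1 {r : ℝ} (hr : 0 < r) : MemHDot1 (scaleHDot1 r (W N)) := by
  have hκ := kap_pos hN.out
  have h := (jap_memHDot1 (N := N) hN.out (κ := kap N * r ^ 2) (by positivity) le_rfl).smul
    (r ^ (-(((N : ℝ) - 2) / 2)))
  have e : scaleHDot1 r (W N) = r ^ (-(((N : ℝ) - 2) / 2)) •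
      (jap (kap N * r ^ 2) (((N : ℝ) - 2) / 2) : Space N → ℝ) := by
    funext x
    rw [W_eq, scaleHDot1, Pi.smul_apply, smul_eq_mul, jap, jap, norm_smul, norm_inv,
      Real.norm_eq_abs, abs_of_pos hr]
    congr 3
    field_simp
  rwa [e]

theorem scaleHDot1_W_pos {r : ℝ} (hr : 0 < r) (x : Space N) : 0 < scaleHDot1 r (W N) x :=
  mul_pos (Real.rpow_pos_of_pos hr _) (jap_pos (kap_pos hN.out) _ _)

/-- At every scale, `W_λ^{4/(N-2)}` is the rescaled potential. -/
theorem scaleHDot1_W_rpow {r : ℝ} (hr : 0 < r) (x : Space N) :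
    scaleHDot1 r (W N) x ^ qexp N = potL N r x := by
  have h := three_le_cast (N := N)
  have h2 : (N : ℝ) - 2 ≠ 0 := by linarith
  have hκ := kap_pos hN.out
  rw [scaleHDot1, potL, W_eq, Real.mul_rpow (Real.rpow_nonneg hr.le _) (jap_pos hκ _ _).le,
    jap_rpow hκ, ← Real.rpow_mul hr.le, pot, ← Real.rpow_natCast, ← Real.rpow_neg hr.le]
  congr 2
  · rw [qexp]; push_cast; field_simp; norm_num
  · rw [qexp]; field_simp; norm_num

omit hN in
theorem IsRadial.inv {u : Space N → ℝ} (hu : IsRadial u) : Inv u := fun e => by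
  obtain ⟨φ, hφ⟩ := hu
  have h := ((ℝ ∙ e)ᗮ.reflection.measurePreserving).quasiMeasurePreserving.ae hφ
  filter_upwards [h, hφ] with x h1 h2
  rw [Function.comp_apply, h1, h2, LinearIsometryEquiv.norm_map]

end hess

/-! ### Coercivity of the Hessian near a two-bubble -/

section main
variable [hN : Fact (3 ≤ N)] {ν : ℝ} {Y Z : Space N → ℝ}

omit hN in
theorem energyNorm_sq {g : Pair N} : energyNorm g ^ 2 =
    (∫ x, ‖weakGradient g.1 x‖ ^ 2) + ∫ x, g.2 x ^ 2 := by
  refine Real.sq_sqrt (add_nonneg (integral_nonneg fun x => ?_) (integral_nonneg fun x => ?_)) <;>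
    exact sq_nonneg _

omit hN in
/-- The pairings with `α^±` dominate the component along the eigenfunction: in the sum of their
squares the cross terms with the velocity cancel. -/
theorem sum_alpha_sq_ge {g : Pair N} {r : ℝ} :
    ν ^ 2 * (r⁻¹ * ∫ x, scaleL2 r Y x * g.1 x) ^ 2 ≤
      2 * (pairing₂ (alphaMinus ν Y r) g ^ 2 + pairing₂ (alphaPlus ν Y r) g ^ 2) := by
  set I1 := ∫ x, scaleL2 r Y x * g.1 x with hI1
  set I2 := ∫ x, scaleL2 r Y x * g.2 x with hI2
  have e1 : pairing (((1 / 2 : ℝ) • ((ν / r) • scaleL2 r Y))) g.1 = 1 / 2 * (ν / r) * I1 := by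
    rw [pairing, hI1, ← integral_const_mul]
    refine integral_congr_ae (ae_of_all _ fun x => ?_)
    simp only [Pi.smul_apply, smul_eq_mul]; ring
  have e2 : pairing ((1 / 2 : ℝ) • scaleL2 r Y) g.2 = 1 / 2 * I2 := by
    rw [pairing, hI2, ← integral_const_mul]
    refine integral_congr_ae (ae_of_all _ fun x => ?_)
    simp only [Pi.smul_apply, smul_eq_mul]; ring
  have e3 : pairing ((1 / 2 : ℝ) • -scaleL2 r Y) g.2 = -(1 / 2 * I2) := by
    rw [pairing, hI2, ← integral_const_mul, ← integral_neg]
    refine integral_congr_ae (ae_of_all _ fun x => ?_)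
    simp only [Pi.smul_apply, Pi.neg_apply, smul_eq_mul]; ring
  have m : pairing₂ (alphaMinus ν Y r) g = 1 / 2 * (ν / r) * I1 + -(1 / 2 * I2) := by
    rw [← e1, ← e3]; rfl
  have p : pairing₂ (alphaPlus ν Y r) g = 1 / 2 * (ν / r) * I1 + 1 / 2 * I2 := by
    rw [← e1, ← e2]; rfl
  rw [m, p]
  have : ν ^ 2 * (r⁻¹ * I1) ^ 2 = (ν / r * I1) ^ 2 := by rw [div_eq_mul_inv]; ring
  rw [this]
  nlinarith [sq_nonneg I2]

/-- The potential `|U|^{4/(N-2)}` near a two-bubble is close to the sum of the two potentials. -/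
theorem exists_potential_le {δ : ℝ} (hδ : 0 < δ) : ∃ η : ℝ, 0 < η ∧
    ∀ l₁ l₂ : ℝ, 0 < l₁ → 0 < l₂ → ∀ u : HDot N, ∀ d : HDot N,
      u.1 = (scaleHDot1 l₂ (W N) - scaleHDot1 l₁ (W N)) + d.1 → ‖gradLp d‖ < η →
      ∀ g : HDot N, Inv g.1 → ∫ x, |u.1 x| ^ qexp N * g.1 x * g.1 x ≤
        (∫ x, potL N l₁ x * g.1 x * g.1 x) + (∫ x, potL N l₂ x * g.1 x * g.1 x) +
          δ * dir g g := by
  obtain ⟨K, hK0, hK⟩ := exists_integral_potL_le (N := N)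
  have hq := qexp_pos (N := N)
  have hs := sob_pos (N := N)
  set δ' : ℝ := δ / (4 * K + 1)
  have hδ' : 0 < δ' := by positivity
  have hδK : δ' * (2 * K) ≤ δ / 2 := by
    rw [div_mul_eq_mul_div, div_le_div_iff₀ (by positivity) two_pos]
    nlinarith
  -- the loss `δ'` in front of the bubbles is paid by the uniform bound `hK`
  obtain ⟨C, hC0, hC⟩ := exists_abs_add_rpow_le hq hδ'
  have hlim : ∃ η : ℝ, 0 < η ∧ C * ((sob N * η) ^ qexp N * sob N ^ 2) ≤ δ / 2 := by
    have hc : Tendsto (fun η : ℝ => C * ((sob N * η) ^ qexp N * sob N ^ 2)) (𝓝[>] 0) (𝓝 0) := by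
      have h1 : Tendsto (fun η : ℝ => sob N * η) (𝓝[>] 0) (𝓝 (sob N * 0)) :=
        (tendsto_id.mono_left nhdsWithin_le_nhds).const_mul _
      have h2 := ((h1.rpow_const (p := qexp N) (Or.inr hq.le)).mul_const (sob N ^ 2)).const_mul C
      simpa [Real.zero_rpow hq.ne'] using h2
    obtain ⟨η, h1, h2⟩ := ((hc.eventually (eventually_le_nhds (half_pos hδ))).and
      self_mem_nhdsWithin).exists
    exact ⟨η, h2, h1⟩
  obtain ⟨η, hη0, hη⟩ := hlim
  refine ⟨η, hη0, fun l₁ l₂ h1 h2 u d hud hd g hg => ?_⟩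
  obtain ⟨hm, hn⟩ := abs_rpow_qexp_memLp (hdot_memLp d)
  have hmu := (abs_rpow_qexp_memLp (hdot_memLp u)).1
  have J : ∀ {a : Space N → ℝ}, MemLp a (ENNReal.ofReal ((N : ℝ) / 2)) volume →
      Integrable (fun x => a x * g.1 x * g.1 x) volume := fun ha =>
    integrable_mul_of_memLp (MemLp.mul_H_S ha (hdot_memLp g)) (hdot_memLp g)
  have j1 := J (potL_memLp (N := N) h1)
  have j2 := J (potL_memLp (N := N) h2)
  have j3 := J hm
  have hpt : ∀ x, |u.1 x| ^ qexp N * g.1 x * g.1 x ≤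
      (1 + δ') * (potL N l₁ x * g.1 x * g.1 x + potL N l₂ x * g.1 x * g.1 x) +
        C * (|d.1 x| ^ qexp N * g.1 x * g.1 x) := fun x => by
    have a1 := hC (scaleHDot1 l₂ (W N) x - scaleHDot1 l₁ (W N) x) (d.1 x)
    have a2 := abs_sub_rpow_le hq (scaleHDot1_W_pos (N := N) h2 x).le
      (scaleHDot1_W_pos (N := N) h1 x).le
    rw [scaleHDot1_W_rpow h1, scaleHDot1_W_rpow h2] at a2
    have a3 : u.1 x = scaleHDot1 l₂ (W N) x - scaleHDot1 l₁ (W N) x + d.1 x := by rw [hud]; rfl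
    rw [← a3] at a1
    have a4 : |u.1 x| ^ qexp N ≤ (1 + δ') * (potL N l₂ x + potL N l₁ x) + C * |d.1 x| ^ qexp N :=
      a1.trans (by gcongr)
    have a5 := mul_le_mul_of_nonneg_right a4 (mul_self_nonneg (g.1 x))
    linarith only [a5]
  have hI := integral_mono (J hmu) (((j1.add j2).const_mul (1 + δ')).add (j3.const_mul C)) hpt
  have e1 := integral_add ((j1.add j2).const_mul (1 + δ')) (j3.const_mul C)
  have e2 := integral_add j1 j2
  simp only [Pi.add_apply] at e1 hI
  rw [e1, integral_const_mul, integral_const_mul, e2] at hI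
  have b1 := hK l₁ h1 g hg
  have b2 := hK l₂ h2 g hg
  have b3 : ∫ x, |d.1 x| ^ qexp N * g.1 x * g.1 x ≤
      (sob N * η) ^ qexp N * sob N ^ 2 * dir g g := by
    refine (le_abs_self _).trans ((abs_wform_le _ hm g g).trans ?_)
    rw [hn, ← sq, ← dir_self]
    have : nS d.1 ≤ sob N * η := (sobolev d).trans (by gcongr)
    have hdg : 0 ≤ dir g g := by rw [dir_self]; positivity
    have := nS_nonneg d.1
    gcongr
  have hdg : 0 ≤ dir g g := by rw [dir_self]; positivity
  have c1 := mul_le_mul_of_nonneg_left (add_le_add b1 b2) hδ'.le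
  have c2 := mul_le_mul_of_nonneg_left b3 hC0
  have c3 := mul_le_mul_of_nonneg_right hδK hdg
  have c4 := mul_le_mul_of_nonneg_right hη hdg
  linarith only [hI, c1, c2, c3, c4]

end main

end TwoBubble

end

theorem mainTheorem6 (N : ℕ) (hN : 3 ≤ N)
    (ν : ℝ) (Y : TwoBubble.Space N → ℝ) (hY : TwoBubble.IsNegativeEigenpair N ν Y)
    (Z : TwoBubble.Space N → ℝ) (hZ : TwoBubble.IsTest Z)
    (hZW : 0 < TwoBubble.pairing Z (TwoBubble.scalingGenerator (TwoBubble.W N)))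
    (hZY : TwoBubble.pairing Z Y = 0) :
    ∃ l₀ > (0 : ℝ), ∃ η > (0 : ℝ), ∃ c > (0 : ℝ),
      ∀ l₁ l₂ : ℝ, 0 < l₁ → 0 < l₂ → l₁ / l₂ < l₀ →
      ∀ U : TwoBubble.Pair N, TwoBubble.MemEnergySpace U →
        TwoBubble.energyNorm (U - (TwoBubble.bubble N l₂ - TwoBubble.bubble N l₁)) < η →
      ∀ g : TwoBubble.Pair N, TwoBubble.MemEnergySpace g →
        TwoBubble.pairing (TwoBubble.scaleL2 l₁ Z) g.1 = 0 →
        TwoBubble.pairing (TwoBubble.scaleL2 l₂ Z) g.1 = 0 →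
        c * TwoBubble.energyNorm g ^ 2 ≤
          1 / 2 * TwoBubble.hessian U g +
            2 * (TwoBubble.pairing₂ (TwoBubble.alphaMinus ν Y l₁) g ^ 2 +
              TwoBubble.pairing₂ (TwoBubble.alphaPlus ν Y l₁) g ^ 2 +
              TwoBubble.pairing₂ (TwoBubble.alphaMinus ν Y l₂) g ^ 2 +
              TwoBubble.pairing₂ (TwoBubble.alphaPlus ν Y l₂) g ^ 2) := by
  open TwoBubble in
  have : Fact (3 ≤ N) := ⟨hN⟩
  obtain ⟨l₀, hl₀, c, hc, H⟩ := hY.two_coercive hZ hZW hZY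
  have hp : 0 < pexp N := by linarith [one_lt_pexp hN]
  obtain ⟨η, hη, hpot⟩ := exists_potential_le (N := N) (δ := c / (2 * pexp N)) (by positivity)
  -- half of the coercivity constant `c` pays for replacing the potential, and the Hessian carries a
  -- factor `1/2`
  refine ⟨l₀, hl₀, η, hη, min (1 / 2) (c / 4), by positivity, ?_⟩
  intro l₁ l₂ h1 h2 h12 U hU hUη g hg hZ1 hZ2
  obtain ⟨⟨hU1, -⟩, hU2, -⟩ := hU
  obtain ⟨⟨hg1, hgr⟩, hg2, -⟩ := hg
  set u : HDot N := ⟨U.1, hU1⟩ with hu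
  set gH : HDot N := ⟨g.1, hg1⟩ with hgH
  set b₁ : HDot N := ⟨scaleHDot1 l₁ (W N), scaleHDot1_W_memHDot1 h1⟩ with hb1
  set b₂ : HDot N := ⟨scaleHDot1 l₂ (W N), scaleHDot1_W_memHDot1 h2⟩ with hb2
  set d : HDot N := u - (b₂ - b₁) with hd
  have hud : u.1 = (scaleHDot1 l₂ (W N) - scaleHDot1 l₁ (W N)) + d.1 := by
    have : u = (b₂ - b₁) + d := by rw [hd]; abel
    calc u.1 = ((b₂ - b₁) + d).1 := by rw [← this]
      _ = _ := rfl
  have hdn : ‖gradLp d‖ < η := by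
    refine lt_of_le_of_lt (Real.le_sqrt_of_sq_le ?_) hUη
    rw [← dir_self, dir_self_eq_integral_of (gradLp_ae d)]
    refine le_add_of_le_of_nonneg le_rfl ?_
    exact MeasureTheory.integral_nonneg fun x => sq_nonneg _
  have hinv : Inv gH.1 := hgr.inv
  have k1 := H l₁ l₂ h1 h2 h12 gH hinv
  have k2 := hpot l₁ l₂ h1 h2 u d hud hdn gH hinv
  have k3 := sum_alpha_sq_ge (ν := ν) (Y := Y) (g := g) (r := l₁)
  have k4 := sum_alpha_sq_ge (ν := ν) (Y := Y) (g := g) (r := l₂)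
  have z1 : ∫ x, scaleL2 l₁ Z x * g.1 x = 0 := hZ1
  have z2 : ∫ x, scaleL2 l₂ Z x * g.1 x = 0 := hZ2
  have hD : dir gH gH = ∫ x, ‖weakGradient g.1 x‖ ^ 2 := dir_self_eq_integral_of (gradLp_ae gH)
  have hh : hessian U g = (∫ x, g.2 x ^ 2) + dir gH gH -
      pexp N * ∫ x, |U.1 x| ^ qexp N * g.1 x * g.1 x := by
    rw [hessian_eq hU1 hU2 hg1 hg2, hD, ← MeasureTheory.integral_const_mul]
    congr 1
    refine MeasureTheory.integral_congr_ae (MeasureTheory.ae_of_all _ fun x => ?_)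
    simp only
    ring
  rw [energyNorm_sq, ← hD, hh]
  simp only [hgH] at k1 k2
  rw [z1, z2] at k1
  have hD0 : 0 ≤ dir gH gH := by rw [dir_self]; positivity
  have hV0 : 0 ≤ ∫ x, g.2 x ^ 2 := MeasureTheory.integral_nonneg fun x => sq_nonneg _
  have k5 := mul_le_mul_of_nonneg_left k2 hp.le
  have e5 : pexp N * (c / (2 * pexp N) * dir gH gH) = c / 2 * dir gH gH := by field_simp
  rw [mul_add, e5] at k5
  have m1 := mul_le_mul_of_nonneg_right (min_le_left (1 / 2) (c / 4)) hV0
  have m2 := mul_le_mul_of_nonneg_right (min_le_right (1 / 2) (c / 4)) hD0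
  norm_num at k1
  linarith only [k1, k3, k4, k5, m1, m2]
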